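/- Notation. Write $s=\sigma+it$ for a complex variable, $\mathbb P$ for the set of primes and $\mathbb N_0$ for the set of non-negative integers. For an open set $G\subset\mathbb C$ let $H(G)$ be the space of analytic functions on $G$ with the topology of uniform convergence on compacta. The class $\widetilde S$. A function $\varphi$ belongs to $\widetilde S$ if (i) $\varphi(s)=\sum_{m=1}^\infty a(m)m^{-s}$ for $\sigma>1$, with $a(m)=O(m^\varepsilon)$ for every $\varepsilon>0$; (ii) there is $\sigma_\varphi<1$ such that $\varphi$ continues meromorphically to $\sigma>\sigma_\varphi$ and is holomorphic there except for at most a pole at $s=1$; (iii) there is $c\ge 0$ such that $\varphi(\sigma+it)=O(|t|^{c+\varepsilon})$ as $|t|\to\infty$ for every fixed $\sigma>\sigma_\varphi$ and $\varepsilon>0$; (iv) for some $l\in\mathbb N$ and $a_j(p)\in\mathbb C$, $\varphi(s)=\prod_{p\in\mathbb P}\prod_{j=1}^{l}\bigl(1-a_j(p)p^{-s}\bigr)^{-1}$ for $\sigma>1$; (v) there is $\kappa>0$ with $\lim_{x\to\infty}\frac1{\pi(x)}\sum_{p\le x}|a(p)|^2=\kappa$, where $\pi(x)$ is the number of primes $p\le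 x$. For $\varphi\in\widetilde S$ let $\sigma^*$ be the infimum of all real $\sigma_1$ such that $\varphi$ is holomorphic on $\sigma\ge\sigma_1$ except possibly at $s=1$ and, for every $\sigma\ge\sigma_1$ with $\sigma\ne1$, the series on the right converges and $$\lim_{T\to\infty}\frac1{2T}\int_{-T}^{T}|\varphi(\sigma+it)|^2\,dt=\sum_{m=1}^\infty\frac{|a(m)|^2}{m^{2\sigma}}.$$ The random element. Let $\gamma=\{z\in\mathbb C:|z|=1\}$, $\Omega_1=\prod_{p\in\mathbb P}\gamma$, $\Omega_2=\prod_{m\in\mathbb N_0}\gamma$, and let $m_H$ be the product of the probability Haar measures on $\Omega_1$ and $\Omega_2$, a measure on $\Omega=\Omega_1\times\Omega_2$. For $\omega_1\in\Omega_1$ and $m=p_1^{l_1}\cdots p_r^{l_r}$ put $\omega_1(m)=\prod_{j}\omega_1(p_j)^{l_j}$. Let $0<\alpha\le1$, and let $(b_m)_{m\in\mathbb N_0}$ be a periodic sequence of complex numbers, not all zero. Let $\sigma^*<\sigma_0<1$, $M>0$, $T>0$, and $$D_M=\{s:\sigma_0<\sigma<1,\ |t|<M\},\qquad D_T=\{s:\tfrac12<\sigma<1,\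 |t|<T\}.$$ For $\omega=(\omega_1,\omega_2)\in\Omega$ let $Z(\omega)=(\varphi(\cdot,\omega_1),\zeta(\cdot,\omega_2))\in H(D_M)\times H(D_T)$, where $$\varphi(s,\omega_1)=\sum_{k=1}^\infty\frac{a(k)\omega_1(k)}{k^s},\qquad \zeta(s,\omega_2)=\sum_{m=0}^\infty\frac{b_m\omega_2(m)}{(m+\alpha)^s},$$ and let $P_Z(A)=m_H\{\omega\in\Omega: Z(\omega)\in A\}$, for Borel sets $A\subset H(D_M)\times H(D_T)$, be the distribution of $Z$. Theorem. Let $\varphi\in\widetilde S$ and $h>0$, and suppose that the set $$L(\mathbb P,\alpha,h)=\{\log p:p\in\mathbb P\}\cup\{\log(m+\alpha):m\in\mathbb N_0\}\cup\{2\pi/h\}$$ is linearly independent over $\mathbb Q$. Then both series converge uniformly on compacta of $D_M$ and $D_T$, respectively, for almost all $\omega\in\Omega$ (so that $Z$ is an $H(D_M)\times H(D_T)$-valued random element, defined almost surely), and the support of $P_Z$ is $S_\varphi\times H(D_T)$, where $S_\varphi$ is the set of all $f\in H(D_M)$ that are non-vanishing on $D_M$ or identically zero on $D_M$. -/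

import Mathlib

open MeasureTheory Filter Topology TopologicalSpace
open scoped Real

noncomputable section

namespace MixedUniversality

/-! ### The class `S̃` and the mean-square abscissa `σ*` -/

/-- `φ` belongs to the class `S̃`, and `a` is the sequence of its Dirichlet coefficients
(the value `a 0` plays no role). As a function on `ℂ`, `φ` only matters on the half-plane
`σ > σφ` without the point `1`. -/
structure IsSteuding (φ : ℂ → ℂ) (a : ℕ → ℂ) : Prop where
  /-- `a(m) = O(m^ε)` for every `ε > 0`. -/
  coeff_isBigO : ∀ ε : ℝ, 0 < ε → a =O[atTop] fun m : ℕ => (m : ℝ) ^ ε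
  /-- `φ(s) = ∑_{m ≥ 1} a(m) m^{-s}` for `σ > 1`. -/
  dirichlet : ∀ s : ℂ, 1 < s.re → LSeriesHasSum a s (φ s)
  /-- Meromorphic continuation to `σ > σφ` with `σφ < 1`, holomorphic except for at most a
  pole at `s = 1`, with polynomial growth on every vertical line of that half-plane. -/
  continuation : ∃ σφ : ℝ, σφ < 1 ∧
    MeromorphicOn φ {s : ℂ | σφ < s.re} ∧
    DifferentiableOn ℂ φ ({s : ℂ | σφ < s.re} \ {1}) ∧
    ∃ c : ℝ, 0 ≤ c ∧ ∀ σ : ℝ, σφ < σ → ∀ ε : ℝ, 0 < ε →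
      (fun t : ℝ => φ (σ + t * Complex.I)) =O[Bornology.cobounded ℝ] fun t : ℝ => |t| ^ (c + ε)
  /-- The Euler product `φ(s) = ∏_p ∏_{j ≤ l} (1 - a_j(p) p^{-s})⁻¹` for `σ > 1`. -/
  euler : ∃ (l : ℕ) (A : Fin l → Nat.Primes → ℂ), ∀ s : ℂ, 1 < s.re →
    (∀ (j : Fin l) (p : Nat.Primes), 1 - A j p / (p : ℂ) ^ s ≠ 0) ∧
    HasProd (fun p : Nat.Primes => ∏ j : Fin l, (1 - A j p / (p : ℂ) ^ s)⁻¹) (φ s)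
  /-- The mean value of `|a(p)|²` over the primes is some `κ > 0`. -/
  prime_mean : ∃ κ : ℝ, 0 < κ ∧
    Tendsto (fun x : ℕ => (∑ p ∈ Nat.primesLE x, ‖a p‖ ^ 2) / (Nat.primeCounting x : ℝ))
      atTop (𝓝 κ)

/-- The mean-square formula on the line `Re s = σ`:
`(1/2T) ∫_{-T}^{T} |φ(σ+it)|² dt → ∑_{m ≥ 1} |a(m)|² m^{-2σ}`, the series being convergent. -/
def MeanSquareFormula (φ : ℂ → ℂ) (a : ℕ → ℂ) (σ : ℝ) : Prop :=
  Summable (fun m : ℕ => ‖a (m + 1)‖ ^ 2 / ((m + 1 : ℕ) : ℝ) ^ (2 * σ)) ∧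
  Tendsto (fun T : ℝ => 1 / (2 * T) * ∫ t in (-T)..T, ‖φ (σ + t * Complex.I)‖ ^ 2) atTop
    (𝓝 (∑' m : ℕ, ‖a (m + 1)‖ ^ 2 / ((m + 1 : ℕ) : ℝ) ^ (2 * σ)))

/-- The abscissa `σ*`: the infimum of all `σ₁` such that `φ` is defined (and holomorphic, up to
the possible pole at `1`) on `σ ≥ σ₁` and the mean-square formula holds for every `σ ≥ σ₁`.
The line `σ = 1`, which may pass through the pole, is left out. -/
def sigmaStar (φ : ℂ → ℂ) (a : ℕ → ℂ) : EReal :=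
  sInf ((fun σ : ℝ => (σ : EReal)) '' {σ₁ : ℝ |
    DifferentiableOn ℂ φ ({s : ℂ | σ₁ ≤ s.re} \ {1}) ∧
    ∀ σ : ℝ, σ₁ ≤ σ → σ ≠ 1 → MeanSquareFormula φ a σ})

/-- The set `L(ℙ, α, h)` of all `log p`, all `log (m + α)` with `m ≥ 0`, and `2π / h`. -/
def logSet (α h : ℝ) : Set ℝ :=
  Set.range (fun p : Nat.Primes => Real.log (p : ℕ)) ∪
    Set.range (fun m : ℕ => Real.log (m + α)) ∪ {2 * π / h}

/-! ### Spaces of analytic functions -/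

/-- `H(U)`: the analytic functions on the open set `U`, inside `C(U, ℂ)`, whose topology is that
of uniform convergence on compacta. -/
def holomorphic (U : Opens ℂ) : Submodule ℂ C(U, ℂ) where
  carrier := {f | ∃ g : ℂ → ℂ, DifferentiableOn ℂ g U ∧ ∀ z : U, f z = g z}
  zero_mem' := ⟨0, differentiableOn_const 0, fun _ => rfl⟩
  add_mem' := by
    rintro f₁ f₂ ⟨g₁, h₁, e₁⟩ ⟨g₂, h₂, e₂⟩
    exact ⟨g₁ + g₂, h₁.add h₂, fun z => by simp [e₁, e₂]⟩
  smul_mem' := by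
    rintro c f ⟨g, hg, e⟩
    exact ⟨c • g, hg.const_smul c, fun z => by simp [e]⟩

/-- The space `H(U)` as a type. -/
abbrev Hol (U : Opens ℂ) : Type := holomorphic U

/-- `H(U)` carries its Borel σ-algebra. -/
instance (U : Opens ℂ) : MeasurableSpace (Hol U) := borel _

instance (U : Opens ℂ) : BorelSpace (Hol U) := ⟨rfl⟩

/-- The σ-algebra of the product `H(U) × H(V)` is its Borel σ-algebra. -/
theorem borelSpace_prod (U V : Opens ℂ) : BorelSpace (Hol U × Hol V) := by
  have : LocallyCompactSpace U := U.isOpen.locallyCompactSpace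
  have : LocallyCompactSpace V := V.isOpen.locallyCompactSpace
  have : SecondCountableTopology (Hol U) := Topology.IsEmbedding.subtypeVal.secondCountableTopology
  have : SecondCountableTopology (Hol V) := Topology.IsEmbedding.subtypeVal.secondCountableTopology
  exact Prod.borelSpace

open Classical in
/-- The limit, uniform on compacta, of a sequence of functions on `U` in `H(U)`
(and `0` if there is no such limit). -/
def holLim (U : Opens ℂ) (F : ℕ → ℂ → ℂ) : Hol U :=
  if h : ∃ f : Hol U, TendstoLocallyUniformly (fun n (z : U) => F n z) f.1 atTop
  then h.choose else 0

/-- The open rectangle `{s : σ₁ < σ < 1, |t| < R}`. -/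
def rect (σ₁ R : ℝ) : Opens ℂ where
  carrier := {s : ℂ | σ₁ < s.re ∧ s.re < 1 ∧ |s.im| < R}
  is_open' := by
    have h₁ : IsOpen {s : ℂ | σ₁ < s.re} := isOpen_lt continuous_const Complex.continuous_re
    have h₂ : IsOpen {s : ℂ | s.re < 1} := isOpen_lt Complex.continuous_re continuous_const
    have h₃ : IsOpen {s : ℂ | |s.im| < R} :=
      isOpen_lt (continuous_abs.comp Complex.continuous_im) continuous_const
    exact h₁.inter (h₂.inter h₃)

/-! ### The torus and the random element -/

/-- The unit circle carries its Borel σ-algebra. -/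
instance : MeasurableSpace Circle := borel _

instance : BorelSpace Circle := ⟨rfl⟩

/-- `Ω₁`, the product of unit circles over all primes. -/
abbrev Ω₁ : Type := Nat.Primes → Circle

/-- `Ω₂`, the product of unit circles over all non-negative integers. -/
abbrev Ω₂ : Type := ℕ → Circle

/-- The product of the probability Haar measures on `Ω₁` and `Ω₂`. -/
def mH : Measure (Ω₁ × Ω₂) :=
  (Measure.haarMeasure (⊤ : PositiveCompacts Ω₁)).prod
    (Measure.haarMeasure (⊤ : PositiveCompacts Ω₂))

/-- The completely multiplicative extension `ω₁(m) = ∏_{p^e ∥ m} ω₁(p)^e` of `ω₁ ∈ Ω₁`. -/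
def multExt (ω₁ : Ω₁) (m : ℕ) : Circle :=
  ∏ p ∈ m.primeFactors.attach,
    ω₁ ⟨p.1, Nat.prime_of_mem_primeFactors p.2⟩ ^ m.factorization p.1

/-- Partial sums of `φ(s, ω₁) = ∑_{k ≥ 1} a(k) ω₁(k) k^{-s}`. -/
def phiPartial (a : ℕ → ℂ) (ω₁ : Ω₁) (n : ℕ) (s : ℂ) : ℂ :=
  ∑ k ∈ Finset.Icc 1 n, a k * (multExt ω₁ k : ℂ) / (k : ℂ) ^ s

/-- Partial sums of `ζ(s, α, ω₂; 𝔅) = ∑_{m ≥ 0} b_m ω₂(m) (m + α)^{-s}`. -/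
def zetaPartial (b : ℕ → ℂ) (α : ℝ) (ω₂ : Ω₂) (n : ℕ) (s : ℂ) : ℂ :=
  ∑ m ∈ Finset.range n, b m * (ω₂ m : ℂ) / ((m : ℂ) + α) ^ s

/-- The random element `Z(ω) = (φ(·, ω₁), ζ(·, α, ω₂; 𝔅))` of `H(D₁) × H(D₂)`. -/
def Z (a b : ℕ → ℂ) (α : ℝ) (D₁ D₂ : Opens ℂ) (ω : Ω₁ × Ω₂) : Hol D₁ × Hol D₂ :=
  (holLim D₁ (phiPartial a ω.1), holLim D₂ (zetaPartial b α ω.2))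

/-- The distribution `P_Z` of the random element `Z`. -/
def PZ (a b : ℕ → ℂ) (α : ℝ) (D₁ D₂ : Opens ℂ) : Measure (Hol D₁ × Hol D₂) :=
  mH.map (Z a b α D₁ D₂)

/-- The set of the functions of `H(D)` that are non-vanishing on `D` or identically zero. -/
def nonvanishingOrZero (D : Opens ℂ) : Set (Hol D) :=
  {f | (∀ z : D, f.1 z ≠ 0) ∨ f = 0}

end MixedUniversality

end

/-! Convergence. Under Haar measure the characters `multExt ω m` (m ≥ 1), and likewise the
coordinates of `Ω₂`, are orthonormal. A Rademacher–Menshov argument (`ae_tendsto_sum_of_orthogonal`)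
and Abel summation then give almost sure locally uniform convergence on Re s > 1/2. For the first
series the same argument, applied to the sum over primes only, shows that the limit is the
exponential of the sum of the logarithms of the local factors (`ae_tendsto_phiPartial`), since the
terms of second order converge absolutely there. This uses that the Euler parameters lie in the unit
disc (`IsSteuding.exists_eulerCoeff`). The rectangle D_M lies in that half-plane because the
mean-square series cannot converge to the left of 1/2 when |a(p)|² has a positive mean
(`half_lt_of_sigmaStar_lt`).

Upper bound for the support. The first component is almost surely an exponential, hence zero-free,
and by Hurwitz the set of functions that are zero-free or identically zero is closed
(`isClosed_nonvanishingOrZero`).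

Lower bound. The measure is a product, so each component may be treated alone. By
`measure_approx_pos` it suffices that suitable choices of the coordinates bring all long partial
sums close to the target: a small tail has positive probability, and finitely many coordinates can
be reset by group translations that leave the tail alone. For the Euler product the target is a
logarithm of the given zero-free function. The zero function is reached at the end as a limit of
nonzero constants.

The approximation is `exists_circle_sum_approx`, for sums of w_m c_m (m+α)^{-s} with |c_m| = 1.
First let the c_m range over the unit disc. If the sums missed a target on K, a Hahn–Banach
functional ℓ would make the sum of |w_m| |ℓ(e^{-s log(m+α)})| bounded. The weights have density
exponent one in every short logarithmic window (`LogDense`), so ρ(x) = ℓ(e^{-sx}) is O(e^{-(1-ε)x})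
at some point of each such window. Interpolation between these points extends the decay to all x,
with any rate β < 1 (`exists_norm_le_exp_of_nodes`). Hence the Laplace transform of ρ continues
holomorphically across K. It is minus the Cauchy transform of ℓ, so Cauchy's formula forces ℓ to
vanish on the target (`functional_eq_zero_of_decay`), a contradiction. Passing from the disc to the
circle costs at most the sum of the squared norms of the terms (`exists_circle_rounding`), a small
tail because the abscissa exceeds 1/2.

For the periodic weights, `LogDense` is a count in an arithmetic progression. For a(p) it needs a
positive proportion of the primes expected in (e^u, e^{u+δ}]. This is a weak Wiener–Ikehara theorem,
obtained with the Fejér kernel from the continuity of ζ'/ζ + 1/(s-1) up to Re s = 1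
(`exists_le_card_primes_window`). -/

noncomputable section

namespace MixedUniversality

/-! ### Almost sure convergence of orthogonal series -/

/-- The sum of the squared moduli of all dyadic block sums of `x` inside `[a, a + 2 ^ k)`. -/
def dyadicSq (x : ℕ → ℂ) : ℕ → ℕ → ℝ
  | 0, a => ‖x a‖ ^ 2
  | k + 1, a => dyadicSq x k a + dyadicSq x k (a + 2 ^ k) +
      ‖∑ i ∈ Finset.Ico a (a + 2 ^ k), x i‖ ^ 2

theorem dyadicSq_nonneg (x : ℕ → ℂ) (k a : ℕ) : 0 ≤ dyadicSq x k a := by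
  induction k generalizing a with
  | zero => simp only [dyadicSq]; positivity
  | succ k ih => simp only [dyadicSq]; have := ih a; have := ih (a + 2 ^ k); positivity

/-- Pathwise maximal inequality behind the Rademacher–Menshov theorem. -/
theorem norm_sq_sum_Ico_le_dyadicSq (x : ℕ → ℂ) (k a n : ℕ) (hn : n ≤ 2 ^ k) :
    ‖∑ i ∈ Finset.Ico a (a + n), x i‖ ^ 2 ≤ (k + 1) * dyadicSq x k a := by
  induction k generalizing a n with
  | zero =>
    simp only [pow_zero] at hn
    interval_cases n <;> simp [dyadicSq]
  | succ k ih =>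
    simp only [dyadicSq]
    have h1 := dyadicSq_nonneg x k a
    have h2 := dyadicSq_nonneg x k (a + 2 ^ k)
    push_cast
    rcases le_or_gt n (2 ^ k) with h | h
    · have := ih a n h
      nlinarith [sq_nonneg ‖∑ i ∈ Finset.Ico a (a + 2 ^ k), x i‖]
    · obtain ⟨m, rfl⟩ := Nat.exists_eq_add_of_le h.le
      have hm := ih (a + 2 ^ k) m (by rw [pow_succ] at hn; omega)
      rw [← Finset.sum_Ico_consecutive _ (Nat.le_add_right a (2 ^ k)) (by omega)]
      rw [add_assoc] at hm
      set u := ∑ i ∈ Finset.Ico a (a + 2 ^ k), x i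
      set v := ∑ i ∈ Finset.Ico (a + 2 ^ k) (a + (2 ^ k + m)), x i
      have huv : ‖u + v‖ ≤ ‖u‖ + ‖v‖ := norm_add_le u v
      have h3 : ‖u + v‖ ^ 2 ≤ (‖u‖ + ‖v‖) ^ 2 := by gcongr
      have hk : (0 : ℝ) ≤ k := Nat.cast_nonneg k
      -- Cauchy–Schwarz with weights 1 : k+1 between the full left half and the remaining piece, so
      -- the constant grows by only one per level.
      have h4 : ((k : ℝ) + 1) * (‖u‖ + ‖v‖) ^ 2 ≤
          (k + 1) * ((k + 2) * ‖u‖ ^ 2) + (k + 2) * ‖v‖ ^ 2 := by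
        nlinarith [sq_nonneg (((k : ℝ) + 1) * ‖u‖ - ‖v‖)]
      have h5 : ((k : ℝ) + 1) * ‖u + v‖ ^ 2 ≤
          (k + 1) * ((k + 1 + 1) * (dyadicSq x k a + dyadicSq x k (a + 2 ^ k) + ‖u‖ ^ 2)) := by
        nlinarith [mul_nonneg (mul_nonneg hk hk) h1, mul_nonneg hk h1]
      exact le_of_mul_le_mul_left h5 (by positivity)

/-- The maximal inequality on [2^k, 2^{k+1}] bounds by B q^k both the step between consecutive
dyadic partial sums and the oscillation in between. -/
theorem tendsto_sum_of_dyadicSq_le (x : ℕ → ℂ) (B q : ℝ) (hq₀ : 0 ≤ q) (hq₁ : q < 1)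
    (h : ∀ k : ℕ, (k + 1) * dyadicSq x k (2 ^ k) ≤ (B * q ^ k) ^ 2) (hB : 0 ≤ B) :
    ∃ L, Tendsto (fun n => ∑ k ∈ Finset.range n, x k) atTop (𝓝 L) := by
  set S : ℕ → ℂ := fun n => ∑ k ∈ Finset.range n, x k with hS
  have key : ∀ k n : ℕ, 2 ^ k ≤ n → n ≤ 2 ^ (k + 1) → dist (S (2 ^ k)) (S n) ≤ B * q ^ k := by
    intro k n h1 h2
    obtain ⟨m, rfl⟩ := Nat.exists_eq_add_of_le h1
    have h3 := (norm_sq_sum_Ico_le_dyadicSq x k (2 ^ k) m (by rw [pow_succ] at h2; omega)).trans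
      (h k)
    rw [Finset.sum_Ico_eq_sub _ (Nat.le_add_right _ _)] at h3
    rw [dist_comm, dist_eq_norm]
    exact le_of_sq_le_sq h3 (by positivity)
  have hc : CauchySeq fun k => S (2 ^ k) :=
    cauchySeq_of_le_geometric q B hq₁ fun k =>
      key k _ (Nat.pow_le_pow_right (by norm_num) (by omega)) le_rfl
  obtain ⟨L, hL⟩ := cauchySeq_tendsto_of_complete hc
  have hlog : Tendsto (fun n => Nat.log 2 n) atTop atTop := by
    refine tendsto_atTop_atTop.2 fun k => ⟨2 ^ k, fun n hn => ?_⟩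
    exact Nat.le_log_of_pow_le (by norm_num) hn
  refine ⟨L, ?_⟩
  have h1 : Tendsto (fun n => S (2 ^ Nat.log 2 n)) atTop (𝓝 L) := hL.comp hlog
  have h2 : Tendsto (fun n : ℕ => B * q ^ Nat.log 2 n) atTop (𝓝 0) := by
    have := ((tendsto_pow_atTop_nhds_zero_of_lt_one hq₀ hq₁).const_mul B).comp hlog
    simpa [Function.comp_def] using this
  refine tendsto_of_tendsto_of_dist h1 ?_
  refine squeeze_zero' (Eventually.of_forall fun _ => dist_nonneg) ?_ h2
  filter_upwards [eventually_ge_atTop 1] with n hn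
  exact key _ n (Nat.pow_log_le_self 2 (by omega)) (Nat.lt_pow_succ_log_self (by norm_num) n).le

section Probability

variable {Ω : Type*} [MeasurableSpace Ω] {μ : Measure Ω} [IsProbabilityMeasure μ]

theorem integral_norm_sq_sum_of_orthogonal {X : ℕ → Ω → ℂ}
    (hm : ∀ n, Measurable (X n)) (B : ℕ → ℝ) (hb : ∀ n ω, ‖X n ω‖ ≤ B n)
    (horth : ∀ m n, m ≠ n → ∫ ω, X m ω * starRingEnd ℂ (X n ω) ∂μ = 0) (s : Finset ℕ) :
    ∫ ω, ‖∑ i ∈ s, X i ω‖ ^ 2 ∂μ = ∑ i ∈ s, ∫ ω, ‖X i ω‖ ^ 2 ∂μ := by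
  have h_int : ∀ i j, Integrable (fun ω => X i ω * starRingEnd ℂ (X j ω)) μ := by
    intro i j
    refine Integrable.of_bound (C := B i * B j)
      (((hm i).mul (Complex.continuous_conj.measurable.comp (hm j))).aestronglyMeasurable)
      (Eventually.of_forall fun ω => ?_)
    rw [norm_mul, RCLike.norm_conj]
    exact mul_le_mul (hb i ω) (hb j ω) (norm_nonneg _) ((norm_nonneg _).trans (hb i ω))
  have h1 : ∀ z : ℂ, ((‖z‖ ^ 2 : ℝ) : ℂ) = z * starRingEnd ℂ z := by
    intro z; rw [Complex.mul_conj, Complex.normSq_eq_norm_sq]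
  have h2 : ((∫ ω, ‖∑ i ∈ s, X i ω‖ ^ 2 ∂μ : ℝ) : ℂ) =
      ((∑ i ∈ s, ∫ ω, ‖X i ω‖ ^ 2 ∂μ : ℝ) : ℂ) := by
    rw [← integral_complex_ofReal]
    push_cast
    simp_rw [← Complex.ofReal_pow, h1, map_sum, Finset.sum_mul_sum]
    rw [integral_finsetSum _ fun i _ => integrable_finsetSum _ fun j _ => h_int i j]
    refine Finset.sum_congr rfl fun i hi => ?_
    rw [integral_finsetSum _ fun j _ => h_int i j, Finset.sum_eq_single i]
    · rw [← integral_complex_ofReal]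
      simp_rw [h1]
    · intro j _ hji; exact horth i j hji.symm
    · intro h; exact absurd hi h
  exact_mod_cast h2

theorem integrable_norm_sq_sum {X : ℕ → Ω → ℂ}
    (hm : ∀ n, Measurable (X n)) (B : ℕ → ℝ) (hb : ∀ n ω, ‖X n ω‖ ≤ B n) (s : Finset ℕ) :
    Integrable (fun ω => ‖∑ i ∈ s, X i ω‖ ^ 2) μ := by
  refine Integrable.of_bound (C := (∑ i ∈ s, B i) ^ 2)
    ((Finset.measurable_sum _ fun i _ => hm i).norm.pow_const 2).aestronglyMeasurable
    (Eventually.of_forall fun ω => ?_)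
  rw [Real.norm_of_nonneg (by positivity)]
  gcongr
  exact (norm_sum_le _ _).trans (Finset.sum_le_sum fun i _ => hb i ω)

/-- By orthogonality the blocks on one level contribute at most the total variance, and there are
k+1 levels. -/
theorem integrable_dyadicSq_and_integral_le {X : ℕ → Ω → ℂ}
    (hm : ∀ n, Measurable (X n)) (B : ℕ → ℝ) (hb : ∀ n ω, ‖X n ω‖ ≤ B n)
    (horth : ∀ m n, m ≠ n → ∫ ω, X m ω * starRingEnd ℂ (X n ω) ∂μ = 0) (k a : ℕ) :
    Integrable (fun ω => dyadicSq (fun i => X i ω) k a) μ ∧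
    ∫ ω, dyadicSq (fun i => X i ω) k a ∂μ ≤
      (k + 1) * ∑ i ∈ Finset.Ico a (a + 2 ^ k), ∫ ω, ‖X i ω‖ ^ 2 ∂μ := by
  induction k generalizing a with
  | zero =>
    simp only [dyadicSq]
    refine ⟨?_, ?_⟩
    · simpa using integrable_norm_sq_sum (μ := μ) hm B hb {a}
    · simp
  | succ k ih =>
    simp only [dyadicSq]
    obtain ⟨i1, h1⟩ := ih a
    obtain ⟨i2, h2⟩ := ih (a + 2 ^ k)
    have i3 := integrable_norm_sq_sum (μ := μ) hm B hb (Finset.Ico a (a + 2 ^ k))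
    refine ⟨(i1.add i2).add i3, ?_⟩
    have e1 : ∫ ω, (dyadicSq (fun i => X i ω) k a + dyadicSq (fun i => X i ω) k (a + 2 ^ k) +
        ‖∑ i ∈ Finset.Ico a (a + 2 ^ k), X i ω‖ ^ 2) ∂μ =
        ∫ ω, dyadicSq (fun i => X i ω) k a ∂μ + ∫ ω, dyadicSq (fun i => X i ω) k (a + 2 ^ k) ∂μ +
        ∫ ω, ‖∑ i ∈ Finset.Ico a (a + 2 ^ k), X i ω‖ ^ 2 ∂μ := by
      rw [← integral_add i1 i2]
      exact integral_add (i1.add i2) i3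
    rw [e1, integral_norm_sq_sum_of_orthogonal hm B hb horth]
    have e2 : a + 2 ^ (k + 1) = a + 2 ^ k + 2 ^ k := by rw [pow_succ]; omega
    rw [e2, ← Finset.sum_Ico_consecutive _ (Nat.le_add_right a (2 ^ k)) (Nat.le_add_right _ (2 ^ k))]
    have h3 : 0 ≤ ∑ i ∈ Finset.Ico (a + 2 ^ k) (a + 2 ^ k + 2 ^ k), ∫ ω, ‖X i ω‖ ^ 2 ∂μ :=
      Finset.sum_nonneg fun i _ => integral_nonneg fun ω => by positivity
    push_cast
    nlinarith

/-- An orthogonal series whose variances decay like `(k + 1) ^ (-1 - δ)` converges almost surely. -/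
theorem ae_tendsto_sum_of_orthogonal {X : ℕ → Ω → ℂ}
    (hm : ∀ n, Measurable (X n)) (C δ : ℝ) (hδ : 0 < δ) (hC : 0 ≤ C)
    (hb : ∀ n ω, ‖X n ω‖ ^ 2 ≤ C * ((n : ℝ) + 1) ^ (-(1 + δ)))
    (horth : ∀ m n, m ≠ n → ∫ ω, X m ω * starRingEnd ℂ (X n ω) ∂μ = 0) :
    ∀ᵐ ω ∂μ, ∃ L, Tendsto (fun n => ∑ k ∈ Finset.range n, X k ω) atTop (𝓝 L) := by
  have hb' : ∀ n ω, ‖X n ω‖ ≤ √(C * ((n : ℝ) + 1) ^ (-(1 + δ))) :=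
    fun n ω => Real.le_sqrt_of_sq_le (hb n ω)
  have hI := integrable_dyadicSq_and_integral_le (μ := μ) hm _ hb' horth
  -- The block [2^k, 2^{k+1}) has 2^k terms of variance at most C 2^{-k(1+δ)}, hence total variance
  -- at most C q^k.
  set q : ℝ := (2 : ℝ) ^ (-δ) with hq
  have hq0 : 0 < q := by positivity
  have hq1 : q < 1 := Real.rpow_lt_one_of_one_lt_of_neg (by norm_num) (by linarith)
  have hblock : ∀ k : ℕ, ∫ ω, dyadicSq (fun i => X i ω) k (2 ^ k) ∂μ ≤ (k + 1) * (C * q ^ k) := by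
    intro k
    refine (hI k (2 ^ k)).2.trans ?_
    gcongr
    have h1 : ∀ i ∈ Finset.Ico (2 ^ k) (2 ^ k + 2 ^ k),
        ∫ ω, ‖X i ω‖ ^ 2 ∂μ ≤ C * (((2 : ℝ) ^ k) ^ (-(1 + δ))) := by
      intro i hi
      have hi1 : (2 ^ k : ℝ) ≤ (i : ℝ) + 1 := by
        have : 2 ^ k ≤ i := (Finset.mem_Ico.1 hi).1
        have : ((2 ^ k : ℕ) : ℝ) ≤ i := by exact_mod_cast this
        push_cast at this; linarith
      have h2 : ∀ ω, ‖X i ω‖ ^ 2 ≤ C * (((2 : ℝ) ^ k) ^ (-(1 + δ))) := by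
        intro ω
        refine (hb i ω).trans ?_
        gcongr C * ?_
        exact Real.rpow_le_rpow_of_nonpos (by positivity) hi1 (by linarith)
      calc ∫ ω, ‖X i ω‖ ^ 2 ∂μ ≤ ∫ ω, C * (((2 : ℝ) ^ k) ^ (-(1 + δ))) ∂μ := by
            refine integral_mono_of_nonneg (Eventually.of_forall fun ω => by positivity)
              (integrable_const _) (Eventually.of_forall h2)
        _ = _ := by simp
    refine (Finset.sum_le_card_nsmul _ _ _ h1).trans (le_of_eq ?_)
    simp only [Nat.card_Ico, add_tsub_cancel_left, nsmul_eq_mul, Nat.cast_pow, Nat.cast_ofNat]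
    have h3 : ((2 : ℝ) ^ k) ^ (-(1 + δ)) = ((2 : ℝ) ^ k)⁻¹ * q ^ k := by
      rw [hq, ← Real.rpow_natCast, ← Real.rpow_natCast, ← Real.rpow_mul (by norm_num),
        ← Real.rpow_neg (by norm_num), ← Real.rpow_mul (by norm_num), ← Real.rpow_add (by norm_num)]
      congr 1; ring
    rw [h3]
    field_simp
  -- The decay q^k = r^k · r^k is split in two: one factor makes the expectations of the
  -- renormalised `Y k` summable, the other survives as pathwise decay of the blocks.
  set r : ℝ := √q with hr
  have hr0 : 0 < r := Real.sqrt_pos.2 hq0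
  have hr1 : r < 1 := by rw [hr, Real.sqrt_lt' one_pos]; simpa using hq1
  have hrq : r ^ 2 = q := Real.sq_sqrt hq0.le
  set Y : ℕ → Ω → ℝ := fun k ω => (k + 1) * (r ^ k)⁻¹ * dyadicSq (fun i => X i ω) k (2 ^ k) with hY
  have hY0 : ∀ k ω, 0 ≤ Y k ω := fun k ω => by
    have := dyadicSq_nonneg (fun i => X i ω) k (2 ^ k); positivity
  have hYint : ∀ k, Integrable (Y k) μ := fun k => (hI k (2 ^ k)).1.const_mul _
  have hYle : ∀ k, ∫ ω, Y k ω ∂μ ≤ C * (((k : ℝ) + 1) ^ 2 * r ^ k) := by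
    intro k
    rw [hY]
    simp only
    rw [integral_const_mul]
    calc ((k : ℝ) + 1) * (r ^ k)⁻¹ * ∫ ω, dyadicSq (fun i => X i ω) k (2 ^ k) ∂μ
        ≤ ((k : ℝ) + 1) * (r ^ k)⁻¹ * ((k + 1) * (C * q ^ k)) := by gcongr; exact hblock k
      _ = _ := by rw [← hrq]; field_simp; ring
  have hsum : Summable fun k : ℕ => C * (((k : ℝ) + 1) ^ 2 * r ^ k) := by
    refine Summable.mul_left C ?_
    have h1 := summable_pow_mul_geometric_of_norm_lt_one (R := ℝ) 2 (r := r)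
      (by rw [Real.norm_of_nonneg hr0.le]; exact hr1)
    have h2 := (summable_nat_add_iff 1).2 h1
    refine (h2.mul_left r⁻¹).congr fun k => ?_
    push_cast; rw [pow_succ r]; field_simp
  have hYsum : Summable fun k => ∫ ω, ‖Y k ω‖ ∂μ := by
    refine Summable.of_nonneg_of_le (fun k => integral_nonneg fun ω => norm_nonneg _) (fun k => ?_) hsum
    simpa only [Real.norm_of_nonneg (hY0 k _)] using hYle k
  have hae : ∀ᵐ ω ∂μ, Summable fun k => Y k ω := by
    have h1 : ∑' k, ∫⁻ ω, ‖Y k ω‖ₑ ∂μ ≠ ⊤ := by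
      have h2 : ∀ k, ∫⁻ ω, ‖Y k ω‖ₑ ∂μ = ENNReal.ofReal (∫ ω, ‖Y k ω‖ ∂μ) := fun k =>
        (ofReal_integral_norm_eq_lintegral_enorm (hYint k)).symm
      simp_rw [h2]
      rw [← ENNReal.ofReal_tsum_of_nonneg (fun k => integral_nonneg fun ω => norm_nonneg _) hYsum]
      exact ENNReal.ofReal_ne_top
    rw [← lintegral_tsum fun k => (hYint k).1.enorm] at h1
    have h3 := ae_lt_top' (AEMeasurable.tsum fun k => (hYint k).1.enorm) h1
    filter_upwards [h3] with ω hω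
    have := ENNReal.summable_toReal hω.ne
    simpa [Real.norm_of_nonneg (hY0 _ _)] using this
  filter_upwards [hae] with ω hω
  obtain ⟨B, hB⟩ := hω.tendsto_atTop_zero.bddAbove_range
  have hB' : ∀ k, Y k ω ≤ B := fun k => hB ⟨k, rfl⟩
  have hB0 : 0 ≤ B := (hY0 0 ω).trans (hB' 0)
  refine tendsto_sum_of_dyadicSq_le (fun i => X i ω) (√B) (√r) (Real.sqrt_nonneg _) ?_ ?_
    (Real.sqrt_nonneg _)
  · rw [Real.sqrt_lt' one_pos]; simpa using hr1
  · intro k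
    rw [mul_pow, Real.sq_sqrt hB0, ← pow_mul, mul_comm k 2, pow_mul, Real.sq_sqrt hr0.le]
    have h1 := hB' k
    simp only [hY] at h1
    rw [mul_right_comm, ← div_eq_mul_inv, div_le_iff₀ (by positivity)] at h1
    exact h1

end Probability

/-! ### Convergence of shifted Dirichlet series -/

theorem norm_natCast_add_cpow {α : ℝ} (hα : 0 < α) (m : ℕ) (s : ℂ) :
    ‖((m : ℂ) + α) ^ s‖ = ((m : ℝ) + α) ^ s.re := by
  have : ((m : ℂ) + α) = (((m : ℝ) + α : ℝ) : ℂ) := by push_cast; rfl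
  rw [this, Complex.norm_cpow_eq_rpow_re_of_pos (by positivity)]

theorem natCast_add_ne_zero {α : ℝ} (hα : 0 < α) (m : ℕ) : (m : ℂ) + α ≠ 0 := by
  have : ((m : ℂ) + α) = (((m : ℝ) + α : ℝ) : ℂ) := by push_cast; rfl
  rw [this]
  exact_mod_cast (by positivity : (0 : ℝ) < (m : ℝ) + α).ne'

/-- Consecutive powers `x ^ (-z)` differ by `O(x ^ (-Re z - 1))`. -/
theorem norm_cpow_sub_cpow_le {x : ℝ} (hx : 0 < x) {z : ℂ} (hz : 0 ≤ z.re) :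
    ‖((x : ℂ)) ^ (-z) - ((x + 1 : ℝ) : ℂ) ^ (-z)‖ ≤ ‖z‖ * x ^ (-z.re - 1) := by
  have hd : ∀ y ∈ Set.Icc x (x + 1), HasDerivWithinAt (fun y : ℝ => (y : ℂ) ^ (-z))
      (-z * (y : ℂ) ^ (-z - 1)) (Set.Icc x (x + 1)) y := by
    intro y hy
    have hy0 : y ≠ 0 := (hx.trans_le hy.1).ne'
    by_cases hz0 : z = 0
    · subst hz0
      simpa using (hasDerivAt_const y (1 : ℂ)).hasDerivWithinAt
    · exact (hasDerivAt_ofReal_cpow_const hy0 (neg_ne_zero.2 hz0)).hasDerivWithinAt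
  have hbound : ∀ y ∈ Set.Ico x (x + 1), ‖-z * (y : ℂ) ^ (-z - 1)‖ ≤ ‖z‖ * x ^ (-z.re - 1) := by
    intro y hy
    rw [norm_mul, norm_neg, Complex.norm_cpow_eq_rpow_re_of_pos (hx.trans_le hy.1)]
    gcongr
    simp only [Complex.sub_re, Complex.neg_re, Complex.one_re]
    exact Real.rpow_le_rpow_of_nonpos hx hy.1 (by linarith)
  have := norm_image_sub_le_of_norm_deriv_le_segment' hd hbound (x + 1)
    (Set.right_mem_Icc.2 (by linarith))
  rw [norm_sub_rev]
  simpa using this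

/-- If a shifted Dirichlet series converges at `s₀`, it converges locally uniformly to the right
of `s₀`. -/
theorem exists_tendstoLocallyUniformlyOn_dirichlet {α : ℝ} (hα : 0 < α) (c : ℕ → ℂ) (σ' : ℝ)
    (h : ∃ L, Tendsto (fun n => ∑ m ∈ Finset.range n, c m / ((m : ℂ) + α) ^ (σ' : ℂ)) atTop (𝓝 L)) :
    ∃ f : ℂ → ℂ, DifferentiableOn ℂ f {s | σ' < s.re} ∧
      TendstoLocallyUniformlyOn (fun n (s : ℂ) => ∑ m ∈ Finset.range n, c m / ((m : ℂ) + α) ^ s) f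
        atTop {s | σ' < s.re} := by
  have hopen : IsOpen {s : ℂ | σ' < s.re} := isOpen_lt continuous_const Complex.continuous_re
  obtain ⟨L, hL⟩ := h
  set d : ℕ → ℂ := fun m => c m / ((m : ℂ) + α) ^ (σ' : ℂ) with hd
  set S : ℕ → ℂ := fun n => ∑ m ∈ Finset.range n, d m with hS
  obtain ⟨B, hB⟩ : ∃ B, ∀ n, ‖S n‖ ≤ B := by
    obtain ⟨B, hB⟩ := hL.norm.bddAbove_range
    exact ⟨B, fun n => hB ⟨n, rfl⟩⟩
  have hB0 : 0 ≤ B := (norm_nonneg _).trans (hB 0)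
  set e : ℕ → ℂ → ℂ := fun m s => (((m : ℝ) + α : ℝ) : ℂ) ^ (-(s - σ')) with he
  have hterm : ∀ m s, c m / ((m : ℂ) + α) ^ s = d m * e m s := by
    intro m s
    have h0 := natCast_add_ne_zero hα m
    simp only [hd, he]
    push_cast
    rw [div_mul_eq_mul_div, mul_div_assoc]
    rw [← Complex.cpow_sub _ _ h0, div_eq_mul_inv, ← Complex.cpow_neg]
    congr 2; ring
  -- Abel summation: only boundedness of the partial sums at σ' enters from here on.
  have hparts : ∀ n s, ∑ m ∈ Finset.range n, c m / ((m : ℂ) + α) ^ s =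
      S n * e n s + ∑ m ∈ Finset.range n, S (m + 1) * (e m s - e (m + 1) s) := by
    intro n s
    simp_rw [hterm]
    induction n with
    | zero => simp [hS]
    | succ n ih =>
      rw [Finset.sum_range_succ, ih, Finset.sum_range_succ]
      have : S (n + 1) = S n + d n := by simp [hS, Finset.sum_range_succ]
      rw [this]; ring
  have hcast : ∀ m : ℕ, (((m + 1 : ℕ) : ℝ) + α) = ((m : ℝ) + α) + 1 := by intro m; push_cast; ring
  have hdiff : ∀ m, Differentiable ℂ (e m) := by
    intro m
    have h0 : (((m : ℝ) + α : ℝ) : ℂ) ≠ 0 := by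
      have := natCast_add_ne_zero hα m; push_cast; exact this
    intro s
    exact DifferentiableAt.const_cpow (by fun_prop) (Or.inl h0)
  set f : ℂ → ℂ := fun s => ∑' m, S (m + 1) * (e m s - e (m + 1) s) with hf
  have hTL : TendstoLocallyUniformlyOn (fun n (s : ℂ) => ∑ m ∈ Finset.range n,
      c m / ((m : ℂ) + α) ^ s) f atTop {s | σ' < s.re} := by
    rw [tendstoLocallyUniformlyOn_iff_forall_isCompact hopen]
    intro K hKsub hK
    rcases K.eq_empty_or_nonempty with rfl | hne
    · exact tendstoUniformlyOn_empty
    obtain ⟨s₀, hs₀, hmin⟩ := hK.exists_isMinOn hne Complex.continuous_re.continuousOn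
    set η := s₀.re - σ' with hη
    have hη0 : 0 < η := sub_pos.2 (hKsub hs₀)
    obtain ⟨R, hR⟩ := hK.isBounded.exists_norm_le
    have hmin' : ∀ s ∈ K, η ≤ (s - σ').re := by
      intro s hs
      have : s₀.re ≤ s.re := hmin hs
      simp; linarith
    -- The index is shifted by one because the base at m = 0 is α, possibly less than 1. From m = 1
    -- on the base is at least 1 and powers are monotone in the exponent.
    have hbd : ∀ m : ℕ, ∀ s ∈ K, ‖S (m + 2) * (e (m + 1) s - e (m + 2) s)‖ ≤
        B * ((R + |σ'|) * ((m : ℝ) + 1) ^ (-η - 1)) := by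
      intro m s hs
      rw [norm_mul]
      refine mul_le_mul (hB _) ?_ (norm_nonneg _) hB0
      have hx : (0 : ℝ) < ((m + 1 : ℕ) : ℝ) + α := by positivity
      have := norm_cpow_sub_cpow_le hx (z := s - σ') (hη0.le.trans (hmin' s hs))
      simp only [he]
      rw [hcast (m + 1)]
      refine this.trans (mul_le_mul ?_ ?_ (by positivity) ?_)
      · refine (norm_sub_le _ _).trans (add_le_add (hR s hs) ?_)
        simp
      · calc (((m + 1 : ℕ) : ℝ) + α) ^ (-(s - σ').re - 1) ≤ ((m : ℝ) + 1) ^ (-(s - σ').re - 1) := by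
              apply Real.rpow_le_rpow_of_nonpos (by positivity) (by push_cast; linarith)
              have := hmin' s hs; linarith
          _ ≤ ((m : ℝ) + 1) ^ (-η - 1) := by
              apply Real.rpow_le_rpow_of_exponent_le (by linarith [(Nat.cast_nonneg m : (0:ℝ) ≤ m)])
              have := hmin' s hs; linarith
      · exact add_nonneg ((norm_nonneg _).trans (hR s hs)) (abs_nonneg _)
    have hsumm : Summable fun m : ℕ => B * ((R + |σ'|) * ((m : ℝ) + 1) ^ (-η - 1)) := by
      refine Summable.mul_left _ (Summable.mul_left _ ?_)
      have := (summable_nat_add_iff 1).2 (Real.summable_nat_rpow.2 (by linarith : -η - 1 < -1))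
      simpa using this
    have h1 := tendstoUniformlyOn_tsum_nat hsumm hbd
    have h2 : TendstoUniformlyOn
        (fun n s => ∑ m ∈ Finset.range n, S (m + 1) * (e m s - e (m + 1) s)) f atTop K := by
      rw [Metric.tendstoUniformlyOn_iff] at h1 ⊢
      intro ε hε
      obtain ⟨N, hN⟩ := eventually_atTop.1 (h1 ε hε)
      refine eventually_atTop.2 ⟨N + 1, fun n hn s hs => ?_⟩
      obtain ⟨n, rfl⟩ : ∃ k, n = k + 1 := ⟨n - 1, by omega⟩
      have := hN n (by omega) s hs
      have hs1 : Summable fun m => S (m + 1) * (e m s - e (m + 1) s) := by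
        rw [← summable_nat_add_iff 1]
        exact Summable.of_norm_bounded hsumm fun m => hbd m s hs
      simp only [hf]
      rw [hs1.tsum_eq_zero_add, Finset.sum_range_succ', add_comm, dist_add_right]
      exact this
    have h3 : TendstoUniformlyOn (fun n s => S n * e n s) 0 atTop K := by
      rw [Metric.tendstoUniformlyOn_iff]
      intro ε hε
      have h4 : Tendsto (fun n : ℕ => B * ((n : ℝ) + α) ^ (-η)) atTop (𝓝 (B * 0)) := by
        refine Tendsto.const_mul B ?_
        refine (tendsto_rpow_neg_atTop hη0).comp ?_
        exact tendsto_atTop_add_const_right _ _ tendsto_natCast_atTop_atTop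
      rw [mul_zero] at h4
      filter_upwards [h4.eventually (gt_mem_nhds hε), eventually_ge_atTop 1] with n hn hn1 s hs
      simp only [Pi.zero_apply, dist_zero_left]
      refine lt_of_le_of_lt ?_ hn
      rw [norm_mul]
      refine mul_le_mul (hB _) ?_ (norm_nonneg _) hB0
      simp only [he]
      rw [Complex.norm_cpow_eq_rpow_re_of_pos (by positivity)]
      apply Real.rpow_le_rpow_of_exponent_le
      · have : (1 : ℝ) ≤ n := by exact_mod_cast hn1
        linarith
      · have := hmin' s hs
        simp only [Complex.neg_re]; linarith
    have h5 := h3.add h2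
    refine (h5.congr (Eventually.of_forall fun n s _ => ?_)).congr_right fun s _ => ?_
    · simp only [Pi.add_apply]; exact (hparts n s).symm
    · simp
  refine ⟨f, ?_, hTL⟩
  refine hTL.differentiableOn (Eventually.of_forall fun n => ?_) hopen
  refine DifferentiableOn.fun_sum fun m _ => ?_
  simp_rw [hterm]
  exact ((hdiff m).differentiableOn).const_mul _

/-! ### The Fejér kernel -/

/-- The Fejér kernel as the cosine transform of the tent function on `[-L, L]`. -/
def fejer (L v : ℝ) : ℝ := ∫ t in (-L)..L, (1 - |t| / L) * Real.cos (t * v)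

theorem fejer_eq {L v : ℝ} (hL : 0 < L) (hv : v ≠ 0) :
    fejer L v = 2 * (1 - Real.cos (L * v)) / (L * v ^ 2) := by
  have hcont : Continuous fun t : ℝ => (1 - |t| / L) * Real.cos (t * v) := by fun_prop
  have hpos : ∫ t in (0)..L, (1 - |t| / L) * Real.cos (t * v) =
      (1 - Real.cos (L * v)) / (L * v ^ 2) := by
    have h1 : ∀ t ∈ Set.uIcc 0 L, HasDerivAt
        (fun t => (1 - t / L) * (Real.sin (t * v) / v) - Real.cos (t * v) / (L * v ^ 2))
        ((1 - |t| / L) * Real.cos (t * v)) t := by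
      intro t ht
      rw [Set.uIcc_of_le hL.le] at ht
      have hm : HasDerivAt (fun t : ℝ => t * v) v t := by simpa using (hasDerivAt_id t).mul_const v
      have hs := (hm.sin).div_const v
      have hc := (hm.cos).div_const (L * v ^ 2)
      have hl : HasDerivAt (fun t : ℝ => 1 - t / L) (-(1 / L)) t := by
        simpa using ((hasDerivAt_id t).div_const L).const_sub 1
      refine ((hl.mul hs).sub hc).congr_deriv ?_
      rw [abs_of_nonneg ht.1]
      field_simp
      ring
    rw [intervalIntegral.integral_eq_sub_of_hasDerivAt h1 (hcont.intervalIntegrable _ _)]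
    simp [hL.ne']
    field_simp
    ring
  have hneg : ∫ t in (-L)..0, (1 - |t| / L) * Real.cos (t * v) =
      ∫ t in (0)..L, (1 - |t| / L) * Real.cos (t * v) := by
    have := intervalIntegral.integral_comp_neg (a := 0) (b := L)
      fun t : ℝ => (1 - |t| / L) * Real.cos (t * v)
    rw [neg_zero] at this
    rw [← this]
    simp
  rw [fejer, ← intervalIntegral.integral_add_adjacent_intervals
    (hcont.intervalIntegrable (-L) 0) (hcont.intervalIntegrable 0 L), hneg, hpos]
  ring

theorem fejer_zero {L : ℝ} (hL : 0 < L) : fejer L 0 = L := by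
  have hcont : Continuous fun t : ℝ => (1 - |t| / L) := by fun_prop
  have h0 : ∫ t in (0)..L, (1 - |t| / L) = L / 2 := by
    have h1 : ∀ t ∈ Set.uIcc 0 L, HasDerivAt (fun t => t - t ^ 2 / (2 * L)) (1 - |t| / L) t := by
      intro t ht
      rw [Set.uIcc_of_le hL.le] at ht
      refine ((hasDerivAt_id t).sub ((hasDerivAt_pow 2 t).div_const (2 * L))).congr_deriv ?_
      rw [abs_of_nonneg ht.1]; field_simp; norm_num; ring
    rw [intervalIntegral.integral_eq_sub_of_hasDerivAt h1 (hcont.intervalIntegrable _ _)]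
    field_simp
    ring
  have hneg : ∫ t in (-L)..0, (1 - |t| / L) = ∫ t in (0)..L, (1 - |t| / L) := by
    have := intervalIntegral.integral_comp_neg (a := 0) (b := L) fun t : ℝ => (1 - |t| / L)
    rw [neg_zero] at this
    rw [← this]
    simp
  simp only [fejer, mul_zero, Real.cos_zero, mul_one]
  rw [← intervalIntegral.integral_add_adjacent_intervals
    (hcont.intervalIntegrable (-L) 0) (hcont.intervalIntegrable 0 L), hneg, h0]
  ring

theorem fejer_nonneg {L : ℝ} (hL : 0 < L) (v : ℝ) : 0 ≤ fejer L v := by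
  rcases eq_or_ne v 0 with rfl | hv
  · rw [fejer_zero hL]; exact hL.le
  · rw [fejer_eq hL hv]
    have := Real.cos_le_one (L * v)
    have : 0 ≤ 1 - Real.cos (L * v) := by linarith
    positivity

theorem fejer_le {L : ℝ} (hL : 0 < L) (v : ℝ) : fejer L v ≤ L := by
  rcases eq_or_ne v 0 with rfl | hv
  · rw [fejer_zero hL]
  · rw [fejer_eq hL hv, div_le_iff₀ (by positivity)]
    nlinarith [Real.one_sub_sq_div_two_le_cos (x := L * v)]

theorem fejer_le_div_sq {L v : ℝ} (hL : 0 < L) (hv : v ≠ 0) : fejer L v ≤ 4 / (L * v ^ 2) := by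
  rw [fejer_eq hL hv]
  gcongr
  linarith [Real.neg_one_le_cos (L * v)]

/-- The quadratic bound cos y ≤ 1 - 2y²/π² on [-π, π]. It guarantees that the main lobe carries an
amount of mass independent of L, which bounds the pole term from below. -/
theorem le_fejer {L v : ℝ} (hL : 0 < L) (hv : |L * v| ≤ π) : 4 * L / π ^ 2 ≤ fejer L v := by
  rcases eq_or_ne v 0 with rfl | h0
  · rw [fejer_zero hL, div_le_iff₀ (by positivity)]
    have : 9 < π ^ 2 := by nlinarith [Real.pi_gt_three]
    nlinarith
  · rw [fejer_eq hL h0, div_le_div_iff₀ (by positivity) (by positivity)]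
    have h1 := Real.cos_le_one_sub_mul_cos_sq hv
    have h3 : 2 / π ^ 2 * (L * v) ^ 2 * π ^ 2 = 2 * (L * v) ^ 2 := by field_simp
    nlinarith [sq_nonneg π]

theorem continuous_fejer {L : ℝ} : Continuous (fejer L) := by
  unfold fejer
  exact intervalIntegral.continuous_parametric_intervalIntegral_of_continuous' (by fun_prop) _ _

/-- Fubini for the tent function against a superposition of characters. -/
theorem re_integral_tent_mul_eq {X : Type*} [MeasurableSpace X] (ν : Measure X) [SFinite ν]
    {L : ℝ} (hL : 0 < L) (W g : X → ℝ) (hW : Integrable W ν) (hg : Measurable g) (x : ℝ) :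
    (∫ t in (-L)..L, ((1 - |t| / L : ℝ) : ℂ) * Complex.exp (Complex.I * t * x) *
      ∫ y, (W y : ℂ) * Complex.exp (-(Complex.I * t * g y)) ∂ν).re =
    ∫ y, W y * fejer L (g y - x) ∂ν := by
  have h_int : Integrable (Function.uncurry fun (t : ℝ) (y : X) =>
      ((1 - |t| / L : ℝ) : ℂ) * Complex.exp (Complex.I * t * x) *
      ((W y : ℂ) * Complex.exp (-(Complex.I * t * g y))))
      ((volume.restrict (Set.Ioc (-L) L)).prod ν) := by
    have h1 : Integrable (fun z : ℝ × X => (1 : ℝ) * ‖W z.2‖)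
        ((volume.restrict (Set.Ioc (-L) L)).prod ν) :=
      Integrable.mul_prod (integrable_const (1 : ℝ)) hW.norm
    refine h1.mono' ?_ ?_
    · have h2 : AEStronglyMeasurable (fun z : ℝ × X => ((W z.2 : ℝ) : ℂ))
          ((volume.restrict (Set.Ioc (-L) L)).prod ν) :=
        Complex.continuous_ofReal.comp_aestronglyMeasurable hW.1.comp_snd
      have h3' : Continuous fun t : ℝ => ((1 - |t| / L : ℝ) : ℂ) *
          Complex.exp (Complex.I * t * x) := by fun_prop
      have h3 := h3'.measurable.comp (measurable_fst : Measurable (Prod.fst : ℝ × X → ℝ))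
      have h4' : Continuous fun z : ℝ × ℝ => Complex.exp (-(Complex.I * z.1 * z.2)) := by fun_prop
      have h4 := h4'.measurable.comp
        ((measurable_fst : Measurable (Prod.fst : ℝ × X → ℝ)).prodMk (hg.comp measurable_snd))
      exact h3.aestronglyMeasurable.mul (h2.mul h4.aestronglyMeasurable)
    · have hae : ∀ᵐ z ∂((volume.restrict (Set.Ioc (-L) L)).prod ν), z.1 ∈ Set.Ioc (-L) L :=
        Measure.quasiMeasurePreserving_fst.ae (ae_restrict_mem measurableSet_Ioc)
      filter_upwards [hae] with z hz
      simp only [Function.uncurry]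
      rw [norm_mul, norm_mul, norm_mul, Complex.norm_exp, Complex.norm_exp]
      simp only [Complex.norm_real, Complex.mul_re, Complex.I_re, Complex.ofReal_re, zero_mul,
        Complex.I_im, Complex.ofReal_im, mul_zero, Complex.mul_im, one_mul, zero_add,
        Complex.neg_re, Real.norm_eq_abs, sub_self, Real.exp_zero, mul_one, neg_zero]
      have habs : |z.1| ≤ L := abs_le.2 ⟨hz.1.le, hz.2⟩
      have h5 : |z.1| / L ≤ 1 := (div_le_one hL).2 habs
      have h6 : |1 - |z.1| / L| ≤ 1 := by
        rw [abs_le]; constructor <;> linarith [div_nonneg (abs_nonneg z.1) hL.le]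
      exact mul_le_of_le_one_left (abs_nonneg _) h6
  rw [intervalIntegral.integral_of_le (by linarith)]
  simp_rw [← integral_const_mul]
  have hre := integral_re h_int.integral_prod_right
  simp only [Function.uncurry] at hre
  rw [integral_integral_swap h_int, ← RCLike.re_eq_complex_re, ← hre]
  refine integral_congr_ae (Eventually.of_forall fun y => ?_)
  simp only
  rw [fejer, ← intervalIntegral.integral_of_le (by linarith), ← intervalIntegral.integral_const_mul,
    RCLike.re_eq_complex_re, ← Complex.reCLM_apply,
    ← ContinuousLinearMap.intervalIntegral_comp_comm]
  · refine intervalIntegral.integral_congr fun t _ => ?_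
    simp only [Complex.reCLM_apply]
    have h7 : ((1 - |t| / L : ℝ) : ℂ) * Complex.exp (Complex.I * t * x) *
        ((W y : ℂ) * Complex.exp (-(Complex.I * t * g y))) =
        ((W y * (1 - |t| / L) : ℝ) : ℂ) * Complex.exp (((t * (x - g y) : ℝ) : ℂ) * Complex.I) := by
      have : Complex.exp (((t * (x - g y) : ℝ) : ℂ) * Complex.I) =
          Complex.exp (Complex.I * t * x) * Complex.exp (-(Complex.I * t * g y)) := by
        rw [← Complex.exp_add]; congr 1; push_cast; ring
      rw [this]; push_cast; ring
    rw [h7, Complex.re_ofReal_mul, Complex.exp_ofReal_mul_I_re, mul_assoc]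
    congr 2
    rw [← Real.cos_neg]; congr 1; ring
  · exact Continuous.intervalIntegrable (by fun_prop) _ _

section

/-! ### Primes in short multiplicative intervals -/

open ArithmeticFunction.vonMangoldt

theorem summable_one_div_one_add_int_sq : Summable fun i : ℤ => 1 / (1 + (i : ℝ) ^ 2) := by
  have h1 : Summable fun i : ℤ => 1 / (i : ℝ) ^ 2 := Real.summable_one_div_int_pow.2 (by norm_num)
  refine Summable.of_norm_bounded_eventually h1 ?_
  have : ∀ᶠ i : ℤ in cofinite, i ≠ 0 := (Set.finite_singleton (0 : ℤ)).compl_mem_cofinite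
  filter_upwards [this] with i hi
  have hi' : (0 : ℝ) < (i : ℝ) ^ 2 := by positivity
  rw [Real.norm_of_nonneg (by positivity)]
  gcongr
  linarith

/-- Chebyshev's bound for ψ(e^{j+1}), combined with 1/n ≤ e^{-j} on the block. -/
theorem sum_vonMangoldt_div_floor_log_le (s : Finset ℕ) (j : ℕ) :
    ∑ n ∈ s with ⌊Real.log (n : ℕ)⌋₊ = j, Λ n / n ≤ (Real.log 4 + 4) * Real.exp 1 := by
  have hsub : ∀ n ∈ s.filter (fun n : ℕ => ⌊Real.log n⌋₊ = j), n ≠ 0 →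
      n ∈ Finset.Ioc 0 ⌊Real.exp (j + 1)⌋₊ ∧ Real.exp j ≤ n := by
    intro n hn hn0
    have hj := (Finset.mem_filter.1 hn).2
    have hpos : (0 : ℝ) < n := by positivity
    have hlog : 0 ≤ Real.log n := Real.log_natCast_nonneg n
    have h1 : (j : ℝ) ≤ Real.log n := hj ▸ Nat.floor_le hlog
    have h2 : Real.log n < j + 1 := hj ▸ Nat.lt_floor_add_one _
    refine ⟨Finset.mem_Ioc.2 ⟨Nat.pos_of_ne_zero hn0, Nat.le_floor ?_⟩, ?_⟩
    · exact ((Real.log_lt_iff_lt_exp hpos).1 h2).le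
    · exact (Real.le_log_iff_exp_le hpos).1 h1
  have h3 : ∑ n ∈ s with ⌊Real.log (n : ℕ)⌋₊ = j, Λ n / n ≤
      ∑ n ∈ Finset.Ioc 0 ⌊Real.exp (j + 1)⌋₊, Λ n * Real.exp (-j) := by
    rw [← Finset.sum_filter_ne_zero]
    refine (Finset.sum_le_sum (g := fun n => Λ n * Real.exp (-j)) fun n hn => ?_).trans
      (Finset.sum_le_sum_of_subset_of_nonneg ?_ ?_)
    · obtain ⟨hn1, hn2⟩ := Finset.mem_filter.1 hn
      have hn0 : n ≠ 0 := by rintro rfl; simp at hn2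
      have := (hsub n hn1 hn0).2
      rw [div_eq_mul_inv, Real.exp_neg]
      gcongr
    · intro n hn
      obtain ⟨hn1, hn2⟩ := Finset.mem_filter.1 hn
      have hn0 : n ≠ 0 := by rintro rfl; simp at hn2
      exact (hsub n hn1 hn0).1
    · intro n _ _
      exact mul_nonneg ArithmeticFunction.vonMangoldt_nonneg (Real.exp_pos _).le
  refine h3.trans ?_
  rw [← Finset.sum_mul]
  have h4 := Chebyshev.psi_le_const_mul_self (Real.exp_pos ((j : ℝ) + 1)).le
  rw [Chebyshev.psi] at h4
  calc _ ≤ (Real.log 4 + 4) * Real.exp (j + 1) * Real.exp (-j) := by gcongr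
    _ = _ := by rw [mul_assoc, ← Real.exp_add]; congr 2; ring

/-- The masses `Λ(n)/n` at `log n` are uniformly summable against `1 / (1 + (· - x) ^ 2)`. -/
theorem exists_sum_vonMangoldt_div_le : ∃ C : ℝ, 0 < C ∧ ∀ (x : ℝ) (s : Finset ℕ),
    ∑ n ∈ s, Λ n / n * (1 / (1 + (Real.log n - x) ^ 2)) ≤ C := by
  have hpos : 0 < ∑' i : ℤ, 1 / (1 + (i : ℝ) ^ 2) :=
    summable_one_div_one_add_int_sq.tsum_pos (fun i => by positivity) 0 (by norm_num)
  have hlog4 : 0 < Real.log 4 := Real.log_pos (by norm_num)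
  refine ⟨(Real.log 4 + 4) * Real.exp 1 * (3 * ∑' i : ℤ, 1 / (1 + (i : ℝ) ^ 2)), by positivity, ?_⟩
  intro x s
  set J : ℕ → ℕ := fun n => ⌊Real.log n⌋₊ with hJ
  set X : ℤ := ⌊x⌋
  rw [← Finset.sum_fiberwise_of_maps_to (fun n hn => Finset.mem_image_of_mem J hn)]
  -- Replacing log n and x by their integer parts changes their difference by at most 1, which costs
  -- the factor 3.
  have h1 : ∀ j ∈ s.image J, ∑ n ∈ s with J n = j, Λ n / n * (1 / (1 + (Real.log n - x) ^ 2)) ≤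
      (Real.log 4 + 4) * Real.exp 1 * (3 * (1 / (1 + (((j : ℤ) - X : ℤ) : ℝ) ^ 2))) := by
    intro j _
    refine le_trans ?_ (mul_le_mul_of_nonneg_right (sum_vonMangoldt_div_floor_log_le s j)
      (by positivity))
    rw [Finset.sum_mul]
    refine Finset.sum_le_sum fun n hn => ?_
    have hj : ⌊Real.log n⌋₊ = j := (Finset.mem_filter.1 hn).2
    have h2 : (j : ℝ) ≤ Real.log n := hj ▸ Nat.floor_le (Real.log_natCast_nonneg n)
    have h3 : Real.log n < j + 1 := hj ▸ Nat.lt_floor_add_one _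
    have h4 : (X : ℝ) ≤ x := Int.floor_le x
    have h5 : x < X + 1 := Int.lt_floor_add_one x
    have h6 : 0 ≤ Λ n / (n : ℝ) := div_nonneg ArithmeticFunction.vonMangoldt_nonneg (Nat.cast_nonneg n)
    refine mul_le_mul_of_nonneg_left ?_ h6
    rw [← mul_div_assoc, mul_one, div_le_div_iff₀ (by positivity) (by positivity)]
    push_cast
    have h7 : ((j : ℝ) - X - (Real.log n - x)) ^ 2 ≤ 1 := by
      rw [sq_le_one_iff_abs_le_one, abs_le]; constructor <;> linarith
    nlinarith [sq_nonneg ((j : ℝ) - X - 2 * (Real.log n - x))]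
  refine (Finset.sum_le_sum h1).trans ?_
  rw [← Finset.mul_sum, ← Finset.mul_sum]
  gcongr
  have hinj : Function.Injective fun j : ℕ => ((j : ℤ) - X) := by
    intro a b h; simpa using h
  rw [show ∑ j ∈ s.image J, 1 / (1 + (((j : ℤ) - X : ℤ) : ℝ) ^ 2) =
    ∑ i ∈ (s.image J).map ⟨_, hinj⟩, 1 / (1 + (i : ℝ) ^ 2) by rw [Finset.sum_map]; rfl]
  exact summable_one_div_one_add_int_sq.sum_le_tsum _ fun i _ => by positivity

/-- The negative logarithmic derivative of `ζ` minus `1 / (s - 1)`, continuous on the closed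
half-plane `Re s ≥ 1`. -/
abbrev zetaAux (s : ℂ) : ℂ := LFunctionResidueClassAux (q := 1) 0 s

theorem zetaAux_eq {s : ℂ} (hs : 1 < s.re) :
    zetaAux s = LSeries (fun n => (Λ n : ℂ)) s - 1 / (s - 1) := by
  have h := eqOn_LFunctionResidueClassAux (q := 1) (a := 0) (by decide) hs
  rw [zetaAux, h]
  simp only [Nat.totient_one, Nat.cast_one, inv_one]
  congr 2
  ext n
  have : (n : ZMod 1) = 0 := Subsingleton.elim _ _
  simp [residueClass, Set.indicator, this]

/-- Both 1/(s-1) and the Dirichlet series of Λ are superpositions of characters on the line Re s = 1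
+ ε: the former of Lebesgue measure on the half-line, the latter of point masses at log n.
Integrating their difference `zetaAux` against the tent and applying Fubini to each term gives the
identity. -/
theorem tsum_vonMangoldt_fejer {L ε : ℝ} (hL : 0 < L) (hε : 0 < ε) (x : ℝ) :
    (Summable fun n : ℕ => Λ n / (n : ℝ) ^ (1 + ε) * fejer L (Real.log n - x)) ∧
    ∑' n : ℕ, Λ n / (n : ℝ) ^ (1 + ε) * fejer L (Real.log n - x) =
    (∫ u in Set.Ioi (0 : ℝ), Real.exp (-ε * u) * fejer L (u - x)) +
    (∫ t in (-L)..L, ((1 - |t| / L : ℝ) : ℂ) * Complex.exp (Complex.I * t * x) *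
      zetaAux (1 + ε + t * Complex.I)).re := by
  have hre : ∀ t : ℝ, ((1 : ℂ) + ε + t * Complex.I).re = 1 + ε := by intro t; simp
  have hsum : Summable fun n : ℕ => Λ n / (n : ℝ) ^ (1 + ε) := by
    have h1 := (ArithmeticFunction.LSeriesSummable_vonMangoldt (s := 1 + ε) (by simpa using hε)).norm
    refine h1.congr fun n => ?_
    rw [LSeries.norm_term_eq]
    split_ifs with h
    · simp [h]
    · simp [abs_of_nonneg (ArithmeticFunction.vonMangoldt_nonneg (n := n))]
  have hWint : Integrable (fun n : ℕ => Λ n / (n : ℝ) ^ (1 + ε)) Measure.count :=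
    integrable_count_iff.2 hsum.norm
  have hcount : ∀ {E : Type} [NormedAddCommGroup E] [NormedSpace ℝ E] [CompleteSpace E] (f : ℕ → E),
      Summable (fun n => ‖f n‖) → ∫ n, f n ∂Measure.count = ∑' n, f n := by
    intro E _ _ _ f hf
    rw [integral_countable (integrable_count_iff.2 hf)]
    simp [measureReal_def]
  have hs2 : Summable fun n : ℕ => Λ n / (n : ℝ) ^ (1 + ε) * fejer L (Real.log n - x) := by
    refine Summable.of_nonneg_of_le (fun n => ?_) (fun n => ?_) (hsum.mul_right L)
    · exact mul_nonneg (div_nonneg ArithmeticFunction.vonMangoldt_nonneg (by positivity)) (fejer_nonneg hL _)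
    · exact mul_le_mul_of_nonneg_left (fejer_le hL _)
        (div_nonneg ArithmeticFunction.vonMangoldt_nonneg (by positivity))
  refine ⟨hs2, ?_⟩
  have e1 := re_integral_tent_mul_eq (Measure.count : Measure ℕ) hL
    (fun n : ℕ => Λ n / (n : ℝ) ^ (1 + ε)) (fun n => Real.log n) hWint (by fun_prop) x
  have hexpint : Integrable (fun u : ℝ => Real.exp (-ε * u)) (volume.restrict (Set.Ioi 0)) :=
    exp_neg_integrableOn_Ioi 0 hε
  have e2 := re_integral_tent_mul_eq (volume.restrict (Set.Ioi (0 : ℝ))) hL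
    (fun u : ℝ => Real.exp (-ε * u)) id hexpint measurable_id x
  rw [hcount _ hs2.norm] at e1
  simp only [id] at e2
  rw [← e1, ← e2, ← Complex.add_re]
  congr 1
  have hpole : ∀ t : ℝ, ∫ u in Set.Ioi (0 : ℝ), ((Real.exp (-ε * u) : ℝ) : ℂ) *
      Complex.exp (-(Complex.I * t * u)) = 1 / ((1 + ε + t * Complex.I : ℂ) - 1) := by
    intro t
    have h1 := integral_exp_mul_complex_Ioi (a := -(ε + t * Complex.I)) (by simpa using hε) 0
    simp only [Complex.ofReal_zero, mul_zero, Complex.exp_zero] at h1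
    rw [show (1 + ε + t * Complex.I : ℂ) - 1 = ε + t * Complex.I by ring]
    rw [← neg_div_neg_eq, ← h1]
    refine setIntegral_congr_fun measurableSet_Ioi fun u _ => ?_
    push_cast
    rw [← Complex.exp_add]
    congr 1; ring
  have hLs : ∀ t : ℝ, ∫ n : ℕ, ((Λ n / (n : ℝ) ^ (1 + ε) : ℝ) : ℂ) *
      Complex.exp (-(Complex.I * t * (Real.log n : ℝ))) ∂Measure.count =
      LSeries (fun n => (Λ n : ℂ)) (1 + ε + t * Complex.I) := by
    intro t
    rw [hcount, LSeries]
    · refine tsum_congr fun n => ?_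
      rcases eq_or_ne n 0 with rfl | hn
      · simp
      · rw [LSeries.term_of_ne_zero hn]
        have hn' : (n : ℂ) ≠ 0 := by exact_mod_cast hn
        rw [Complex.cpow_add _ _ hn']
        push_cast
        rw [Complex.ofReal_cpow (Nat.cast_nonneg n)]
        push_cast
        rw [Complex.exp_neg, Complex.cpow_def_of_ne_zero hn' (t * Complex.I)]
        rw [div_mul_eq_div_div, div_eq_mul_inv (_ / _)]
        congr 3; ring
    · refine hsum.congr fun n => ?_
      have h2 : -(Complex.I * t * (Real.log n : ℝ)) = ((-(t * Real.log n) : ℝ) : ℂ) * Complex.I := by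
        push_cast; ring
      rw [norm_mul, h2, Complex.norm_exp_ofReal_mul_I, mul_one, Complex.norm_real,
        Real.norm_of_nonneg (div_nonneg ArithmeticFunction.vonMangoldt_nonneg (by positivity))]
  simp_rw [hLs, hpole]
  have hcont : ContinuousOn (fun t : ℝ => zetaAux (1 + ε + t * Complex.I)) Set.univ := by
    refine (continuousOn_LFunctionResidueClassAux (q := 1) 0).comp (by fun_prop) ?_
    intro t _
    simp only [Set.mem_ofPred_eq, hre]; linarith
  rw [continuousOn_univ] at hcont
  rw [← intervalIntegral.integral_add]
  · refine intervalIntegral.integral_congr fun t _ => ?_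
    rw [zetaAux_eq (by rw [hre]; linarith)]
    ring
  · refine Continuous.intervalIntegrable ?_ _ _
    have : ∀ t : ℝ, (1 + ε + t * Complex.I : ℂ) - 1 ≠ 0 := by
      intro t h
      have := congrArg Complex.re h
      simp at this; linarith
    fun_prop (disch := exact this _)
  · refine Continuous.intervalIntegrable ?_ _ _
    fun_prop

end

section

open ArithmeticFunction.vonMangoldt

/-- Dominated convergence on a compact rectangle, where `zetaAux` is continuous up to the line Re s
= 1. -/
theorem tendsto_integral_tent_zetaAux {L : ℝ} (hL : 0 < L) (x : ℝ) :
    Tendsto (fun ε : ℝ => (∫ t in (-L)..L, ((1 - |t| / L : ℝ) : ℂ) *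
      Complex.exp (Complex.I * t * x) * zetaAux (1 + ε + t * Complex.I)).re) (𝓝[>] 0)
      (𝓝 (∫ t in (-L)..L, ((1 - |t| / L : ℝ) : ℂ) *
      Complex.exp (Complex.I * t * x) * zetaAux (1 + t * Complex.I)).re) := by
  refine (Complex.continuous_re.tendsto _).comp ?_
  set G : ℝ × ℝ → ℂ := fun z => zetaAux (1 + z.1 + z.2 * Complex.I) with hG
  have hcont : ContinuousOn G {z | 0 ≤ z.1} := by
    refine (continuousOn_LFunctionResidueClassAux (q := 1) 0).comp (by fun_prop) ?_
    intro z hz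
    have : 0 ≤ z.1 := hz
    simpa using this
  have hcompact : IsCompact (Set.Icc (0 : ℝ) 1 ×ˢ Set.Icc (-L) L) :=
    isCompact_Icc.prod isCompact_Icc
  obtain ⟨B, hB⟩ := hcompact.exists_bound_of_continuousOn
    (hcont.mono fun z hz => (Set.mem_prod.1 hz).1.1)
  have hev : ∀ᶠ ε : ℝ in 𝓝[>] 0, 0 < ε ∧ ε ≤ 1 := by
    filter_upwards [Ioc_mem_nhdsGT (show (0 : ℝ) < 1 by norm_num)] with ε hε using hε
  have hline : ∀ ε : ℝ, 0 ≤ ε → Continuous fun t : ℝ => G (ε, t) := by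
    intro ε hε
    rw [← continuousOn_univ]
    exact hcont.comp (by fun_prop) fun t _ => hε
  refine intervalIntegral.tendsto_integral_filter_of_dominated_convergence (fun _ => 2 * B) ?_ ?_ ?_ ?_
  · filter_upwards [hev] with ε hε
    have h1 := hline ε hε.1.le
    simp only [hG] at h1
    exact (Continuous.mul (by fun_prop) h1).aestronglyMeasurable
  · filter_upwards [hev] with ε hε
    refine Eventually.of_forall fun t ht => ?_
    rw [Set.uIoc_of_le (by linarith)] at ht
    have hb := hB (ε, t) ⟨⟨hε.1.le, hε.2⟩, ht.1.le, ht.2⟩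
    have h2 : Complex.I * t * x = ((t * x : ℝ) : ℂ) * Complex.I := by push_cast; ring
    rw [norm_mul, norm_mul, h2, Complex.norm_exp_ofReal_mul_I, mul_one, Complex.norm_real]
    have h3 : |t| / L ≤ 1 := (div_le_one hL).2 (abs_le.2 ⟨ht.1.le, ht.2⟩)
    have h4 : ‖1 - |t| / L‖ ≤ 2 := by
      rw [Real.norm_eq_abs, abs_le]
      constructor <;> linarith [div_nonneg (abs_nonneg t) hL.le]
    exact mul_le_mul h4 hb (norm_nonneg _) (by norm_num)
  · exact intervalIntegrable_const
  · refine Eventually.of_forall fun t ht => ?_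
    refine Tendsto.const_mul _ ?_
    have h5 : ContinuousWithinAt G {z | 0 ≤ z.1} (0, t) := hcont _ (le_refl (0 : ℝ))
    have h6 : Tendsto (fun ε : ℝ => (ε, t)) (𝓝[>] 0) (𝓝[{z : ℝ × ℝ | 0 ≤ z.1}] (0, t)) := by
      refine tendsto_nhdsWithin_iff.2 ⟨?_, ?_⟩
      · exact ((Continuous.prodMk_left t).tendsto 0).mono_left nhdsWithin_le_nhds
      · filter_upwards [hev] with ε hε using hε.1.le
    have := h5.tendsto.comp h6
    simpa [hG, Function.comp_def] using this

/-- Riemann–Lebesgue: x is the frequency, and the rest of the integrand is a fixed function of t on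
a bounded interval. -/
theorem tendsto_integral_tent_zetaAux_atTop (L : ℝ) :
    Tendsto (fun x : ℝ => (∫ t in (-L)..L, ((1 - |t| / L : ℝ) : ℂ) *
      Complex.exp (Complex.I * t * x) * zetaAux (1 + t * Complex.I)).re) atTop (𝓝 0) := by
  have key : ∀ a b : ℝ, Tendsto (fun x : ℝ => ∫ t in Set.Ioc a b, ((1 - |t| / L : ℝ) : ℂ) *
      Complex.exp (Complex.I * t * x) * zetaAux (1 + t * Complex.I)) atTop (𝓝 0) := by
    intro a b
    have h1 := Real.tendsto_integral_exp_smul_cocompact ((Set.Ioc a b).indicator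
      fun t : ℝ => ((1 - |t| / L : ℝ) : ℂ) * zetaAux (1 + t * Complex.I))
    have h2 : Tendsto (fun x : ℝ => -(x / (2 * π))) atTop (cocompact ℝ) := by
      refine Tendsto.mono_right ?_ atBot_le_cocompact
      exact tendsto_neg_atTop_atBot.comp (tendsto_id.atTop_div_const (by positivity))
    refine (h1.comp h2).congr fun x => ?_
    rw [← integral_indicator measurableSet_Ioc]
    refine integral_congr_ae (Eventually.of_forall fun t => ?_)
    simp only [Set.indicator]
    split_ifs
    · rw [Circle.smul_def, Real.fourierChar_apply, smul_eq_mul]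
      have : (2 * π * (-(t * -(x / (2 * π)))) : ℝ) = t * x := by field_simp
      rw [this]
      push_cast
      rw [mul_comm (t * x : ℂ) Complex.I]
      ring_nf
    · simp
  have h3 := (key (-L) L).sub (key L (-L))
  rw [sub_zero] at h3
  have h4 := (Complex.continuous_re.tendsto _).comp h3
  rw [Complex.zero_re] at h4
  exact h4

/-! ### Lower bounds for the mass in logarithmic windows -/

/-- The integers whose logarithm lies in `(x - δ, x + δ]`. -/
def logWindow (x δ : ℝ) : Finset ℕ :=
  (Finset.Ioc 0 ⌊Real.exp (x + δ)⌋₊).filter fun n => x - δ < Real.log n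

theorem mem_logWindow {x δ : ℝ} {n : ℕ} :
    n ∈ logWindow x δ ↔ 0 < n ∧ x - δ < Real.log n ∧ Real.log n ≤ x + δ := by
  simp only [logWindow, Finset.mem_filter, Finset.mem_Ioc]
  constructor
  · rintro ⟨⟨h1, h2⟩, h3⟩
    refine ⟨h1, h3, ?_⟩
    rw [Real.log_le_iff_le_exp (by exact_mod_cast h1)]
    exact (Nat.le_floor_iff (Real.exp_pos _).le).1 h2
  · rintro ⟨h1, h2, h3⟩
    refine ⟨⟨h1, Nat.le_floor ?_⟩, h2⟩
    rwa [Real.log_le_iff_le_exp (by exact_mod_cast h1)] at h3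

/-- As ε → 0 the Fejér-smoothed sum has limit inferior at least 8/π² from the pole, up to an error
that vanishes as x → ∞. The part outside the window is small for large L, and inside the window the
kernel is at most L, so the window must hold mass of order 1/L. -/
theorem exists_le_sum_vonMangoldt {δ : ℝ} (hδ : 0 < δ) (hδ₁ : δ ≤ 1) :
    ∃ c : ℝ, 0 < c ∧ ∀ᶠ x : ℝ in atTop, c ≤ ∑ n ∈ logWindow x δ, Λ n / n := by
  obtain ⟨C, hC, hbound⟩ := exists_sum_vonMangoldt_div_le
  -- For |v| ≥ δ, δ ≤ 1, the kernel is at most 8/(Lδ²) · 1/(1+v²). This L makes the contribution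
  -- from outside the window at most 1/10.
  set L : ℝ := 1 + 80 * C / δ ^ 2 with hLdef
  have hL1 : 1 ≤ L := by rw [hLdef]; have : 0 ≤ 80 * C / δ ^ 2 := by positivity
                         linarith
  have hL : 0 < L := by linarith
  have htail : 8 / (L * δ ^ 2) * C ≤ 1 / 10 := by
    rw [div_mul_eq_mul_div, div_le_iff₀ (by positivity)]
    have : L * δ ^ 2 = δ ^ 2 + 80 * C := by rw [hLdef]; field_simp
    rw [this]; nlinarith [sq_nonneg δ]
  refine ⟨(1 / 10) / L, by positivity, ?_⟩
  have hR := tendsto_integral_tent_zetaAux_atTop L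
  have hR' := hR.eventually (lt_mem_nhds (show (-(1 / 10 : ℝ)) < 0 by norm_num))
  filter_upwards [hR', eventually_ge_atTop 2] with x hx hx2
  have hupper : ∀ ε : ℝ, 0 < ε →
      ∑' n : ℕ, Λ n / (n : ℝ) ^ (1 + ε) * fejer L (Real.log n - x) ≤
      L * ∑ n ∈ logWindow x δ, Λ n / n + 1 / 10 := by
    intro ε hε
    refine Real.tsum_le_of_sum_le (fun n => mul_nonneg (div_nonneg
      ArithmeticFunction.vonMangoldt_nonneg (by positivity)) (fejer_nonneg hL _)) fun s => ?_
    have hterm : ∀ n ∈ s, Λ n / (n : ℝ) ^ (1 + ε) * fejer L (Real.log n - x) ≤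
        (if n ∈ logWindow x δ then Λ n / n * L else 0) +
        8 / (L * δ ^ 2) * (Λ n / n * (1 / (1 + (Real.log n - x) ^ 2))) := by
      intro n _
      rcases Nat.eq_zero_or_pos n with rfl | hn
      · simp [mem_logWindow]
      have hn1 : (1 : ℝ) ≤ n := by exact_mod_cast hn
      have hΛ : 0 ≤ Λ n / (n : ℝ) := div_nonneg ArithmeticFunction.vonMangoldt_nonneg (by positivity)
      have hle : Λ n / (n : ℝ) ^ (1 + ε) ≤ Λ n / n := by
        refine div_le_div_of_nonneg_left ArithmeticFunction.vonMangoldt_nonneg (by positivity) ?_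
        calc (n : ℝ) = (n : ℝ) ^ (1 : ℝ) := (Real.rpow_one _).symm
          _ ≤ _ := Real.rpow_le_rpow_of_exponent_le hn1 (by linarith)
      split_ifs with h
      · have h2 : 0 ≤ 8 / (L * δ ^ 2) * (Λ n / n * (1 / (1 + (Real.log n - x) ^ 2))) := by
          positivity
        have := mul_le_mul hle (fejer_le hL (Real.log n - x)) (fejer_nonneg hL _) hΛ
        linarith
      · rw [mem_logWindow] at h
        have hv : δ ^ 2 ≤ (Real.log n - x) ^ 2 := by
          by_contra! hcon
          have := abs_lt_of_sq_lt_sq hcon hδ.le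
          rw [abs_lt] at this
          exact h ⟨hn, by linarith, by linarith⟩
        have hv0 : Real.log n - x ≠ 0 := by
          intro h0; rw [h0] at hv; nlinarith
        have h3 : fejer L (Real.log n - x) ≤
            8 / (L * δ ^ 2) * (1 / (1 + (Real.log n - x) ^ 2)) := by
          refine (fejer_le_div_sq hL hv0).trans ?_
          rw [div_mul_div_comm, div_le_div_iff₀ (by positivity) (by positivity)]
          have h4 : δ ^ 2 * (1 + (Real.log n - x) ^ 2) ≤ 2 * (Real.log n - x) ^ 2 := by
            have : δ ^ 2 ≤ 1 := by nlinarith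
            nlinarith [sq_nonneg (Real.log n - x)]
          nlinarith
        calc _ ≤ Λ n / (n : ℝ) * (8 / (L * δ ^ 2) * (1 / (1 + (Real.log n - x) ^ 2))) :=
              mul_le_mul hle h3 (fejer_nonneg hL _) hΛ
          _ = _ := by ring
    refine (Finset.sum_le_sum hterm).trans ?_
    rw [Finset.sum_add_distrib, ← Finset.mul_sum]
    refine add_le_add ?_ ?_
    · rw [← Finset.sum_filter, Finset.mul_sum]
      refine (Finset.sum_le_sum_of_subset_of_nonneg (t := logWindow x δ)
        (fun n hn => (Finset.mem_filter.1 hn).2) fun n _ _ => ?_).trans (le_of_eq ?_)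
      · exact mul_nonneg (div_nonneg ArithmeticFunction.vonMangoldt_nonneg (by positivity)) hL.le
      · exact Finset.sum_congr rfl fun n _ => mul_comm _ _
    · exact (mul_le_mul_of_nonneg_left (hbound x s) (by positivity)).trans htail
  -- Only |u - x| ≤ 1/L is kept: an interval of length 2/L on which the kernel is at least 4L/π².
  have hlower : ∀ ε : ℝ, 0 < ε → Real.exp (-ε * (x + 1)) * (8 / π ^ 2) ≤
      ∫ u in Set.Ioi (0 : ℝ), Real.exp (-ε * u) * fejer L (u - x) := by
    intro ε hε
    have h_int : IntegrableOn (fun u : ℝ => Real.exp (-ε * u) * fejer L (u - x)) (Set.Ioi 0) := by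
      have h1 : IntegrableOn (fun u : ℝ => Real.exp (-ε * u) * L) (Set.Ioi 0) :=
        (exp_neg_integrableOn_Ioi 0 hε).mul_const L
      refine h1.mono' ?_ (Eventually.of_forall fun u => ?_)
      · have := continuous_fejer (L := L)
        exact (by fun_prop : Continuous fun u : ℝ =>
          Real.exp (-ε * u) * fejer L (u - x)).aestronglyMeasurable
      · rw [Real.norm_of_nonneg (mul_nonneg (Real.exp_pos _).le (fejer_nonneg hL _))]
        exact mul_le_mul_of_nonneg_left (fejer_le hL _) (Real.exp_pos _).le
    have hLinv : L⁻¹ ≤ 1 := inv_le_one_of_one_le₀ hL1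
    have hLinv0 : 0 < L⁻¹ := inv_pos.2 hL
    have hsub : Set.Ioc (x - L⁻¹) (x + L⁻¹) ⊆ Set.Ioi 0 := fun u hu => by
      have := hu.1
      simp only [Set.mem_Ioi]; linarith
    calc Real.exp (-ε * (x + 1)) * (8 / π ^ 2)
        = ∫ u in Set.Ioc (x - L⁻¹) (x + L⁻¹), Real.exp (-ε * (x + 1)) * (4 * L / π ^ 2) := by
          rw [setIntegral_const, measureReal_def, Real.volume_Ioc, ENNReal.toReal_ofReal (by linarith)]
          rw [smul_eq_mul]
          field_simp
          ring
      _ ≤ ∫ u in Set.Ioc (x - L⁻¹) (x + L⁻¹), Real.exp (-ε * u) * fejer L (u - x) := by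
          refine setIntegral_mono_on (integrableOn_const (by simp)) (h_int.mono_set hsub)
            measurableSet_Ioc fun u hu => ?_
          refine mul_le_mul ?_ (le_fejer hL ?_) (by positivity) (Real.exp_pos _).le
          · apply Real.exp_le_exp.2
            have := hu.2
            nlinarith
          · rw [abs_mul, abs_of_pos hL]
            have h1 : |u - x| ≤ L⁻¹ := abs_le.2 ⟨by linarith [hu.1], by linarith [hu.2]⟩
            calc L * |u - x| ≤ L * L⁻¹ := by gcongr
              _ = 1 := mul_inv_cancel₀ hL.ne'
              _ ≤ π := by linarith [Real.pi_gt_three]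
      _ ≤ _ := setIntegral_mono_set h_int (Eventually.of_forall fun u =>
            mul_nonneg (Real.exp_pos _).le (fejer_nonneg hL _)) hsub.eventuallyLE
  have hlim1 : Tendsto (fun ε : ℝ => Real.exp (-ε * (x + 1)) * (8 / π ^ 2)) (𝓝[>] 0)
      (𝓝 (Real.exp (-0 * (x + 1)) * (8 / π ^ 2))) := by
    refine Tendsto.mono_left ?_ nhdsWithin_le_nhds
    exact Continuous.tendsto (by fun_prop) 0
  have hlim := hlim1.add (tendsto_integral_tent_zetaAux hL x)
  have hfin := le_of_tendsto hlim (b := L * ∑ n ∈ logWindow x δ, Λ n / n + 1 / 10) (by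
    filter_upwards [self_mem_nhdsWithin] with ε hε
    have hε0 : 0 < ε := hε
    have h1 := (tsum_vonMangoldt_fejer hL hε0 x).2
    have h2 := hupper ε hε0
    have h3 := hlower ε hε0
    linarith)
  simp only [neg_zero, zero_mul, Real.exp_zero, one_mul] at hfin
  have hpi : (7 : ℝ) / 10 ≤ 8 / π ^ 2 := by
    rw [div_le_div_iff₀ (by norm_num) (by positivity)]
    nlinarith [Real.pi_lt_d2, Real.pi_pos]
  rw [div_le_iff₀ hL]
  linarith

/-- Every window `(e ^ u, e ^ (u + δ)]` contains a positive proportion of the expected number of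
primes. -/
theorem exists_le_card_primes_window {δ : ℝ} (hδ : 0 < δ) (hδ₁ : δ ≤ 1) :
    ∃ c : ℝ, 0 < c ∧ ∀ᶠ x : ℝ in atTop,
      c * (Real.exp x / x) ≤ ((logWindow x δ).filter Nat.Prime).card := by
  obtain ⟨c, hc, h⟩ := exists_le_sum_vonMangoldt hδ hδ₁
  refine ⟨c / 2 * Real.exp (-δ) / 2, by positivity, ?_⟩
  -- Proper prime powers contribute a convergent series, so a window far enough to the right
  -- receives less than c/2 from them.
  obtain ⟨s, hs⟩ := summable_iff_vanishing_norm.1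
    (summable_residueClass_non_primes_div (q := 1) 0) (c / 2) (by positivity)
  obtain ⟨N, hN⟩ : ∃ N : ℕ, ∀ n ∈ s, n ≤ N := ⟨s.sup id, fun n hn => Finset.le_sup (f := id) hn⟩
  filter_upwards [h, eventually_ge_atTop (2 : ℝ), eventually_ge_atTop (Real.log (N + 1) + 1)]
    with x hx hx2 hxN
  have hmem : ∀ n ∈ logWindow x δ, Real.exp (x - δ) < n ∧ Real.log n ≤ x + δ ∧ 0 < n := by
    intro n hn
    obtain ⟨h1, h2, h3⟩ := mem_logWindow.1 hn
    exact ⟨(Real.lt_log_iff_exp_lt (by exact_mod_cast h1)).1 h2, h3, h1⟩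
  have hdisj : Disjoint (logWindow x δ) s := by
    rw [Finset.disjoint_left]
    intro n hn hns
    obtain ⟨h1, h2, h3⟩ := mem_logWindow.1 hn
    have h4 : Real.log n ≤ Real.log (N + 1) :=
      Real.log_le_log (by exact_mod_cast h1) (by exact_mod_cast (hN n hns).trans (Nat.le_succ N))
    linarith
  have hnp := hs _ hdisj
  have hres : ∀ n : ℕ, residueClass (q := 1) 0 n = Λ n := by
    intro n
    have : (n : ZMod 1) = 0 := Subsingleton.elim _ _
    simp [residueClass, Set.indicator, this]
  simp_rw [hres] at hnp
  have hsplit : ∑ n ∈ logWindow x δ, Λ n / n =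
      ∑ n ∈ (logWindow x δ).filter Nat.Prime, Λ n / n +
      ∑ n ∈ logWindow x δ, (if n.Prime then 0 else Λ n) / (n : ℝ) := by
    rw [Finset.sum_filter, ← Finset.sum_add_distrib]
    refine Finset.sum_congr rfl fun n _ => ?_
    split_ifs <;> simp
  have hle : ∑ n ∈ (logWindow x δ).filter Nat.Prime, Λ n / n ≤
      ((logWindow x δ).filter Nat.Prime).card * ((x + δ) * Real.exp (-(x - δ))) := by
    rw [← nsmul_eq_mul]
    refine Finset.sum_le_card_nsmul _ _ _ fun n hn => ?_
    obtain ⟨hn1, hn2⟩ := Finset.mem_filter.1 hn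
    obtain ⟨h1, h2, h3⟩ := hmem n hn1
    rw [ArithmeticFunction.vonMangoldt_apply_prime hn2, div_eq_mul_inv, Real.exp_neg]
    have := Real.log_natCast_nonneg n
    gcongr
  have h5 := (le_abs_self _).trans_lt hnp
  have h6 : c / 2 ≤ ((logWindow x δ).filter Nat.Prime).card *
      ((x + δ) * Real.exp (-(x - δ))) := by linarith
  set k : ℝ := (((logWindow x δ).filter Nat.Prime).card : ℝ)
  have hk : 0 ≤ k := Nat.cast_nonneg _
  have h7 : k * ((x + δ) * Real.exp (-(x - δ))) ≤ k * ((2 * x) * Real.exp (-(x - δ))) := by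
    gcongr; linarith
  have h8 : Real.exp (-(x - δ)) = Real.exp δ / Real.exp x := by
    rw [neg_sub, Real.exp_sub]
  rw [h8] at h7 h6
  have h9 := h6.trans h7
  rw [Real.exp_neg]
  have hx0 : 0 < x := by linarith
  have e1 : c / 2 * (Real.exp δ)⁻¹ / 2 * (Real.exp x / x) =
    c / 2 * (Real.exp x / (2 * x * Real.exp δ)) := by field_simp
  rw [e1]
  calc c / 2 * (Real.exp x / (2 * x * Real.exp δ))
      ≤ k * (2 * x * (Real.exp δ / Real.exp x)) * (Real.exp x / (2 * x * Real.exp δ)) := by gcongr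
    _ = k := by field_simp

end

/-! ### The Cauchy integral formula on a rectangle -/

/-- The integral of `f` along the positively oriented boundary of `[x₀, x₁] × [y₀, y₁]`. -/
def rectIntegral {E : Type*} [NormedAddCommGroup E] [NormedSpace ℂ E] (f : ℂ → E)
    (x₀ x₁ y₀ y₁ : ℝ) : E :=
  (∫ x : ℝ in x₀..x₁, f (x + y₀ * Complex.I)) - (∫ x : ℝ in x₀..x₁, f (x + y₁ * Complex.I)) +
    Complex.I • (∫ y : ℝ in y₀..y₁, f (x₁ + y * Complex.I)) -
    Complex.I • (∫ y : ℝ in y₀..y₁, f (x₀ + y * Complex.I))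

/-- The boundary of `[x₀, x₁] × [y₀, y₁]`. -/
def rectBoundary (x₀ x₁ y₀ y₁ : ℝ) : Set ℂ :=
  {w | w.re ∈ Set.Icc x₀ x₁ ∧ w.im ∈ Set.Icc y₀ y₁ ∧
    (w.re = x₀ ∨ w.re = x₁ ∨ w.im = y₀ ∨ w.im = y₁)}

theorem rectIntegral_eq_zero {x₀ x₁ y₀ y₁ : ℝ} (hx : x₀ ≤ x₁) (hy : y₀ ≤ y₁) {f : ℂ → ℂ}
    (hf : DifferentiableOn ℂ f {w | w.re ∈ Set.Icc x₀ x₁ ∧ w.im ∈ Set.Icc y₀ y₁}) :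
    rectIntegral f x₀ x₁ y₀ y₁ = 0 := by
  have h := Complex.integral_boundary_rect_eq_zero_of_differentiableOn f
    (x₀ + y₀ * Complex.I) (x₁ + y₁ * Complex.I) (by
      refine hf.mono fun w hw => ?_
      simpa [Complex.mem_reProdIm, Set.uIcc_of_le hx, Set.uIcc_of_le hy] using hw)
  simpa [rectIntegral] using h

section

variable {E : Type*} [NormedAddCommGroup E] [NormedSpace ℂ E] {x₀ x₁ y₀ y₁ : ℝ}

theorem mem_rectBoundary_horizontal (hy : y₀ ≤ y₁) {x : ℝ} (h : x ∈ Set.Icc x₀ x₁) :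
    (x : ℂ) + y₀ * Complex.I ∈ rectBoundary x₀ x₁ y₀ y₁ ∧
    (x : ℂ) + y₁ * Complex.I ∈ rectBoundary x₀ x₁ y₀ y₁ := by
  constructor <;> simp [rectBoundary, hy, h.1, h.2]

theorem mem_rectBoundary_vertical (hx : x₀ ≤ x₁) {y : ℝ} (h : y ∈ Set.Icc y₀ y₁) :
    (x₀ : ℂ) + y * Complex.I ∈ rectBoundary x₀ x₁ y₀ y₁ ∧
    (x₁ : ℂ) + y * Complex.I ∈ rectBoundary x₀ x₁ y₀ y₁ := by
  constructor <;> simp [rectBoundary, hx, h.1, h.2]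

theorem rectIntegral_congr (hx : x₀ ≤ x₁) (hy : y₀ ≤ y₁) {f g : ℂ → E}
    (h : Set.EqOn f g (rectBoundary x₀ x₁ y₀ y₁)) :
    rectIntegral f x₀ x₁ y₀ y₁ = rectIntegral g x₀ x₁ y₀ y₁ := by
  unfold rectIntegral
  congr 1
  · congr 1
    · congr 1 <;> refine intervalIntegral.integral_congr fun x hx' => ?_ <;>
        rw [Set.uIcc_of_le hx] at hx'
      · exact h (mem_rectBoundary_horizontal hy hx').1
      · exact h (mem_rectBoundary_horizontal hy hx').2
    · congr 1
      refine intervalIntegral.integral_congr fun y hy' => ?_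
      rw [Set.uIcc_of_le hy] at hy'
      exact h (mem_rectBoundary_vertical hx hy').2
  · congr 1
    refine intervalIntegral.integral_congr fun y hy' => ?_
    rw [Set.uIcc_of_le hy] at hy'
    exact h (mem_rectBoundary_vertical hx hy').1

theorem intervalIntegrable_rectBoundary {E : Type*} [NormedAddCommGroup E]
    (hx : x₀ ≤ x₁) (hy : y₀ ≤ y₁) {f : ℂ → E}
    (hf : ContinuousOn f (rectBoundary x₀ x₁ y₀ y₁)) :
    IntervalIntegrable (fun x : ℝ => f (x + y₀ * Complex.I)) volume x₀ x₁ ∧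
    IntervalIntegrable (fun x : ℝ => f (x + y₁ * Complex.I)) volume x₀ x₁ ∧
    IntervalIntegrable (fun y : ℝ => f (x₁ + y * Complex.I)) volume y₀ y₁ ∧
    IntervalIntegrable (fun y : ℝ => f (x₀ + y * Complex.I)) volume y₀ y₁ := by
  refine ⟨?_, ?_, ?_, ?_⟩ <;> refine ContinuousOn.intervalIntegrable ?_ <;>
    refine hf.comp (by fun_prop) fun t ht => ?_
  · rw [Set.uIcc_of_le hx] at ht; exact (mem_rectBoundary_horizontal hy ht).1
  · rw [Set.uIcc_of_le hx] at ht; exact (mem_rectBoundary_horizontal hy ht).2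
  · rw [Set.uIcc_of_le hy] at ht; exact (mem_rectBoundary_vertical hx ht).2
  · rw [Set.uIcc_of_le hy] at ht; exact (mem_rectBoundary_vertical hx ht).1

theorem rectIntegral_add (hx : x₀ ≤ x₁) (hy : y₀ ≤ y₁) {f g : ℂ → E}
    (hf : ContinuousOn f (rectBoundary x₀ x₁ y₀ y₁))
    (hg : ContinuousOn g (rectBoundary x₀ x₁ y₀ y₁)) :
    rectIntegral (fun w => f w + g w) x₀ x₁ y₀ y₁ =
      rectIntegral f x₀ x₁ y₀ y₁ + rectIntegral g x₀ x₁ y₀ y₁ := by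
  obtain ⟨f1, f2, f3, f4⟩ := intervalIntegrable_rectBoundary hx hy hf
  obtain ⟨g1, g2, g3, g4⟩ := intervalIntegrable_rectBoundary hx hy hg
  simp only [rectIntegral]
  rw [intervalIntegral.integral_add f1 g1, intervalIntegral.integral_add f2 g2,
    intervalIntegral.integral_add f3 g3, intervalIntegral.integral_add f4 g4, smul_add, smul_add]
  abel

theorem rectIntegral_comp_clm [CompleteSpace E] {F : Type*} [NormedAddCommGroup F]
    [NormedSpace ℂ F] [CompleteSpace F]
    (hx : x₀ ≤ x₁) (hy : y₀ ≤ y₁) {f : ℂ → E}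
    (hf : ContinuousOn f (rectBoundary x₀ x₁ y₀ y₁)) (l : E →L[ℂ] F) :
    rectIntegral (fun w => l (f w)) x₀ x₁ y₀ y₁ = l (rectIntegral f x₀ x₁ y₀ y₁) := by
  obtain ⟨f1, f2, f3, f4⟩ := intervalIntegrable_rectBoundary hx hy hf
  simp only [rectIntegral, map_sub, map_add, map_smul]
  rw [l.intervalIntegral_comp_comm f1, l.intervalIntegral_comp_comm f2,
    l.intervalIntegral_comp_comm f3, l.intervalIntegral_comp_comm f4]

end

/-- This is the jump at a corner between the branches of log used on two adjacent sides. -/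
theorem log_I_mul_sub_log {v : ℂ} (hv : 0 < v.re) :
    Complex.log (Complex.I * v) - Complex.log v = Complex.I * (π / 2) := by
  have hv0 : v ≠ 0 := by rintro rfl; simp at hv
  have harg := (Complex.abs_arg_lt_pi_div_two_iff (z := v)).2 (Or.inl hv)
  rw [abs_lt] at harg
  rw [Complex.log_mul Complex.I_ne_zero hv0, Complex.log_I]
  · ring
  · rw [Complex.arg_I]; constructor <;> linarith [Real.pi_pos]

theorem integral_inv_eq_log_sub_log {a b : ℝ} (hab : a ≤ b) (A d c : ℂ) (hd : d ≠ 0)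
    (hc : c ≠ 0)
    (h : ∀ x ∈ Set.Icc a b, 0 < (c * (A + x * d)).re) :
    d * ∫ x : ℝ in a..b, (A + x * d)⁻¹ =
      Complex.log (c * (A + b * d)) - Complex.log (c * (A + a * d)) := by
  have hne : ∀ x ∈ Set.Icc a b, A + x * d ≠ 0 := by
    intro x hx h0
    have := h x hx
    rw [h0] at this; simp at this
  rw [← intervalIntegral.integral_const_mul]
  have hderiv : ∀ x ∈ Set.uIcc a b, HasDerivAt (fun x : ℝ => Complex.log (c * (A + x * d)))
      (d * (A + x * d)⁻¹) x := by
    intro x hx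
    rw [Set.uIcc_of_le hab] at hx
    have h1 : HasDerivAt (fun x : ℝ => c * (A + x * d)) (c * d) x := by
      have : HasDerivAt (fun x : ℝ => (x : ℂ)) 1 x := Complex.ofRealCLM.hasDerivAt
      simpa using ((this.mul_const d).const_add A).const_mul c
    refine (h1.clog_real (Or.inl (h x hx))).congr_deriv ?_
    have := hne x hx
    field_simp
  rw [intervalIntegral.integral_eq_sub_of_hasDerivAt hderiv]
  refine ContinuousOn.intervalIntegrable ?_
  rw [Set.uIcc_of_le hab]
  exact continuousOn_const.mul (ContinuousOn.inv₀ (by fun_prop) hne)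

/-- On each side w - s is multiplied by one of i, -i, 1, -1 so as to lie in the right half-plane,
where the principal logarithm is a primitive. The endpoint values combine into four corner jumps of
iπ/2 each. -/
theorem rectIntegral_inv_sub {x₀ x₁ y₀ y₁ : ℝ} {s : ℂ} (hx : s.re ∈ Set.Ioo x₀ x₁)
    (hy : s.im ∈ Set.Ioo y₀ y₁) :
    rectIntegral (fun w => (w - s)⁻¹) x₀ x₁ y₀ y₁ = 2 * π * Complex.I := by
  have hxle : x₀ ≤ x₁ := (hx.1.trans hx.2).le
  have hyle : y₀ ≤ y₁ := (hy.1.trans hy.2).le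
  have e1 := integral_inv_eq_log_sub_log hxle (y₀ * Complex.I - s) 1 Complex.I one_ne_zero
    Complex.I_ne_zero (by intro x _; simp; exact hy.1)
  have e2 := integral_inv_eq_log_sub_log hxle (y₁ * Complex.I - s) 1 (-Complex.I) one_ne_zero
    (neg_ne_zero.2 Complex.I_ne_zero) (by intro x _; simp; exact hy.2)
  have e3 := integral_inv_eq_log_sub_log hyle (x₁ - s) Complex.I 1 Complex.I_ne_zero
    one_ne_zero (by intro x _; simp; exact hx.2)
  have e4 := integral_inv_eq_log_sub_log hyle (x₀ - s) Complex.I (-1) Complex.I_ne_zero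
    (by norm_num) (by intro x _; simp; exact hx.1)
  simp only [one_mul, mul_one] at e1 e2 e3 e4
  have r1 := log_I_mul_sub_log (v := x₁ + y₀ * Complex.I - s) (by simp; exact hx.2)
  have r2 := log_I_mul_sub_log (v := -Complex.I * (x₁ + y₁ * Complex.I - s)) (by simp; exact hy.2)
  have r3 := log_I_mul_sub_log (v := -(x₀ + y₁ * Complex.I - s)) (by simp; exact hx.1)
  have r4 := log_I_mul_sub_log (v := Complex.I * (x₀ + y₀ * Complex.I - s)) (by simp; exact hy.1)
  have i1 : ∀ z : ℂ, Complex.I * (-Complex.I * z) = z := fun z => by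
    rw [← mul_assoc, mul_neg, Complex.I_mul_I]; ring
  have i2 : ∀ z : ℂ, Complex.I * (Complex.I * z) = -z := fun z => by
    rw [← mul_assoc, Complex.I_mul_I]; ring
  rw [i1] at r2
  rw [i2] at r4
  simp only [rectIntegral, smul_eq_mul]
  have c1 : ∀ x y : ℝ, (x : ℂ) + y * Complex.I - s = y * Complex.I - s + x := fun x y => by ring
  have c2 : ∀ x y : ℝ, (x : ℂ) + y * Complex.I - s = x - s + y * Complex.I := fun x y => by ring
  have E1 : ∫ x : ℝ in x₀..x₁, ((x : ℂ) + y₀ * Complex.I - s)⁻¹ =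
      Complex.log (Complex.I * (x₁ + y₀ * Complex.I - s)) -
      Complex.log (Complex.I * (x₀ + y₀ * Complex.I - s)) := by
    simp only [c1]; exact e1
  have E2 : ∫ x : ℝ in x₀..x₁, ((x : ℂ) + y₁ * Complex.I - s)⁻¹ =
      Complex.log (-Complex.I * (x₁ + y₁ * Complex.I - s)) -
      Complex.log (-Complex.I * (x₀ + y₁ * Complex.I - s)) := by
    simp only [c1]; exact e2
  have E3 : Complex.I * ∫ y : ℝ in y₀..y₁, ((x₁ : ℂ) + y * Complex.I - s)⁻¹ =
      Complex.log (x₁ + y₁ * Complex.I - s) - Complex.log (x₁ + y₀ * Complex.I - s) := by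
    simp only [c2]; exact e3
  have E4 : Complex.I * ∫ y : ℝ in y₀..y₁, ((x₀ : ℂ) + y * Complex.I - s)⁻¹ =
      Complex.log (-(x₀ + y₁ * Complex.I - s)) - Complex.log (-(x₀ + y₀ * Complex.I - s)) := by
    simp only [c2]; simpa using e4
  rw [E1, E2, E3, E4]
  have r3' : Complex.I * -(x₀ + y₁ * Complex.I - s) = -Complex.I * (x₀ + y₁ * Complex.I - s) := by
    ring
  rw [r3'] at r3
  linear_combination r1 + r2 + r3 + r4

theorem sub_ne_zero_of_mem_rectBoundary {x₀ x₁ y₀ y₁ : ℝ} {s w : ℂ} (hx : s.re ∈ Set.Ioo x₀ x₁)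
    (hy : s.im ∈ Set.Ioo y₀ y₁) (hw : w ∈ rectBoundary x₀ x₁ y₀ y₁) : w - s ≠ 0 := by
  intro h
  rw [sub_eq_zero] at h
  subst h
  obtain ⟨-, -, h⟩ := hw
  rcases h with h | h | h | h
  · exact hx.1.ne' h
  · exact hx.2.ne h
  · exact hy.1.ne' h
  · exact hy.2.ne h

/-- The difference quotient `dslope f s` is holomorphic and integrates to zero; what remains is f(s)
times the integral of 1/(w - s). -/
theorem rectIntegral_cauchy {x₀ x₁ y₀ y₁ : ℝ} {s : ℂ} (hx : s.re ∈ Set.Ioo x₀ x₁)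
    (hy : s.im ∈ Set.Ioo y₀ y₁) {f : ℂ → ℂ}
    (hf : DifferentiableOn ℂ f {w | w.re ∈ Set.Icc x₀ x₁ ∧ w.im ∈ Set.Icc y₀ y₁}) :
    rectIntegral (fun w => f w * (w - s)⁻¹) x₀ x₁ y₀ y₁ = 2 * π * Complex.I * f s := by
  have hxle : x₀ ≤ x₁ := (hx.1.trans hx.2).le
  have hyle : y₀ ≤ y₁ := (hy.1.trans hy.2).le
  set S : Set ℂ := {w | w.re ∈ Set.Icc x₀ x₁ ∧ w.im ∈ Set.Icc y₀ y₁} with hS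
  have hbS : rectBoundary x₀ x₁ y₀ y₁ ⊆ S := fun w hw => ⟨hw.1, hw.2.1⟩
  have hnhds : S ∈ 𝓝 s := by
    have h1 : Complex.re ⁻¹' Set.Icc x₀ x₁ ∈ 𝓝 s :=
      Complex.continuous_re.continuousAt (Icc_mem_nhds hx.1 hx.2)
    have h2 : Complex.im ⁻¹' Set.Icc y₀ y₁ ∈ 𝓝 s :=
      Complex.continuous_im.continuousAt (Icc_mem_nhds hy.1 hy.2)
    filter_upwards [h1, h2] with w hw1 hw2 using ⟨hw1, hw2⟩
  have hds : DifferentiableOn ℂ (dslope f s) S := (Complex.differentiableOn_dslope hnhds).2 hf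
  have hne := fun w => sub_ne_zero_of_mem_rectBoundary (w := w) hx hy
  have h0 := rectIntegral_eq_zero hxle hyle hds
  have hinv : ContinuousOn (fun w : ℂ => (w - s)⁻¹) (rectBoundary x₀ x₁ y₀ y₁) :=
    ContinuousOn.inv₀ (by fun_prop) hne
  have h1 : rectIntegral (fun w => f w * (w - s)⁻¹) x₀ x₁ y₀ y₁ =
      rectIntegral (fun w => dslope f s w + f s * (w - s)⁻¹) x₀ x₁ y₀ y₁ := by
    refine rectIntegral_congr hxle hyle fun w hw => ?_
    have hws : w ≠ s := sub_ne_zero.1 (hne w hw)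
    rw [dslope_of_ne _ hws, slope_def_field]
    ring
  have hinv' : ContinuousOn (fun w : ℂ => f s * (w - s)⁻¹) (rectBoundary x₀ x₁ y₀ y₁) :=
    continuousOn_const.mul hinv
  rw [h1, rectIntegral_add hxle hyle (hds.continuousOn.mono hbS) hinv', h0, zero_add]
  have h2 := rectIntegral_comp_clm hxle hyle hinv (ContinuousLinearMap.mul ℂ ℂ (f s))
  simp only [ContinuousLinearMap.mul_apply'] at h2
  rw [h2, rectIntegral_inv_sub hx hy]
  ring

/-- The sum of the integrals of `|f|²` over the sides of a rectangle. -/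
def rectEnergy (x₀ x₁ y₀ y₁ : ℝ) (f : ℂ → ℂ) : ℝ :=
  (∫ x : ℝ in x₀..x₁, ‖f (x + y₀ * Complex.I)‖ ^ 2) +
    (∫ x : ℝ in x₀..x₁, ‖f (x + y₁ * Complex.I)‖ ^ 2) +
    (∫ y : ℝ in y₀..y₁, ‖f (x₁ + y * Complex.I)‖ ^ 2) +
    (∫ y : ℝ in y₀..y₁, ‖f (x₀ + y * Complex.I)‖ ^ 2)

/-- Cauchy's formula with |f| ≤ η + |f|²/η on the boundary. The parameter η stands in for
Cauchy–Schwarz and turns a bound on a quadratic form into a pointwise bound. -/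
theorem norm_le_of_rectEnergy {x₀ x₁ y₀ y₁ : ℝ} {s : ℂ} (hx : s.re ∈ Set.Ioo x₀ x₁)
    (hy : s.im ∈ Set.Ioo y₀ y₁) {f : ℂ → ℂ} (hf : Differentiable ℂ f) {d η : ℝ} (hd : 0 < d)
    (hη : 0 < η) (hdist : ∀ w ∈ rectBoundary x₀ x₁ y₀ y₁, d ≤ ‖w - s‖) :
    ‖f s‖ ≤ d⁻¹ * (η * (2 * ((x₁ - x₀) + (y₁ - y₀))) + η⁻¹ * rectEnergy x₀ x₁ y₀ y₁ f) := by
  have hxle : x₀ ≤ x₁ := (hx.1.trans hx.2).le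
  have hyle : y₀ ≤ y₁ := (hy.1.trans hy.2).le
  have hc := rectIntegral_cauchy hx hy hf.differentiableOn
  have hpt : ∀ w ∈ rectBoundary x₀ x₁ y₀ y₁,
      ‖f w * (w - s)⁻¹‖ ≤ d⁻¹ * (η + η⁻¹ * ‖f w‖ ^ 2) := by
    intro w hw
    rw [norm_mul, norm_inv, mul_comm]
    have h1 : ‖w - s‖⁻¹ ≤ d⁻¹ := inv_anti₀ hd (hdist w hw)
    have h2 : ‖f w‖ ≤ η + η⁻¹ * ‖f w‖ ^ 2 := by
      have : η * ‖f w‖ ≤ η * (η + η⁻¹ * ‖f w‖ ^ 2) := by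
        rw [mul_add, ← mul_assoc, mul_inv_cancel₀ hη.ne', one_mul]
        nlinarith [sq_nonneg (η - ‖f w‖), sq_nonneg (η + ‖f w‖), norm_nonneg (f w)]
      exact le_of_mul_le_mul_left this hη
    exact mul_le_mul h1 h2 (norm_nonneg _) (by positivity)
  have hedge : ∀ (a b : ℝ) (γ : ℝ → ℂ), a ≤ b → Continuous γ →
      (∀ x ∈ Set.Icc a b, γ x ∈ rectBoundary x₀ x₁ y₀ y₁) →
      ‖∫ x : ℝ in a..b, f (γ x) * (γ x - s)⁻¹‖ ≤
        d⁻¹ * (η * (b - a) + η⁻¹ * ∫ x : ℝ in a..b, ‖f (γ x)‖ ^ 2) := by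
    intro a b γ hab hγ hmem
    have hfc := hf.continuous
    have hi : IntervalIntegrable (fun x : ℝ => η⁻¹ * ‖f (γ x)‖ ^ 2) volume a b :=
      Continuous.intervalIntegrable (by fun_prop) _ _
    refine (intervalIntegral.norm_integral_le_of_norm_le (g := fun x =>
      d⁻¹ * (η + η⁻¹ * ‖f (γ x)‖ ^ 2)) hab (Eventually.of_forall fun x hx' => ?_)
      (Continuous.intervalIntegrable (by fun_prop) _ _)).trans (le_of_eq ?_)
    · exact hpt _ (hmem x ⟨hx'.1.le, hx'.2⟩)
    · rw [intervalIntegral.integral_const_mul, intervalIntegral.integral_add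
        (by simp) hi, intervalIntegral.integral_const_mul]
      simp [mul_comm]
  have b1 := hedge x₀ x₁ (fun x => x + y₀ * Complex.I) hxle (by fun_prop)
    fun x hx' => (mem_rectBoundary_horizontal hyle hx').1
  have b2 := hedge x₀ x₁ (fun x => x + y₁ * Complex.I) hxle (by fun_prop)
    fun x hx' => (mem_rectBoundary_horizontal hyle hx').2
  have b3 := hedge y₀ y₁ (fun y => x₁ + y * Complex.I) hyle (by fun_prop)
    fun y hy' => (mem_rectBoundary_vertical hxle hy').2
  have b4 := hedge y₀ y₁ (fun y => x₀ + y * Complex.I) hyle (by fun_prop)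
    fun y hy' => (mem_rectBoundary_vertical hxle hy').1
  have h2pi : ‖2 * π * Complex.I * f s‖ = 2 * π * ‖f s‖ := by
    rw [norm_mul, norm_mul, norm_mul, Complex.norm_I, Complex.norm_real,
      Real.norm_of_nonneg Real.pi_pos.le]
    simp
  have hnorm : 2 * π * ‖f s‖ ≤
      d⁻¹ * (η * (2 * ((x₁ - x₀) + (y₁ - y₀))) + η⁻¹ * rectEnergy x₀ x₁ y₀ y₁ f) := by
    rw [← h2pi, ← hc, rectIntegral]
    refine (norm_sub_le _ _).trans ((add_le_add_left (norm_add_le _ _) _).trans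
      ((add_le_add_left (add_le_add_left (norm_sub_le _ _) _) _).trans ?_))
    rw [norm_smul, norm_smul, Complex.norm_I, one_mul, one_mul]
    refine (add_le_add (add_le_add (add_le_add b1 b2) b3) b4).trans (le_of_eq ?_)
    rw [rectEnergy]; ring
  have : ‖f s‖ ≤ 2 * π * ‖f s‖ := by
    nlinarith [norm_nonneg (f s), Real.pi_gt_three]
  linarith

/-! ### Interpolation of exponentials -/

/-- Up to powers of 2 this product bounds the Lagrange coefficients for extrapolating to a point
left of roughly equally spaced nodes, which therefore grow only exponentially in N. -/
theorem prod_erase_range_div_eq_choose (i N : ℕ) (hi : i < N) :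
    ∏ j ∈ (Finset.range N).erase i, (((j : ℝ) + 1) / |(i : ℝ) - j|) = N.choose (i + 1) := by
  induction N, (Nat.succ_le_of_lt hi) using Nat.le_induction with
  | base =>
    have h1 : (Finset.range (i + 1)).erase i = Finset.range i := by
      rw [Finset.range_add_one, Finset.erase_insert (by simp)]
    rw [Nat.succ_eq_add_one, h1, Finset.prod_div_distrib, Nat.choose_self, Nat.cast_one]
    have h2 : ∏ j ∈ Finset.range i, |(i : ℝ) - j| = ∏ j ∈ Finset.range i, ((j : ℝ) + 1) := by
      rw [← Finset.prod_range_reflect]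
      refine Finset.prod_congr rfl fun j hj => ?_
      have hj' := Finset.mem_range.1 hj
      have : ((i - 1 - j : ℕ) : ℝ) = (i : ℝ) - 1 - j := by
        rw [Nat.sub_sub, Nat.cast_sub (by omega)]; push_cast; ring
      rw [this, abs_of_nonneg] <;> [skip; skip] <;> ring_nf
      positivity
    rw [h2]
    exact div_self (Finset.prod_ne_zero_iff.2 fun j _ => by positivity)
  | succ N hN ih =>
    have hiN : i < N := hN
    have h1 : (Finset.range (N + 1)).erase i = insert N ((Finset.range N).erase i) := by
      rw [Finset.range_add_one, Finset.erase_insert_of_ne (by omega)]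
    rw [h1, Finset.prod_insert (by simp), ih hiN]
    have h2 := Nat.choose_mul_succ_eq N (i + 1)
    have h3 : |(i : ℝ) - N| = ((N + 1 - (i + 1) : ℕ) : ℝ) := by
      have : (i : ℝ) ≤ N := by exact_mod_cast hiN.le
      rw [Nat.add_sub_add_right, Nat.cast_sub hiN.le, abs_sub_comm, abs_of_nonneg (by linarith)]
    have h4 : ((N + 1 - (i + 1) : ℕ) : ℝ) ≠ 0 := by
      have : N + 1 - (i + 1) ≠ 0 := by omega
      exact_mod_cast this
    rw [h3, div_mul_eq_mul_div, div_eq_iff h4]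
    have h5 : ((N.choose (i + 1) * (N + 1) : ℕ) : ℝ) =
      (((N + 1).choose (i + 1) * (N + 1 - (i + 1)) : ℕ) : ℝ) := by exact_mod_cast h2
    push_cast at h5 ⊢
    rw [mul_comm]; exact h5

/-- The tail of the exponential series is compared termwise with a full one, using n! m! ≤ (n+m)!.
-/
theorem norm_exp_sub_sum_le (z : ℂ) (n : ℕ) :
    ‖Complex.exp z - ∑ m ∈ Finset.range n, z ^ m / m.factorial‖ ≤
      ‖z‖ ^ n / n.factorial * Real.exp ‖z‖ := by
  refine (Complex.norm_exp_sub_sum_le_exp_norm_sub_sum z n).trans ?_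
  have hs : ∀ r : ℝ, HasSum (fun m : ℕ => r ^ m / m.factorial) (Real.exp r) := fun r => by
    rw [Real.exp_eq_exp_ℝ]; exact NormedSpace.expSeries_div_hasSum_exp r
  have h1 := (hasSum_nat_add_iff' n).2 (hs ‖z‖)
  have h2 := (hs ‖z‖).mul_left (‖z‖ ^ n / n.factorial)
  refine hasSum_le (fun m => ?_) h1 h2
  rw [div_mul_div_comm, ← pow_add, add_comm n m]
  gcongr
  have := Nat.factorial_mul_factorial_dvd_factorial_add n m
  have := Nat.le_of_dvd (Nat.factorial_pos _) this
  rw [add_comm n m] at this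
  exact_mod_cast this

/-- Interpolating `e ^ {-s y}` at `N` separated nodes to the right of `x`. -/
theorem exists_interpolation_exp (N : ℕ) (hN : 0 < N) {δ x R : ℝ} (hδ : 0 < δ) (hx : 0 ≤ x)
    (hR : 0 ≤ R) (lam : ℕ → ℝ)
    (hlam : ∀ i < N, lam i ∈ Set.Ioc (x + 2 * i * δ) (x + 2 * i * δ + δ)) :
    ∃ c : ℕ → ℂ, (∀ i < N, ‖c i‖ ≤ 4 ^ N) ∧ ∀ s : ℂ, 0 ≤ s.re → ‖s‖ ≤ R →
      ‖Complex.exp (-s * x) - ∑ i ∈ Finset.range N, c i * Complex.exp (-s * lam i)‖ ≤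
      N * 4 ^ N * ((N * (2 * δ * R)) ^ N / N.factorial * Real.exp (N * (2 * δ * R))) := by
  set v : ℕ → ℂ := fun i => (lam i : ℂ) with hv
  have hsep : ∀ i < N, ∀ j < N, i ≠ j → |(i : ℝ) - j| * δ ≤ |lam i - lam j| := by
    have key : ∀ i j : ℕ, i < N → j < N → i < j → |(i : ℝ) - j| * δ ≤ |lam i - lam j| := by
      intro i j hi hj hij
      have h1 := hlam i hi
      have h2 := hlam j hj
      have h3 : (i : ℝ) + 1 ≤ j := by exact_mod_cast hij
      rw [abs_sub_comm, abs_of_nonneg (by linarith), abs_sub_comm (lam i)]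
      refine le_trans ?_ (le_abs_self _)
      nlinarith [h1.2, h2.1]
    intro i hi j hj hij
    rcases lt_or_gt_of_ne hij with h | h
    · exact key i j hi hj h
    · rw [abs_sub_comm, abs_sub_comm (lam i)]; exact key j i hj hi h
  have hinj : Set.InjOn v (Finset.range N) := by
    intro i hi j hj hij
    by_contra hne
    have h1 := hsep i (by simpa using hi) j (by simpa using hj) hne
    have h2 : lam i = lam j := by simpa [hv] using hij
    rw [h2, sub_self, abs_zero] at h1
    have h3 : 0 < |(i : ℝ) - j| := abs_pos.2 (sub_ne_zero.2 (by exact_mod_cast hne))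
    nlinarith
  set c : ℕ → ℂ := fun i => (Lagrange.basis (Finset.range N) v i).eval (x : ℂ) with hc
  -- Each factor is at most 2(j+1)/|i-j|; the powers of 2 and the binomial coefficient contribute at
  -- most 2^N each.
  have hcb : ∀ i < N, ‖c i‖ ≤ 4 ^ N := by
    intro i hi
    simp only [hc, Lagrange.basis, Polynomial.eval_prod, Lagrange.basisDivisor]
    rw [norm_prod]
    have h1 : ∀ j ∈ (Finset.range N).erase i,
        ‖(Polynomial.C (v i - v j)⁻¹ * (Polynomial.X - Polynomial.C (v j))).eval (x : ℂ)‖ ≤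
        2 * (((j : ℝ) + 1) / |(i : ℝ) - j|) := by
      intro j hj
      obtain ⟨hji, hjN⟩ := Finset.mem_erase.1 hj
      have hjN' := Finset.mem_range.1 hjN
      simp only [Polynomial.eval_mul, Polynomial.eval_C, Polynomial.eval_sub, Polynomial.eval_X, hv]
      rw [norm_mul, norm_inv, ← Complex.ofReal_sub, ← Complex.ofReal_sub, Complex.norm_real,
        Complex.norm_real, Real.norm_eq_abs, Real.norm_eq_abs]
      have h2 := hsep i hi j hjN' hji.symm
      have h3 : 0 < |(i : ℝ) - j| := abs_pos.2 (sub_ne_zero.2 (by exact_mod_cast hji.symm))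
      have h4 : |x - lam j| ≤ 2 * (j + 1) * δ := by
        have := hlam j hjN'
        rw [abs_sub_comm, abs_of_nonneg]
        · linarith [this.2]
        · have : (0 : ℝ) ≤ 2 * j * δ := by positivity
          linarith [(hlam j hjN').1]
      calc |lam i - lam j|⁻¹ * |x - lam j| ≤ (|(i : ℝ) - j| * δ)⁻¹ * (2 * (j + 1) * δ) := by
            gcongr
        _ = _ := by field_simp
    refine (Finset.prod_le_prod (fun j _ => norm_nonneg _) h1).trans ?_
    rw [Finset.prod_mul_distrib, prod_erase_range_div_eq_choose i N hi, Finset.prod_const]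
    have h5 : ((Finset.range N).erase i).card ≤ N := by
      refine (Finset.card_erase_le).trans (by simp)
    have h6 : (2 : ℝ) ^ ((Finset.range N).erase i).card ≤ 2 ^ N :=
      pow_le_pow_right₀ (by norm_num) h5
    have h7 : (N.choose (i + 1) : ℝ) ≤ 2 ^ N := by exact_mod_cast Nat.choose_le_two_pow N (i + 1)
    calc _ ≤ (2 : ℝ) ^ N * 2 ^ N := by gcongr
      _ = 4 ^ N := by rw [← mul_pow]; norm_num
  refine ⟨c, hcb, fun s hs0 hsR => ?_⟩
  -- The Taylor polynomial at x of y ↦ e^{-s(y-x)}. Having degree below N it is reproduced exactly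
  -- by interpolation at the nodes, and its value at x is 1, so only Taylor remainders at the nodes
  -- enter the error.
  set P : Polynomial ℂ := ∑ k ∈ Finset.range N,
    Polynomial.C ((-s) ^ k / k.factorial) * (Polynomial.X - Polynomial.C (x : ℂ)) ^ k with hP
  have hPeval : ∀ y : ℂ, P.eval y = ∑ k ∈ Finset.range N, (-s * (y - x)) ^ k / k.factorial := by
    intro y
    simp only [hP, Polynomial.eval_finsetSum, Polynomial.eval_mul, Polynomial.eval_C,
      Polynomial.eval_pow, Polynomial.eval_sub, Polynomial.eval_X]
    refine Finset.sum_congr rfl fun k _ => ?_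
    rw [mul_pow]; ring
  have hdeg : P.degree < (Finset.range N).card := by
    rw [Finset.card_range, hP]
    refine (Polynomial.degree_sum_le _ _).trans_lt ?_
    refine (Finset.sup_lt_iff (by exact_mod_cast WithBot.bot_lt_coe N)).2 fun k hk => ?_
    refine (Polynomial.degree_mul_le _ _).trans_lt ?_
    refine (add_le_add_left Polynomial.degree_C_le _).trans_lt ?_
    rw [zero_add, Polynomial.degree_pow, Polynomial.degree_X_sub_C]
    simpa using Finset.mem_range.1 hk
  have hinterp := Lagrange.eq_interpolate hinj hdeg
  have h1 : (1 : ℂ) = ∑ i ∈ Finset.range N, c i * P.eval (v i) := by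
    have h2 : P.eval (x : ℂ) = 1 := by
      rw [hPeval]
      obtain ⟨M, rfl⟩ : ∃ M, N = M + 1 := ⟨N - 1, by omega⟩
      rw [Finset.sum_range_succ']
      simp
    rw [← h2]
    conv_lhs => rw [hinterp]
    rw [Lagrange.interpolate_apply, Polynomial.eval_finsetSum]
    refine Finset.sum_congr rfl fun i _ => ?_
    rw [Polynomial.eval_mul, Polynomial.eval_C, mul_comm]
  have herr : ∀ i < N, ‖P.eval (v i) - Complex.exp (-s * (lam i - x))‖ ≤
      (N * (2 * δ * R)) ^ N / N.factorial * Real.exp (N * (2 * δ * R)) := by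
    intro i hi
    rw [hPeval, norm_sub_rev]
    refine (norm_exp_sub_sum_le _ N).trans ?_
    have h3 : ‖-s * ((v i : ℂ) - x)‖ ≤ N * (2 * δ * R) := by
      rw [norm_mul, norm_neg]
      simp only [hv]
      rw [← Complex.ofReal_sub, Complex.norm_real, Real.norm_eq_abs]
      have h4 : |lam i - x| ≤ 2 * δ * N := by
        have h5 := hlam i hi
        have h6 : (i : ℝ) + 1 ≤ N := by exact_mod_cast hi
        have : (0 : ℝ) ≤ 2 * i * δ := by positivity
        rw [abs_of_nonneg (by linarith [h5.1])]
        nlinarith [h5.2]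
      calc ‖s‖ * |lam i - x| ≤ R * (2 * δ * N) := by gcongr
        _ = _ := by ring
    gcongr
  have hfac : Complex.exp (-s * x) - ∑ i ∈ Finset.range N, c i * Complex.exp (-s * lam i) =
      Complex.exp (-s * x) * ∑ i ∈ Finset.range N,
        c i * (P.eval (v i) - Complex.exp (-s * (lam i - x))) := by
    simp_rw [mul_sub, Finset.sum_sub_distrib]
    rw [← h1, mul_sub, mul_one, Finset.mul_sum]
    congr 1
    refine Finset.sum_congr rfl fun i _ => ?_
    rw [mul_left_comm, ← Complex.exp_add]
    congr 2; ring
  rw [hfac, norm_mul]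
  have h7 : ‖Complex.exp (-s * x)‖ ≤ 1 := by
    rw [Complex.norm_exp, Real.exp_le_one_iff]
    simp only [Complex.mul_re, Complex.neg_re, Complex.ofReal_re, Complex.neg_im, Complex.ofReal_im,
      mul_zero, sub_zero]
    nlinarith
  refine (mul_le_of_le_one_left (norm_nonneg _) h7).trans ?_
  refine (norm_sum_le _ _).trans ?_
  calc ∑ i ∈ Finset.range N, ‖c i * (P.eval (v i) - Complex.exp (-s * (lam i - x)))‖
      ≤ ∑ i ∈ Finset.range N,
        4 ^ N * ((N * (2 * δ * R)) ^ N / N.factorial * Real.exp (N * (2 * δ * R))) := by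
        refine Finset.sum_le_sum fun i hi => ?_
        have hi' := Finset.mem_range.1 hi
        rw [norm_mul]
        exact mul_le_mul (hcb i hi') (herr i hi') (norm_nonneg _) (by positivity)
    _ = _ := by rw [Finset.sum_const, Finset.card_range, nsmul_eq_mul]; ring

/-! ### Functionals on `C(K, ℂ)` and their Laplace transforms -/

/-- The exponential `s ↦ e ^ {-s x}` on `K`. -/
def expFun (K : Set ℂ) (x : ℝ) : C(K, ℂ) := ⟨fun s => Complex.exp (-(s : ℂ) * x), by fun_prop⟩

@[simp]
theorem expFun_apply (K : Set ℂ) (x : ℝ) (s : K) : expFun K x s = Complex.exp (-(s : ℂ) * x) := rfl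

theorem continuous_expFun (K : Set ℂ) : Continuous (expFun K) :=
  ContinuousMap.continuous_of_continuous_uncurry _ (by
    simp only [Function.uncurry_def, expFun_apply]; fun_prop)

theorem norm_exp_neg_mul_ofReal (s : ℂ) (x : ℝ) :
    ‖Complex.exp (-s * x)‖ = Real.exp (-(s.re * x)) := by
  rw [Complex.norm_exp]; simp

/-- If `ℓ(e ^ {-s x})` is of size `e ^ {-(1-ε) x}` at a point of each short interval, then it is
of size `e ^ {-β x}` everywhere, for all `β < 1`. -/
theorem exists_norm_le_exp_of_nodes (K : Set ℂ) [CompactSpace K] (hK : ∀ s ∈ K, 0 ≤ s.re)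
    (l : C(K, ℂ) →L[ℂ] ℂ) {C : ℝ} (hC : 0 ≤ C)
    (hnodes : ∀ δ : ℝ, 0 < δ → δ ≤ 1 → ∀ ε : ℝ, 0 < ε → ∀ᶠ u : ℝ in atTop,
      ∃ y ∈ Set.Ioc u (u + δ), ‖l (expFun K y)‖ ≤ C * Real.exp (-(1 - ε) * u))
    {β : ℝ} (hβ₀ : 0 < β) (hβ₁ : β < 1) :
    ∃ C' : ℝ, ∀ x : ℝ, 0 ≤ x → ‖l (expFun K x)‖ ≤ C' * Real.exp (-β * x) := by
  obtain ⟨R, hR0, hR⟩ : ∃ R : ℝ, 0 < R ∧ ∀ s ∈ K, ‖s‖ ≤ R := by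
    obtain ⟨R, hR⟩ := (isCompact_iff_compactSpace.2 ‹CompactSpace K›).isBounded.exists_norm_le
    exact ⟨max R 1, by positivity, fun s hs => (hR s hs).trans (le_max_left _ _)⟩
  -- Loss e^{εx} from the interpolation coefficients times the nodal decay e^{-(1-ε)x} gives exactly
  -- e^{-βx}.
  set ε : ℝ := (1 - β) / 2 with hε
  have hε0 : 0 < ε := by rw [hε]; linarith
  have hlog8 : 0 < Real.log 8 := Real.log_pos (by norm_num)
  -- About c·x nodes will be used, so that 8^N is of size e^{εx}. The spacing δ is then taken so
  -- small that the interpolation error, at most (8ηe²)^N, is below e^{-N/c} ≤ e^{-x}.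
  set c : ℝ := ε / Real.log 8 with hc
  have hc0 : 0 < c := by positivity
  set η₀ : ℝ := Real.exp (-(1 / c)) / (8 * Real.exp 2) with hη₀
  have hη₀0 : 0 < η₀ := by positivity
  set δ : ℝ := min 1 (η₀ / (2 * R)) with hδ
  have hδ0 : 0 < δ := lt_min one_pos (by positivity)
  set η : ℝ := 2 * δ * R with hη
  have hη0 : 0 < η := by positivity
  have hηle : 8 * η * Real.exp 2 ≤ Real.exp (-(1 / c)) := by
    have h1 : δ ≤ η₀ / (2 * R) := min_le_right _ _
    have h2 : η ≤ η₀ := by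
      rw [hη]
      calc 2 * δ * R ≤ 2 * (η₀ / (2 * R)) * R := by gcongr
        _ = η₀ := by field_simp
    calc 8 * η * Real.exp 2 ≤ 8 * η₀ * Real.exp 2 := by gcongr
      _ = _ := by rw [hη₀]; field_simp
  have hη1 : η ≤ 1 := by
    have h1 : Real.exp (-(1 / c)) ≤ 1 := by
      rw [Real.exp_le_one_iff]; have : 0 < 1 / c := by positivity
      linarith
    have h2 : 1 ≤ Real.exp 2 := by rw [Real.one_le_exp_iff]; norm_num
    nlinarith
  obtain ⟨u₀, hu₀⟩ := eventually_atTop.1 (hnodes δ hδ0 (min_le_left _ _) ε hε0)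
  set u₁ := max u₀ 0 with hu₁
  have hlarge : ∀ x : ℝ, u₁ ≤ x → ‖l (expFun K x)‖ ≤ (8 * C + ‖l‖) * Real.exp (-β * x) := by
    intro x hx
    have hx0 : 0 ≤ x := (le_max_right _ _).trans hx
    have hxu : u₀ ≤ x := (le_max_left _ _).trans hx
    set N : ℕ := ⌊c * x⌋₊ + 1 with hN
    have hN1 : c * x ≤ N := by rw [hN]; push_cast; exact (Nat.lt_floor_add_one _).le
    have hN2 : (N : ℝ) ≤ c * x + 1 := by
      rw [hN]; push_cast; linarith [Nat.floor_le (show 0 ≤ c * x by positivity)]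
    have hnode : ∀ i : ℕ, ∃ y ∈ Set.Ioc (x + 2 * i * δ) (x + 2 * i * δ + δ),
        ‖l (expFun K y)‖ ≤ C * Real.exp (-(1 - ε) * x) := by
      intro i
      have h0 : (0 : ℝ) ≤ 2 * i * δ := by positivity
      obtain ⟨y, hy, hy2⟩ := hu₀ (x + 2 * i * δ) (by linarith)
      refine ⟨y, hy, hy2.trans ?_⟩
      gcongr C * Real.exp ?_
      have : ε < 1 := by rw [hε]; linarith
      nlinarith
    choose lam hlam hlamb using hnode
    obtain ⟨a, ha, h_int⟩ := exists_interpolation_exp N (Nat.succ_pos _) hδ0 hx0 hR0.le lam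
      fun i _ => hlam i
    have hclose : ‖expFun K x - ∑ i ∈ Finset.range N, a i • expFun K (lam i)‖ ≤
        N * 4 ^ N * ((N * (2 * δ * R)) ^ N / N.factorial * Real.exp (N * (2 * δ * R))) := by
      rw [ContinuousMap.norm_le _ (by positivity)]
      intro s
      have := h_int s (hK s s.2) (hR s s.2)
      simpa [ContinuousMap.sum_apply] using this
    have hN2N : (N : ℝ) ≤ 2 ^ N := by exact_mod_cast Nat.lt_two_pow_self.le
    have h8 : (N : ℝ) * 4 ^ N ≤ 8 ^ N := by
      calc (N : ℝ) * 4 ^ N ≤ 2 ^ N * 4 ^ N := by gcongr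
        _ = 8 ^ N := by rw [← mul_pow]; norm_num
    have herr : (N * η) ^ N / N.factorial * Real.exp (N * η) ≤ (η * Real.exp 2) ^ N := by
      have h1 : (N : ℝ) ^ N / N.factorial ≤ Real.exp N :=
        Real.pow_div_factorial_le_exp _ (Nat.cast_nonneg N) N
      have h2 : Real.exp (N * η) ≤ Real.exp N := by
        apply Real.exp_le_exp.2; nlinarith [(Nat.cast_nonneg N : (0 : ℝ) ≤ N)]
      calc (N * η) ^ N / N.factorial * Real.exp (N * η)
          = η ^ N * ((N : ℝ) ^ N / N.factorial) * Real.exp (N * η) := by rw [mul_pow]; ring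
        _ ≤ η ^ N * Real.exp N * Real.exp N := by gcongr
        _ = (η * Real.exp 2) ^ N := by
            rw [mul_pow η (Real.exp 2), mul_assoc, ← Real.exp_add, ← Real.exp_nat_mul]; congr 2; ring
    have hsmall : (8 * η * Real.exp 2) ^ N ≤ Real.exp (-β * x) := by
      calc (8 * η * Real.exp 2) ^ N ≤ Real.exp (-(1 / c)) ^ N := by gcongr
        _ = Real.exp (-(N / c)) := by rw [← Real.exp_nat_mul]; congr 1; ring
        _ ≤ Real.exp (-β * x) := by
            apply Real.exp_le_exp.2
            have : x ≤ N / c := by rw [le_div_iff₀ hc0]; linarith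
            nlinarith
    have h8N : (8 : ℝ) ^ N ≤ 8 * Real.exp (ε * x) := by
      rw [← Real.exp_log (show (0 : ℝ) < 8 by norm_num), ← Real.exp_nat_mul, ← Real.exp_add]
      apply Real.exp_le_exp.2
      have : c * Real.log 8 = ε := by rw [hc]; field_simp
      nlinarith
    have hmain : ‖l (∑ i ∈ Finset.range N, a i • expFun K (lam i))‖ ≤
        8 * C * Real.exp (-β * x) := by
      rw [map_sum]
      calc _ ≤ ∑ i ∈ Finset.range N, ‖l (a i • expFun K (lam i))‖ := norm_sum_le _ _
        _ ≤ ∑ i ∈ Finset.range N, 4 ^ N * (C * Real.exp (-(1 - ε) * x)) := by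
            refine Finset.sum_le_sum fun i hi => ?_
            rw [map_smul, norm_smul]
            exact mul_le_mul (ha i (Finset.mem_range.1 hi)) (hlamb i) (norm_nonneg _) (by positivity)
        _ = N * 4 ^ N * (C * Real.exp (-(1 - ε) * x)) := by
            rw [Finset.sum_const, Finset.card_range, nsmul_eq_mul]; ring
        _ ≤ 8 * Real.exp (ε * x) * (C * Real.exp (-(1 - ε) * x)) := by
            exact mul_le_mul_of_nonneg_right (h8.trans h8N) (by positivity)
        _ = 8 * C * (Real.exp (ε * x) * Real.exp (-(1 - ε) * x)) := by ring
        _ = _ := by rw [← Real.exp_add]; congr 2; rw [hε]; ring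
    have hrest : ‖l (expFun K x - ∑ i ∈ Finset.range N, a i • expFun K (lam i))‖ ≤
        ‖l‖ * Real.exp (-β * x) := by
      refine (l.le_opNorm _).trans ?_
      gcongr
      refine hclose.trans ?_
      calc _ ≤ 8 ^ N * (η * Real.exp 2) ^ N := by gcongr
        _ = (8 * η * Real.exp 2) ^ N := by rw [← mul_pow]; ring
        _ ≤ _ := hsmall
    calc ‖l (expFun K x)‖ = ‖l (∑ i ∈ Finset.range N, a i • expFun K (lam i)) +
          l (expFun K x - ∑ i ∈ Finset.range N, a i • expFun K (lam i))‖ := by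
          rw [← map_add]; congr 2; abel
      _ ≤ _ := norm_add_le _ _
      _ ≤ _ := add_le_add hmain hrest
      _ = _ := by ring
  refine ⟨max (8 * C + ‖l‖) (‖l‖ * Real.exp (β * u₁)), fun x hx => ?_⟩
  rcases le_total u₁ x with h | h
  · exact (hlarge x h).trans (by gcongr; exact le_max_left _ _)
  · have h1 : ‖expFun K x‖ ≤ 1 := by
      rw [ContinuousMap.norm_le _ zero_le_one]
      intro s
      rw [expFun_apply, norm_exp_neg_mul_ofReal, Real.exp_le_one_iff]
      have := mul_nonneg (hK s s.2) hx
      linarith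
    calc ‖l (expFun K x)‖ ≤ ‖l‖ * 1 := (l.le_opNorm _).trans (by gcongr)
      _ ≤ ‖l‖ * (Real.exp (β * u₁) * Real.exp (-β * x)) := by
          gcongr
          rw [← Real.exp_add, Real.one_le_exp_iff]
          nlinarith
      _ = ‖l‖ * Real.exp (β * u₁) * Real.exp (-β * x) := by ring
      _ ≤ _ := by gcongr; exact le_max_right _ _

theorem integrableOn_mul_cexp {ρ : ℝ → ℂ} (hρ : Continuous ρ) {C β : ℝ}
    (hbound : ∀ x : ℝ, 0 ≤ x → ‖ρ x‖ ≤ C * Real.exp (-β * x)) {w : ℂ} (hw : w.re < β) :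
    IntegrableOn (fun x : ℝ => ρ x * Complex.exp (w * x)) (Set.Ioi 0) := by
  have h1 : IntegrableOn (fun x : ℝ => C * Real.exp (-(β - w.re) * x)) (Set.Ioi 0) :=
    (exp_neg_integrableOn_Ioi 0 (sub_pos.2 hw)).const_mul C
  refine h1.mono' (by fun_prop : Continuous _).aestronglyMeasurable ?_
  filter_upwards [ae_restrict_mem measurableSet_Ioi] with x hx
  rw [norm_mul, Complex.norm_exp]
  have h2 : (w * (x : ℂ)).re = w.re * x := by simp
  rw [h2]
  calc ‖ρ x‖ * Real.exp (w.re * x) ≤ C * Real.exp (-β * x) * Real.exp (w.re * x) := by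
        gcongr; exact hbound x (le_of_lt hx)
    _ = _ := by rw [mul_assoc, ← Real.exp_add]; congr 2; ring

/-- The Laplace transform of an exponentially decaying function is holomorphic. -/
theorem differentiableOn_laplace {ρ : ℝ → ℂ} (hρ : Continuous ρ) {C β : ℝ}
    (hbound : ∀ x : ℝ, 0 ≤ x → ‖ρ x‖ ≤ C * Real.exp (-β * x)) :
    DifferentiableOn ℂ (fun w : ℂ => ∫ x in Set.Ioi (0 : ℝ), ρ x * Complex.exp (w * x))
      {w | w.re < β} := by
  have hC : 0 ≤ C := by
    have := (norm_nonneg _).trans (hbound 0 le_rfl)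
    simpa using this
  intro w₀ hw₀
  have hw₀' : w₀.re < β := hw₀
  set r : ℝ := (β - w₀.re) / 2 with hr
  have hr0 : 0 < r := by rw [hr]; linarith
  have hball : ∀ w ∈ Metric.ball w₀ r, w.re < β - r := by
    intro w hw
    have h1 : |(w - w₀).re| ≤ ‖w - w₀‖ := Complex.abs_re_le_norm _
    have h2 : ‖w - w₀‖ < r := by simpa [dist_eq_norm] using hw
    have h3 := (abs_lt.1 (h1.trans_lt h2)).2
    simp only [Complex.sub_re] at h3
    rw [hr] at h3 ⊢; linarith
  have key := hasDerivAt_integral_of_dominated_loc_of_deriv_le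
    (μ := volume.restrict (Set.Ioi (0 : ℝ)))
    (F := fun (w : ℂ) (x : ℝ) => ρ x * Complex.exp (w * x))
    (F' := fun (w : ℂ) (x : ℝ) => ρ x * (Complex.exp (w * x) * x)) (x₀ := w₀)
    (bound := fun x : ℝ => C * (2 / r) * Real.exp (-(r / 2) * x))
    (Metric.ball_mem_nhds w₀ hr0) ?_ ?_ ?_ ?_ ?_ ?_
  · exact key.2.differentiableAt.differentiableWithinAt
  · exact Eventually.of_forall fun w => (by fun_prop : Continuous _).aestronglyMeasurable
  · exact integrableOn_mul_cexp hρ hbound hw₀'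
  · exact (by fun_prop : Continuous _).aestronglyMeasurable
  · filter_upwards [ae_restrict_mem measurableSet_Ioi] with x hx w hw
    have hx0 : (0 : ℝ) < x := hx
    rw [norm_mul, norm_mul, Complex.norm_exp, Complex.norm_real, Real.norm_of_nonneg hx0.le]
    have h2 : (w * (x : ℂ)).re = w.re * x := by simp
    rw [h2]
    -- Half of the available decay e^{-rx} absorbs the factor x produced by differentiation.
    have h3 : x ≤ 2 / r * Real.exp (r / 2 * x) := by
      have := Real.add_one_le_exp (r / 2 * x)
      have h4 : x = 2 / r * (r / 2 * x) := by field_simp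
      calc x = 2 / r * (r / 2 * x) := h4
        _ ≤ _ := by gcongr; linarith
    have h5 : Real.exp (w.re * x) ≤ Real.exp ((β - r) * x) := by
      apply Real.exp_le_exp.2; have := hball w hw; nlinarith
    calc ‖ρ x‖ * (Real.exp (w.re * x) * x)
        ≤ C * Real.exp (-β * x) * (Real.exp ((β - r) * x) * (2 / r * Real.exp (r / 2 * x))) := by
          gcongr; exact hbound x hx0.le
      _ = C * (2 / r) * (Real.exp (-β * x) * Real.exp ((β - r) * x) * Real.exp (r / 2 * x)) := by
          ring
      _ = _ := by rw [← Real.exp_add, ← Real.exp_add]; congr 2; ring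
  · exact (exp_neg_integrableOn_Ioi 0 (half_pos hr0)).const_mul _
  · refine Eventually.of_forall fun x w _ => ?_
    have : HasDerivAt (fun w : ℂ => w * (x : ℂ)) x w := by simpa using (hasDerivAt_id w).mul_const (x : ℂ)
    exact this.cexp.const_mul (ρ x)

/-- The coordinate function on `K`. -/
def coordFun (K : Set ℂ) : C(K, ℂ) := ⟨Subtype.val, continuous_subtype_val⟩

theorem mem_resolventSet_coordFun {K : Set ℂ} [CompactSpace K] {w : ℂ} (hw : w ∉ K) :
    w ∈ resolventSet ℂ (coordFun K) := by
  rw [spectrum.mem_resolventSet_iff, ContinuousMap.isUnit_iff_forall_ne_zero]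
  intro s h
  have h1 : w - (s : ℂ) = 0 := h
  exact hw (sub_eq_zero.1 h1 ▸ s.2)

theorem resolvent_coordFun_apply {K : Set ℂ} [CompactSpace K] {w : ℂ} (hw : w ∉ K) (s : K) :
    resolvent (coordFun K) w s = (w - s)⁻¹ := by
  have h := Ring.inverse_mul_cancel _ (mem_resolventSet_coordFun hw)
  have h1 := congrArg (fun g : C(K, ℂ) => g s) h
  have h2 : resolvent (coordFun K) w s * (w - s) = 1 := h1
  exact eq_inv_of_mul_eq_one_left h2

/-- The Cauchy kernel 1/(w - s) is the resolvent of the coordinate function in the Banach algebra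
C(K, ℂ), so holomorphy of the Cauchy transform of ℓ off K is holomorphy of the resolvent. -/
theorem differentiableOn_resolvent_coordFun (K : Set ℂ) [CompactSpace K] (l : C(K, ℂ) →L[ℂ] ℂ) :
    DifferentiableOn ℂ (fun w => l (resolvent (coordFun K) w)) Kᶜ := fun w hw =>
  (l.differentiableAt.comp w
    (spectrum.hasDerivAt_resolvent_const_left (mem_resolventSet_coordFun hw)).differentiableAt).differentiableWithinAt

/-- To the left of `K` the Laplace transform of `ℓ(e ^ {-s x})` is the Cauchy transform of `ℓ`. -/
theorem laplace_eq_neg_resolvent (K : Set ℂ) [CompactSpace K] {a : ℝ} (hK : ∀ s ∈ K, a ≤ s.re)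
    (l : C(K, ℂ) →L[ℂ] ℂ) {w : ℂ} (hw : w.re < a) :
    ∫ x in Set.Ioi (0 : ℝ), l (expFun K x) * Complex.exp (w * x) =
      -l (resolvent (coordFun K) w) := by
  have hwK : w ∉ K := fun h => absurd (hK w h) (not_le.2 hw)
  have h_int : IntegrableOn (fun x : ℝ => Complex.exp (w * x) • expFun K x) (Set.Ioi 0) := by
    have h1 : IntegrableOn (fun x : ℝ => Real.exp (-(a - w.re) * x)) (Set.Ioi 0) :=
      exp_neg_integrableOn_Ioi 0 (sub_pos.2 hw)
    have hc := continuous_expFun K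
    refine h1.mono' (by fun_prop : Continuous _).aestronglyMeasurable ?_
    filter_upwards [ae_restrict_mem measurableSet_Ioi] with x hx
    have hx0 : (0 : ℝ) < x := hx
    rw [ContinuousMap.norm_le _ (Real.exp_pos _).le]
    intro s
    rw [ContinuousMap.smul_apply, expFun_apply, smul_eq_mul, norm_mul, norm_exp_neg_mul_ofReal,
      Complex.norm_exp]
    have h2 : (w * (x : ℂ)).re = w.re * x := by simp
    rw [h2, ← Real.exp_add]
    apply Real.exp_le_exp.2
    have := hK s s.2
    nlinarith
  have h3 : ∫ x in Set.Ioi (0 : ℝ), Complex.exp (w * x) • expFun K x =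
      -resolvent (coordFun K) w := by
    ext s
    rw [ContinuousMap.neg_apply, resolvent_coordFun_apply hwK]
    have h4 := (ContinuousMap.evalCLM ℂ s).integral_comp_comm h_int
    simp only [ContinuousMap.evalCLM_apply, ContinuousMap.smul_apply, expFun_apply,
      smul_eq_mul] at h4
    rw [← h4]
    have h5 : (w - s).re < 0 := by
      have := hK s s.2
      simp only [Complex.sub_re]; linarith
    have h6 := integral_exp_mul_complex_Ioi h5 0
    simp only [Complex.ofReal_zero, mul_zero, Complex.exp_zero] at h6
    rw [← one_div, ← neg_div, ← h6]
    refine setIntegral_congr_fun measurableSet_Ioi fun x _ => ?_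
    rw [← Complex.exp_add]; congr 1; ring
  rw [← map_neg, ← h3, ← l.integral_comp_comm h_int]
  refine setIntegral_congr_fun measurableSet_Ioi fun x _ => ?_
  simp only [map_smul, smul_eq_mul]
  ring

theorem eqOn_of_convex_of_eqOn {U V : Set ℂ} (hU : IsOpen U) (hU' : Convex ℝ U) (hV : IsOpen V)
    (hne : (U ∩ V).Nonempty) {f g : ℂ → ℂ} (hf : DifferentiableOn ℂ f U)
    (hg : DifferentiableOn ℂ g U) (h : Set.EqOn f g V) : Set.EqOn f g U := by
  obtain ⟨z, hzU, hzV⟩ := hne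
  refine (hf.analyticOnNhd hU).eqOn_of_preconnected_of_eventuallyEq (hg.analyticOnNhd hU)
    hU'.isPreconnected hzU ?_
  filter_upwards [hV.mem_nhds hzV] with w hw using h hw

/-- A functional on `C(K, ℂ)` for which `ℓ(e ^ {-s x})` decays faster than the abscissa of `K`
permits annihilates all functions holomorphic around `K`. -/
theorem functional_eq_zero_of_decay (K : Set ℂ) [CompactSpace K] {a a' b b' R R' β : ℝ}
    (hK : ∀ s ∈ K, a ≤ s.re ∧ s.re ≤ b ∧ |s.im| ≤ R) (ha : a' < a) (hb : b < b') (hR : R < R')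
    (hR0 : 0 ≤ R) (hab : a ≤ b) (hβ : b' < β) (l : C(K, ℂ) →L[ℂ] ℂ) {C : ℝ}
    (hl : ∀ x : ℝ, 0 ≤ x → ‖l (expFun K x)‖ ≤ C * Real.exp (-β * x))
    {f : ℂ → ℂ} (hf : DifferentiableOn ℂ f {w | w.re ∈ Set.Icc a' b' ∧ w.im ∈ Set.Icc (-R') R'})
    (g : C(K, ℂ)) (hg : ∀ s : K, g s = f s) : l g = 0 := by
  have hx : a' ≤ b' := by linarith
  have hy : -R' ≤ R' := by linarith
  have hρ : Continuous fun x : ℝ => l (expFun K x) := l.continuous.comp (continuous_expFun K)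
  set F : ℂ → ℂ := fun w => ∫ x in Set.Ioi (0 : ℝ), l (expFun K x) * Complex.exp (w * x) with hF
  set G : ℂ → ℂ := fun w => -l (resolvent (coordFun K) w) with hG
  have hFd : DifferentiableOn ℂ F {w | w.re < β} := differentiableOn_laplace hρ hl
  have hGd : DifferentiableOn ℂ G Kᶜ := (differentiableOn_resolvent_coordFun K l).neg
  have e0 : Set.EqOn F G {w | w.re < a} := fun w hw =>
    laplace_eq_neg_resolvent K (fun s hs => (hK s hs).1) l hw
  have o0 : IsOpen {w : ℂ | w.re < a} := isOpen_lt Complex.continuous_re continuous_const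
  have oβ : IsOpen {w : ℂ | w.re < β} := isOpen_lt Complex.continuous_re continuous_const
  have ob : IsOpen {w : ℂ | b < w.re} := isOpen_lt continuous_const Complex.continuous_re
  have oR : IsOpen {w : ℂ | R < w.im} := isOpen_lt continuous_const Complex.continuous_im
  have oR' : IsOpen {w : ℂ | w.im < -R} := isOpen_lt Complex.continuous_im continuous_const
  have cβ : Convex ℝ {w : ℂ | w.re < β} := convex_halfSpace_re_lt β
  -- The identity F = G is carried around the box containing K: from the left to above and below,
  -- then from above to the right. Every region used is convex, so nothing about the topology of the
  -- complement of K is needed.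
  have e1 : Set.EqOn F G ({w | w.re < β} ∩ {w | R < w.im}) := by
    refine eqOn_of_convex_of_eqOn (oβ.inter oR) (cβ.inter (convex_halfSpace_im_gt R)) o0 ?_
      (hFd.mono Set.inter_subset_left) (hGd.mono ?_) e0
    · refine ⟨⟨a - 1, R + 1⟩, ⟨?_, ?_⟩, ?_⟩ <;> (simp; try linarith)
    · intro w hw hwK
      exact absurd ((le_abs_self _).trans (hK w hwK).2.2) (not_le.2 hw.2)
  have e2 : Set.EqOn F G ({w | w.re < β} ∩ {w | w.im < -R}) := by
    refine eqOn_of_convex_of_eqOn (oβ.inter oR') (cβ.inter (convex_halfSpace_im_lt (-R))) o0 ?_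
      (hFd.mono Set.inter_subset_left) (hGd.mono ?_) e0
    · refine ⟨⟨a - 1, -R - 1⟩, ⟨?_, ?_⟩, ?_⟩ <;> (simp; try linarith)
    · intro w hw hwK
      have h1 : w.im < -R := hw.2
      have h2 := (abs_le.1 (hK w hwK).2.2).1
      linarith
  have e3 : Set.EqOn F G ({w | w.re < β} ∩ {w | b < w.re}) := by
    refine eqOn_of_convex_of_eqOn (oβ.inter ob) (cβ.inter (convex_halfSpace_re_gt b))
      (oβ.inter oR) ?_ (hFd.mono Set.inter_subset_left) (hGd.mono ?_) e1
    · refine ⟨⟨b', R + 1⟩, ⟨?_, ?_⟩, ?_, ?_⟩ <;> simp <;> linarith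
    · intro w hw hwK
      exact absurd (hK w hwK).2.1 (not_le.2 hw.2)
  have hbd : ∀ w ∈ rectBoundary a' b' (-R') R', F w = G w ∧ w ∉ K := by
    rintro w ⟨h1, h2, h3⟩
    have hwβ : w.re < β := h1.2.trans_lt hβ
    rcases h3 with h | h | h | h
    · refine ⟨e0 (show w.re < a by linarith), fun hwK => ?_⟩
      have := (hK w hwK).1; linarith
    · refine ⟨e3 ⟨hwβ, show b < w.re by linarith⟩, fun hwK => ?_⟩
      have := (hK w hwK).2.1; linarith
    · refine ⟨e2 ⟨hwβ, show w.im < -R by linarith⟩, fun hwK => ?_⟩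
      have := (abs_le.1 (hK w hwK).2.2).1; linarith
    · refine ⟨e1 ⟨hwβ, show R < w.im by linarith⟩, fun hwK => ?_⟩
      have := (abs_le.1 (hK w hwK).2.2).2; linarith
  have hbS : rectBoundary a' b' (-R') R' ⊆
      {w | w.re ∈ Set.Icc a' b' ∧ w.im ∈ Set.Icc (-R') R'} := fun w hw => ⟨hw.1, hw.2.1⟩
  have hcont : ContinuousOn (fun w => f w • resolvent (coordFun K) w)
      (rectBoundary a' b' (-R') R') := by
    refine (hf.continuousOn.mono hbS).smul fun w hw => ?_
    exact (spectrum.hasDerivAt_resolvent_const_left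
      (mem_resolventSet_coordFun (hbd w hw).2)).continuousAt.continuousWithinAt
  -- Cauchy's formula as an identity in C(K, ℂ). Applying ℓ turns the left side into an integral of
  -- -f·F, which is zero since F is holomorphic inside the rectangle.
  have hcauchy : rectIntegral (fun w => f w • resolvent (coordFun K) w) a' b' (-R') R' =
      (2 * π * Complex.I) • g := by
    ext s
    have h1 := rectIntegral_comp_clm hx hy hcont (ContinuousMap.evalCLM ℂ s)
    simp only [ContinuousMap.evalCLM_apply] at h1
    rw [← h1]
    obtain ⟨hs1, hs2, hs3⟩ := hK s s.2
    have hs3' := abs_le.1 hs3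
    rw [ContinuousMap.smul_apply, smul_eq_mul, hg,
      ← rectIntegral_cauchy (s := (s : ℂ)) (x₀ := a') (x₁ := b') (y₀ := -R') (y₁ := R')
        ⟨by linarith, by linarith⟩ ⟨by linarith, by linarith⟩ hf]
    refine rectIntegral_congr hx hy fun w hw => ?_
    simp only [ContinuousMap.smul_apply, smul_eq_mul]
    rw [resolvent_coordFun_apply (hbd w hw).2]
  have hzero : rectIntegral (fun w => l (f w • resolvent (coordFun K) w)) a' b' (-R') R' = 0 := by
    rw [← rectIntegral_eq_zero hx hy (f := fun w => -(f w * F w))]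
    · refine rectIntegral_congr hx hy fun w hw => ?_
      simp only [map_smul, smul_eq_mul]
      rw [(hbd w hw).1, hG]; ring
    · exact (hf.mul (hFd.mono fun w hw => hw.1.2.trans_lt hβ)).neg
  rw [rectIntegral_comp_clm hx hy hcont, hcauchy, map_smul, smul_eq_mul] at hzero
  have h2pi : (2 * π * Complex.I : ℂ) ≠ 0 := Complex.two_pi_I_ne_zero
  exact (mul_eq_zero.1 hzero).resolve_left h2pi

/-! ### Rounding coefficients to the unit circle -/

/-- The endpoints of the chord through c perpendicular to the radius; c is their midpoint. -/
theorem exists_circle_pair {c : ℂ} (hc : ‖c‖ ≤ 1) :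
    ∃ (u v : Circle) (d : ℂ), ‖d‖ ≤ 1 ∧ (u : ℂ) - c = d ∧ (v : ℂ) - c = -d := by
  obtain ⟨ζ, hζ⟩ : ∃ ζ : Circle, c = ‖c‖ * ζ :=
    ⟨Circle.exp c.arg, by rw [Circle.coe_exp]; exact (Complex.norm_mul_exp_arg_mul_I c).symm⟩
  set r : ℝ := ‖c‖ with hr
  have hr0 : 0 ≤ r := norm_nonneg c
  have hd : √(1 - r ^ 2) ^ 2 = 1 - r ^ 2 := Real.sq_sqrt (by nlinarith)
  have hmem : ∀ t : ℝ, t ^ 2 = 1 - r ^ 2 → ‖(r : ℂ) + t * Complex.I‖ = 1 := by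
    intro t ht
    rw [Complex.norm_add_mul_I, ht]; simp
  have h1 := hmem _ hd
  have h2 := hmem (-√(1 - r ^ 2)) (by rw [neg_sq, hd])
  have hex : ∀ z : ℂ, ‖z‖ = 1 → ∃ u : Circle, (u : ℂ) = z := fun z hz =>
    ⟨Circle.exp z.arg, by
      rw [Circle.coe_exp]
      have := Complex.norm_mul_exp_arg_mul_I z
      rwa [hz, Complex.ofReal_one, one_mul] at this⟩
  obtain ⟨u, hu⟩ := hex _ h1
  obtain ⟨v, hv⟩ := hex _ h2
  refine ⟨ζ * u, ζ * v, ζ * (√(1 - r ^ 2) * Complex.I), ?_, ?_, ?_⟩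
  · rw [norm_mul, Circle.norm_coe, one_mul, norm_mul, Complex.norm_I, mul_one, Complex.norm_real,
      Real.norm_of_nonneg (Real.sqrt_nonneg _), Real.sqrt_le_iff]
    constructor <;> nlinarith
  · rw [hζ, Circle.coe_mul, hu]; ring
  · rw [hζ, Circle.coe_mul, hv]; push_cast; ring

/-- Greedy rounding: coefficients in the unit disc can be moved to the unit circle at a cost
controlled by the sum of a quadratic form. -/
theorem exists_circle_rounding {V : Type*} [AddCommGroup V] [Module ℂ V] (Q : V → ℝ)
    (hpar : ∀ u v, Q (u + v) + Q (u - v) = 2 * Q u + 2 * Q v)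
    (hsmul : ∀ (c : ℂ) v, Q (c • v) = ‖c‖ ^ 2 * Q v) (hnn : ∀ v, 0 ≤ Q v)
    (x : ℕ → V) (c : ℕ → ℂ) (hc : ∀ m, ‖c m‖ ≤ 1) (s : Finset ℕ) :
    ∃ c' : ℕ → Circle, Q (∑ m ∈ s, ((c' m : ℂ) - c m) • x m) ≤ ∑ m ∈ s, Q (x m) := by
  classical
  induction s using Finset.induction_on with
  | empty =>
    refine ⟨fun _ => 1, ?_⟩
    have := hsmul 0 0
    simp at this
    simp [this]
  | insert k s hk ih =>
    obtain ⟨c', hc'⟩ := ih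
    obtain ⟨u, v, d, hd, hu, hv⟩ := exists_circle_pair (hc k)
    set S := ∑ m ∈ s, ((c' m : ℂ) - c m) • x m with hS
    have hsum : ∀ z : Circle, ∑ m ∈ insert k s, ((Function.update c' k z m : ℂ) - c m) • x m =
        ((z : ℂ) - c k) • x k + S := by
      intro z
      rw [Finset.sum_insert hk, Function.update_self]
      congr 1
      refine Finset.sum_congr rfl fun m hm => ?_
      rw [Function.update_of_ne (by rintro rfl; exact hk hm)]
    -- By the parallelogram law the average of the values at S ± d·x_k is Q(S) + |d|² Q(x_k), so one
    -- of the two signs does not exceed it.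
    have h1 := hpar S (d • x k)
    rw [hsmul] at h1
    have h2 : ‖d‖ ^ 2 * Q (x k) ≤ Q (x k) :=
      mul_le_of_le_one_left (hnn _) (pow_le_one₀ (norm_nonneg _) hd)
    rw [Finset.sum_insert hk]
    rcases le_total (Q (S + d • x k)) (Q (S - d • x k)) with h | h
    · refine ⟨Function.update c' k u, ?_⟩
      rw [hsum, hu, add_comm]; linarith
    · refine ⟨Function.update c' k v, ?_⟩
      rw [hsum, hv, neg_smul, neg_add_eq_sub]; linarith

/-! ### The boundary energy as a quadratic form -/

theorem rectEnergy_nonneg {x₀ x₁ y₀ y₁ : ℝ} (hx : x₀ ≤ x₁) (hy : y₀ ≤ y₁) (f : ℂ → ℂ) :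
    0 ≤ rectEnergy x₀ x₁ y₀ y₁ f := by
  have h1 : ∀ (a b : ℝ) (γ : ℝ → ℂ), a ≤ b → 0 ≤ ∫ x in a..b, ‖f (γ x)‖ ^ 2 := fun a b γ hab =>
    intervalIntegral.integral_nonneg hab fun x _ => by positivity
  unfold rectEnergy
  have := h1 x₀ x₁ (fun x => x + y₀ * Complex.I) hx
  have := h1 x₀ x₁ (fun x => x + y₁ * Complex.I) hx
  have := h1 y₀ y₁ (fun y => x₁ + y * Complex.I) hy
  have := h1 y₀ y₁ (fun y => x₀ + y * Complex.I) hy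
  positivity

theorem rectEnergy_smul (x₀ x₁ y₀ y₁ : ℝ) (c : ℂ) (f : C(ℂ, ℂ)) :
    rectEnergy x₀ x₁ y₀ y₁ (c • f) = ‖c‖ ^ 2 * rectEnergy x₀ x₁ y₀ y₁ f := by
  simp only [rectEnergy, Pi.smul_apply, norm_smul, mul_pow, intervalIntegral.integral_const_mul]
  ring

theorem rectEnergy_parallelogram (x₀ x₁ y₀ y₁ : ℝ) (f g : C(ℂ, ℂ)) :
    rectEnergy x₀ x₁ y₀ y₁ (f + g : C(ℂ, ℂ)) + rectEnergy x₀ x₁ y₀ y₁ (f - g : C(ℂ, ℂ)) =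
      2 * rectEnergy x₀ x₁ y₀ y₁ f + 2 * rectEnergy x₀ x₁ y₀ y₁ g := by
  have key : ∀ (a b : ℝ) (γ : ℝ → ℂ), Continuous γ →
      (∫ x in a..b, ‖(f + g : C(ℂ, ℂ)) (γ x)‖ ^ 2) + (∫ x in a..b, ‖(f - g : C(ℂ, ℂ)) (γ x)‖ ^ 2) =
      2 * (∫ x in a..b, ‖f (γ x)‖ ^ 2) + 2 * ∫ x in a..b, ‖g (γ x)‖ ^ 2 := by
    intro a b γ hγ
    have hi : ∀ h : C(ℂ, ℂ), IntervalIntegrable (fun x => ‖h (γ x)‖ ^ 2) volume a b := fun h =>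
      Continuous.intervalIntegrable (by fun_prop) _ _
    rw [← intervalIntegral.integral_add (hi _) (hi _), ← intervalIntegral.integral_const_mul,
      ← intervalIntegral.integral_const_mul,
      ← intervalIntegral.integral_add ((hi _).const_mul 2) ((hi _).const_mul 2)]
    refine intervalIntegral.integral_congr fun x _ => ?_
    have := parallelogram_law_with_norm ℝ (f (γ x)) (g (γ x))
    simp only [ContinuousMap.add_apply, ContinuousMap.sub_apply]
    linarith
  have k1 := key x₀ x₁ (fun x => x + y₀ * Complex.I) (by fun_prop)
  have k2 := key x₀ x₁ (fun x => x + y₁ * Complex.I) (by fun_prop)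
  have k3 := key y₀ y₁ (fun y => x₁ + y * Complex.I) (by fun_prop)
  have k4 := key y₀ y₁ (fun y => x₀ + y * Complex.I) (by fun_prop)
  simp only [rectEnergy]
  linarith

theorem rectEnergy_le {x₀ x₁ y₀ y₁ B : ℝ} (hx : x₀ ≤ x₁) (hy : y₀ ≤ y₁) (f : C(ℂ, ℂ))
    (hf : ∀ w ∈ rectBoundary x₀ x₁ y₀ y₁, ‖f w‖ ^ 2 ≤ B) :
    rectEnergy x₀ x₁ y₀ y₁ f ≤ 2 * ((x₁ - x₀) + (y₁ - y₀)) * B := by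
  have key : ∀ (a b : ℝ) (γ : ℝ → ℂ), a ≤ b → Continuous γ →
      (∀ x ∈ Set.Icc a b, γ x ∈ rectBoundary x₀ x₁ y₀ y₁) →
      ∫ x in a..b, ‖f (γ x)‖ ^ 2 ≤ (b - a) * B := by
    intro a b γ hab hγ hmem
    calc ∫ x in a..b, ‖f (γ x)‖ ^ 2 ≤ ∫ _ in a..b, B := by
          refine intervalIntegral.integral_mono_on hab
            (Continuous.intervalIntegrable (by fun_prop) _ _) (by simp) fun x hx' => ?_
          exact hf _ (hmem x hx')
      _ = _ := by simp
  have k1 := key x₀ x₁ (fun x => x + y₀ * Complex.I) hx (by fun_prop)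
    fun x hx' => (mem_rectBoundary_horizontal hy hx').1
  have k2 := key x₀ x₁ (fun x => x + y₁ * Complex.I) hx (by fun_prop)
    fun x hx' => (mem_rectBoundary_horizontal hy hx').2
  have k3 := key y₀ y₁ (fun y => x₁ + y * Complex.I) hy (by fun_prop)
    fun x hx' => (mem_rectBoundary_vertical hx hx').2
  have k4 := key y₀ y₁ (fun y => x₀ + y * Complex.I) hy (by fun_prop)
    fun x hx' => (mem_rectBoundary_vertical hx hx').1
  simp only [rectEnergy]
  linarith

/-! ### Density of weighted sums over shifted integers -/

theorem exp_neg_mul_log_eq {α : ℝ} (hα : 0 < α) (m : ℕ) (s : ℂ) :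
    Complex.exp (-s * (Real.log (m + α) : ℝ)) = (((m : ℂ) + α) ^ s)⁻¹ := by
  have hpos : (0 : ℝ) < m + α := by positivity
  have h0 : ((m : ℂ) + α) ≠ 0 := by
    have : ((m : ℂ) + α) = ((m + α : ℝ) : ℂ) := by push_cast; rfl
    rw [this]; exact_mod_cast hpos.ne'
  rw [Complex.cpow_def_of_ne_zero h0, ← Complex.exp_neg, Complex.ofReal_log hpos.le]
  congr 1
  push_cast
  ring

theorem exists_unit_mul_eq_norm (z : ℂ) : ∃ c : ℂ, ‖c‖ ≤ 1 ∧ c * z = ‖z‖ := by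
  rcases eq_or_ne z 0 with rfl | hz
  · exact ⟨0, by simp, by simp⟩
  · have hz' : (‖z‖ : ℂ) ≠ 0 := by exact_mod_cast norm_ne_zero_iff.2 hz
    refine ⟨starRingEnd ℂ z / ‖z‖, ?_, ?_⟩
    · rw [norm_div, RCLike.norm_conj, Complex.norm_real, norm_norm, div_self (norm_ne_zero_iff.2 hz)]
    · rw [div_mul_eq_mul_div, div_eq_iff hz', mul_comm, Complex.mul_conj, Complex.normSq_eq_norm_sq]
      push_cast; ring

/-- The absolute weights `‖w m‖` are dense along `log (m + α)` with exponent one. -/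
def LogDense (α : ℝ) (w : ℕ → ℂ) : Prop :=
  ∀ δ : ℝ, 0 < δ → δ ≤ 1 → ∀ ε : ℝ, 0 < ε → ∀ᶠ u : ℝ in atTop, ∃ t : Finset ℕ,
    (∀ m ∈ t, Real.log (m + α) ∈ Set.Ioc u (u + δ)) ∧
      Real.exp ((1 - ε) * u) ≤ ∑ m ∈ t, ‖w m‖

/-- Combinations of the tail terms with coefficients in the unit disc are dense. -/
theorem exists_disc_sum_approx {α : ℝ} (hα : 0 < α) {w : ℕ → ℂ} (hw : LogDense α w)
    {a a' b b' R R' : ℝ} {K : Set ℂ} (hKc : IsCompact K)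
    (hK : ∀ s ∈ K, a ≤ s.re ∧ s.re ≤ b ∧ |s.im| ≤ R) (ha : a' < a) (hb : b < b') (hR : R < R')
    (hR0 : 0 ≤ R) (hab : a ≤ b) (ha0 : 0 < a) (hb1 : b' < 1) {f : ℂ → ℂ}
    (hf : DifferentiableOn ℂ f {w | w.re ∈ Set.Icc a' b' ∧ w.im ∈ Set.Icc (-R') R'})
    (y : ℕ) {ε : ℝ} (hε : 0 < ε) :
    ∃ (c : ℕ →₀ ℂ), (∀ m, ‖c m‖ ≤ 1) ∧ (∀ m < y, c m = 0) ∧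
      ∀ s ∈ K, ‖(c.sum fun m z => z * w m / ((m : ℂ) + α) ^ s) - f s‖ ≤ ε := by
  classical
  have : CompactSpace K := isCompact_iff_compactSpace.1 hKc
  have hfK : ContinuousOn f K := by
    refine hf.continuousOn.mono fun s hs => ?_
    obtain ⟨h1, h2, h3⟩ := hK s hs
    have h3 := abs_le.1 h3
    exact ⟨⟨by linarith, by linarith⟩, ⟨by linarith, by linarith⟩⟩
  set g : C(K, ℂ) := ⟨fun s => f s, continuousOn_iff_continuous_domRestrict.1 hfK⟩ with hg
  set x : ℕ → C(K, ℂ) := fun m => w m • expFun K (Real.log (m + α)) with hx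
  set S : Set (ℕ →₀ ℂ) := {c | (∀ m, ‖c m‖ ≤ 1) ∧ ∀ m < y, c m = 0} with hS
  have hSconv : Convex ℝ S := by
    rintro c ⟨hc1, hc2⟩ d ⟨hd1, hd2⟩ p q hp hq hpq
    refine ⟨fun m => ?_, fun m hm => ?_⟩
    · rw [Finsupp.add_apply, Finsupp.smul_apply, Finsupp.smul_apply]
      refine (norm_add_le _ _).trans ?_
      rw [norm_smul, norm_smul, Real.norm_of_nonneg hp, Real.norm_of_nonneg hq]
      have := mul_le_mul_of_nonneg_left (hc1 m) hp
      have := mul_le_mul_of_nonneg_left (hd1 m) hq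
      linarith
    · simp [hc2 m hm, hd2 m hm]
  set Λ : (ℕ →₀ ℂ) →ₗ[ℂ] C(K, ℂ) := Finsupp.linearCombination ℂ x with hΛ
  have hBconv : Convex ℝ (Λ '' S) := hSconv.linear_image (Λ.restrictScalars ℝ)
  have hmem : g ∈ closure (Λ '' S) := by
    by_contra hgB
    obtain ⟨l, u, hlu, hug⟩ := RCLike.geometric_hahn_banach_closed_point (𝕜 := ℂ)
      hBconv.closure isClosed_closure hgB
    have hS0 : (0 : ℕ →₀ ℂ) ∈ S := ⟨by simp, by simp⟩
    have hu0 : 0 < u := by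
      have := hlu 0 (subset_closure ⟨0, hS0, map_zero Λ⟩)
      simpa using this
    -- The coefficients are the phases that make every ℓ(x_m) real and nonnegative; they lie in the
    -- disc, so the separating bound applies to the sum of absolute values.
    have hsum : ∀ t : Finset ℕ, (∀ m ∈ t, y ≤ m) →
        ∑ m ∈ t, ‖w m‖ * ‖l (expFun K (Real.log (m + α)))‖ < u := by
      intro t ht
      choose c hc1 hc2 using fun m => exists_unit_mul_eq_norm (l (x m))
      set d : ℕ →₀ ℂ := Finsupp.indicator t fun m _ => c m with hd
      have hdS : d ∈ S := by
        refine ⟨fun m => ?_, fun m hm => ?_⟩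
        · rw [hd, Finsupp.indicator_apply]
          split_ifs
          · exact hc1 m
          · simp
        · rw [hd, Finsupp.indicator_apply, dif_neg fun h => absurd (ht m h) (not_le.2 hm)]
      have h1 := hlu _ (subset_closure ⟨d, hdS, rfl⟩)
      have h2 : Λ d = ∑ m ∈ t, c m • x m := by
        rw [hΛ, Finsupp.linearCombination_apply, hd, Finsupp.sum_indicator_index]
        simp
      rw [h2, map_sum, map_sum] at h1
      refine lt_of_le_of_lt (le_of_eq ?_) h1
      refine Finset.sum_congr rfl fun m _ => ?_
      rw [map_smul, smul_eq_mul, hc2, RCLike.re_eq_complex_re, Complex.ofReal_re, hx]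
      simp only [map_smul, norm_smul]
    -- Otherwise |ℓ(e^{-sz})| exceeds u e^{-(1-ε)v} throughout the window, whose weights total at
    -- least e^{(1-ε)v}, and the sum would reach u.
    have hnodes : ∀ δ : ℝ, 0 < δ → δ ≤ 1 → ∀ ε : ℝ, 0 < ε → ∀ᶠ v : ℝ in atTop,
        ∃ z ∈ Set.Ioc v (v + δ), ‖l (expFun K z)‖ ≤ u * Real.exp (-(1 - ε) * v) := by
      intro δ hδ hδ1 ε hε
      filter_upwards [hw δ hδ hδ1 ε hε, eventually_ge_atTop (Real.log (y + α))] with v hv hvy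
      obtain ⟨t, ht, htsum⟩ := hv
      by_contra! hcon
      have hty : ∀ m ∈ t, y ≤ m := by
        intro m hm
        have h1 := (ht m hm).1
        have h2 : Real.log (y + α) < Real.log (m + α) := hvy.trans_lt h1
        have h3 := (Real.log_lt_log_iff (by positivity) (by positivity)).1 h2
        have h4 : (y : ℝ) < m := by linarith
        exact_mod_cast h4.le
      have h1 := hsum t hty
      have h2 : (∑ m ∈ t, ‖w m‖) * (u * Real.exp (-(1 - ε) * v)) ≤
          ∑ m ∈ t, ‖w m‖ * ‖l (expFun K (Real.log (m + α)))‖ := by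
        rw [Finset.sum_mul]
        exact Finset.sum_le_sum fun m hm =>
          mul_le_mul_of_nonneg_left (hcon _ (ht m hm)).le (norm_nonneg _)
      have h3 : Real.exp ((1 - ε) * v) * (u * Real.exp (-(1 - ε) * v)) = u := by
        rw [mul_left_comm, ← Real.exp_add, neg_mul, add_neg_cancel, Real.exp_zero, mul_one]
      have h4 := mul_le_mul_of_nonneg_right htsum
        (by positivity : 0 ≤ u * Real.exp (-(1 - ε) * v))
      linarith
    obtain ⟨β, hβ1, hβ2⟩ := exists_between hb1
    obtain ⟨C', hC'⟩ := exists_norm_le_exp_of_nodes K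
      (fun s hs => ha0.le.trans (hK s hs).1) l hu0.le hnodes
      (by linarith : 0 < β) hβ2
    have hz := functional_eq_zero_of_decay K hK ha hb hR hR0 hab hβ1 l (fun x hx => hC' x hx) hf g
      fun _ => rfl
    rw [hz] at hug
    simp at hug
    linarith
  obtain ⟨_, ⟨c, hc, rfl⟩, hdist⟩ := Metric.mem_closure_iff.1 hmem ε hε
  refine ⟨c, hc.1, hc.2, fun s hs => ?_⟩
  rw [dist_eq_norm, norm_sub_rev] at hdist
  have h1 := ((Λ c - g).norm_coe_le_norm ⟨s, hs⟩).trans hdist.le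
  refine le_trans (le_of_eq ?_) h1
  congr 1
  rw [ContinuousMap.sub_apply, hΛ, Finsupp.linearCombination_apply]
  simp only [Finsupp.sum, ContinuousMap.sum_apply]
  refine congrArg₂ _ (Finset.sum_congr rfl fun m _ => ?_) rfl
  simp only [hx, ContinuousMap.smul_apply, smul_eq_mul, expFun_apply]
  rw [exp_neg_mul_log_eq hα]
  ring

theorem exists_sum_rpow_tail_le {α a W : ℝ} (ha : 1 / 2 < a) {ε : ℝ} (hε : 0 < ε) :
    ∃ y₀ : ℕ, ∀ y ≥ y₀, ∀ N, ∑ m ∈ Finset.Ico y N, W ^ 2 * |(m : ℝ) + α| ^ (-(2 * a)) ≤ ε := by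
  have h1 : Summable fun m : ℕ => W ^ 2 * |(m : ℝ) + α| ^ (-(2 * a)) := by
    refine Summable.mul_left _ ?_
    have := (Real.summable_one_div_nat_add_rpow α (2 * a)).2 (by linarith)
    refine this.congr fun m => ?_
    rw [Real.rpow_neg (abs_nonneg _), one_div]
  obtain ⟨s, hs⟩ := summable_iff_vanishing_norm.1 h1 ε hε
  refine ⟨s.sup id + 1, fun y hy N => (le_abs_self _).trans (hs _ ?_).le⟩
  rw [Finset.disjoint_left]
  intro m hm hms
  have h2 : m ≤ s.sup id := Finset.le_sup (f := id) hms
  have h3 := (Finset.mem_Ico.1 hm).1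
  omega

theorem exists_closed_rect {σ₁ R : ℝ} {K : Set ℂ} (hK : IsCompact K) (hKr : K ⊆ rect σ₁ R)
    (hne : K.Nonempty) : ∃ a b r : ℝ, σ₁ < a ∧ a ≤ b ∧ b < 1 ∧ 0 ≤ r ∧ r < R ∧
      ∀ s ∈ K, a ≤ s.re ∧ s.re ≤ b ∧ |s.im| ≤ r := by
  obtain ⟨p, hp, hpm⟩ := hK.exists_isMinOn hne Complex.continuous_re.continuousOn
  obtain ⟨q, hq, hqm⟩ := hK.exists_isMaxOn hne Complex.continuous_re.continuousOn
  obtain ⟨r, hr, hrm⟩ := hK.exists_isMaxOn hne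
    (continuous_abs.comp Complex.continuous_im).continuousOn
  exact ⟨p.re, q.re, |r.im|, (hKr hp).1, hpm hq, (hKr hq).2.1, abs_nonneg _, (hKr hr).2.2,
    fun s hs => ⟨hpm hs, hqm hs, hrm hs⟩⟩

/-- Every holomorphic function on a rectangle is approximated, uniformly on compacta, by sums of
tail terms with unimodular coefficients. -/
theorem exists_circle_sum_approx {α : ℝ} (hα : 0 < α) {w : ℕ → ℂ} (hw : LogDense α w) {W : ℝ}
    (hW : ∀ m, ‖w m‖ ≤ W) {σ₁ R : ℝ} (hσ : 1 / 2 ≤ σ₁) {K : Set ℂ} (hK : IsCompact K)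
    (hKr : K ⊆ rect σ₁ R) {ε : ℝ} (hε : 0 < ε) :
    ∃ y₀ : ℕ, ∀ y ≥ y₀, ∀ f : ℂ → ℂ, DifferentiableOn ℂ f (rect σ₁ R) →
      ∃ N₀ : ℕ, ∀ N ≥ N₀, ∃ c : ℕ → Circle, ∀ s ∈ K,
        ‖∑ m ∈ Finset.Ico y N, w m * c m / ((m : ℂ) + α) ^ s - f s‖ ≤ ε := by
  classical
  rcases K.eq_empty_or_nonempty with rfl | hne
  · exact ⟨0, fun y _ f _ => ⟨0, fun N _ => ⟨fun _ => 1, by simp⟩⟩⟩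
  obtain ⟨a, b, r, ha, hab, hb, hr0, hr, hKb⟩ := exists_closed_rect hK hKr hne
  obtain ⟨a', ha'1, ha'2⟩ := exists_between ha
  obtain ⟨b', hb'1, hb'2⟩ := exists_between hb
  obtain ⟨r', hr'1, hr'2⟩ := exists_between hr
  obtain ⟨d, hd0, hd⟩ : ∃ d : ℝ, 0 < d ∧ d ≤ a - a' ∧ d ≤ b' - b ∧ d ≤ r' - r :=
    ⟨min (a - a') (min (b' - b) (r' - r)), by
      simp only [lt_min_iff, sub_pos]; exact ⟨ha'2, hb'1, hr'1⟩, min_le_left _ _,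
      (min_le_right _ _).trans (min_le_left _ _), (min_le_right _ _).trans (min_le_right _ _)⟩
  set P : ℝ := 2 * ((b' - a') + (r' - -r')) with hP
  have hP0 : 0 < P := by rw [hP]; linarith
  -- P is the perimeter. With this η and boundary energy at most dηε/4, each of the two terms in
  -- `norm_le_of_rectEnergy` is at most ε/4.
  set η : ℝ := d * ε / (4 * P) with hη
  have hη0 : 0 < η := by positivity
  obtain ⟨y₀, hy₀⟩ := exists_sum_rpow_tail_le (α := α) (W := W) (a := a') (by linarith)
    (by positivity : 0 < d * η * ε / (4 * P))
  -- The threshold depends on K and ε but not on f, so that callers may subtract from their target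
  -- the terms below y. The extra 1 ensures m ≥ 1, hence log(m+α) ≥ 0.
  refine ⟨y₀ + 1, fun y hy f hf => ?_⟩
  have hf' : DifferentiableOn ℂ f {w | w.re ∈ Set.Icc a' b' ∧ w.im ∈ Set.Icc (-r') r'} :=
    hf.mono fun s hs => ⟨ha'1.trans_le hs.1.1, hs.1.2.trans_lt hb'2,
      (abs_le.2 ⟨hs.2.1, hs.2.2⟩).trans_lt hr'2⟩
  obtain ⟨c, hc1, hc2, hc3⟩ := exists_disc_sum_approx hα hw hK hKb ha'2 hb'1 hr'1 hr0 hab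
    (by linarith) hb'2 hf' y (half_pos hε)
  -- Beyond the support the disc coefficients are 0; these too are rounded to the circle, at a cost
  -- bounded by the same tail for every N.
  refine ⟨c.support.sup id + 1, fun N hN => ?_⟩
  have hsub : c.support ⊆ Finset.Ico y N := by
    intro m hm
    have h1 : m ≤ c.support.sup id := Finset.le_sup (f := id) hm
    refine Finset.mem_Ico.2 ⟨?_, by omega⟩
    by_contra h
    exact Finsupp.mem_support_iff.1 hm (hc2 m (not_le.1 h))
  have hcsum : ∀ s : ℂ, (c.sum fun m z => z * w m / ((m : ℂ) + α) ^ s) =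
      ∑ m ∈ Finset.Ico y N, c m * w m / ((m : ℂ) + α) ^ s := fun s =>
    Finsupp.sum_of_support_subset _ hsub _ fun m _ => by simp
  set x : ℕ → C(ℂ, ℂ) := fun m =>
    ⟨fun s => w m * Complex.exp (-s * (Real.log (m + α) : ℝ)), by fun_prop⟩ with hx
  have hxv : ∀ m s, x m s = w m / ((m : ℂ) + α) ^ s := fun m s => by
    simp only [hx, ContinuousMap.coe_mk]
    rw [exp_neg_mul_log_eq hα, div_eq_mul_inv]
  obtain ⟨c', hc'⟩ := exists_circle_rounding
    (fun v : C(ℂ, ℂ) => rectEnergy a' b' (-r') r' v)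
    (rectEnergy_parallelogram a' b' (-r') r') (rectEnergy_smul a' b' (-r') r')
    (fun v => rectEnergy_nonneg (by linarith) (by linarith) v) x c hc1 (Finset.Ico y N)
  refine ⟨c', fun s hs => ?_⟩
  have henergy : rectEnergy a' b' (-r') r'
      (∑ m ∈ Finset.Ico y N, ((c' m : ℂ) - c m) • x m : C(ℂ, ℂ)) ≤ d * η * ε / 4 := by
    refine hc'.trans ?_
    have h1 : ∀ m ∈ Finset.Ico y N, rectEnergy a' b' (-r') r' (x m) ≤
        P * (W ^ 2 * |(m : ℝ) + α| ^ (-(2 * a'))) := by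
      intro m hm
      refine rectEnergy_le (by linarith) (by linarith) _ fun z hz => ?_
      have hpos : (0 : ℝ) < m + α := by positivity
      simp only [hx, ContinuousMap.coe_mk]
      rw [norm_mul, mul_pow, norm_exp_neg_mul_ofReal, abs_of_pos hpos]
      have hm0 : 1 ≤ m := by have := (Finset.mem_Ico.1 hm).1; omega
      have h2 : Real.exp (-(z.re * Real.log (m + α))) ^ 2 ≤ ((m : ℝ) + α) ^ (-(2 * a')) := by
        rw [← Real.exp_nat_mul, Real.rpow_def_of_pos hpos]
        apply Real.exp_le_exp.2
        have hz1 : a' ≤ z.re := hz.1.1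
        have hl : 0 ≤ Real.log (m + α) := Real.log_nonneg (by
          have : (1 : ℝ) ≤ m := by exact_mod_cast hm0
          linarith)
        push_cast
        nlinarith
      exact mul_le_mul (pow_le_pow_left₀ (norm_nonneg _) (hW m) 2) h2 (by positivity)
        (by positivity)
    refine (Finset.sum_le_sum h1).trans ?_
    rw [← Finset.mul_sum]
    refine (mul_le_mul_of_nonneg_left (hy₀ y (by omega) N) hP0.le).trans (le_of_eq ?_)
    field_simp
  obtain ⟨hs1, hs2, hs3⟩ := hKb s hs
  have hs4 := abs_le.1 hs3
  have hdiff : Differentiable ℂ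
      (∑ m ∈ Finset.Ico y N, ((c' m : ℂ) - c m) • x m : C(ℂ, ℂ)) := by
    have : ((∑ m ∈ Finset.Ico y N, ((c' m : ℂ) - c m) • x m : C(ℂ, ℂ)) : ℂ → ℂ) =
        fun s => ∑ m ∈ Finset.Ico y N,
          ((c' m : ℂ) - c m) * (w m * Complex.exp (-s * (Real.log (m + α) : ℝ))) := by
      ext s; simp [hx, ContinuousMap.sum_apply]
    rw [this]
    fun_prop
  have hdist : ∀ z ∈ rectBoundary a' b' (-r') r', d ≤ ‖z - s‖ := by
    rintro z ⟨h1, h2, h3⟩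
    have hre := Complex.abs_re_le_norm (z - s)
    have him := Complex.abs_im_le_norm (z - s)
    rw [Complex.sub_re] at hre
    rw [Complex.sub_im] at him
    rcases h3 with h | h | h | h
    · have := neg_abs_le (z.re - s.re); linarith
    · have := le_abs_self (z.re - s.re); linarith
    · have := neg_abs_le (z.im - s.im); linarith
    · have := le_abs_self (z.im - s.im); linarith
  have hmain := norm_le_of_rectEnergy (s := s) (x₀ := a') (x₁ := b') (y₀ := -r') (y₁ := r')
    ⟨by linarith, by linarith⟩ ⟨by linarith, by linarith⟩ hdiff hd0 hη0 hdist
  have hfin : ‖(∑ m ∈ Finset.Ico y N, ((c' m : ℂ) - c m) • x m : C(ℂ, ℂ)) s‖ ≤ ε / 2 := by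
    refine hmain.trans ?_
    have h1 : η⁻¹ * rectEnergy a' b' (-r') r'
        (∑ m ∈ Finset.Ico y N, ((c' m : ℂ) - c m) • x m : C(ℂ, ℂ)) ≤ d * ε / 4 := by
      refine (mul_le_mul_of_nonneg_left henergy (inv_nonneg.2 hη0.le)).trans (le_of_eq ?_)
      field_simp
    have h2 : η * P = d * ε / 4 := by rw [hη]; field_simp
    calc _ ≤ d⁻¹ * (d * ε / 4 + d * ε / 4) :=
          mul_le_mul_of_nonneg_left (add_le_add h2.le h1) (inv_nonneg.2 hd0.le)
      _ = ε / 2 := by field_simp; ring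
  have hdecomp : ∑ m ∈ Finset.Ico y N, w m * c' m / ((m : ℂ) + α) ^ s - f s =
      (∑ m ∈ Finset.Ico y N, ((c' m : ℂ) - c m) • x m : C(ℂ, ℂ)) s +
        ((c.sum fun m z => z * w m / ((m : ℂ) + α) ^ s) - f s) := by
    rw [hcsum, ContinuousMap.sum_apply, ← add_sub_assoc, ← Finset.sum_add_distrib]
    refine congrArg₂ _ (Finset.sum_congr rfl fun m _ => ?_) rfl
    rw [ContinuousMap.smul_apply, hxv, smul_eq_mul]
    ring
  rw [hdecomp]
  exact (norm_add_le _ _).trans (by linarith [hc3 s hs])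

/-! ### Logarithmic density of the two systems of weights -/

/-- The primes `p` with `u < log p ≤ u + δ`. -/
def primeWindow (u δ : ℝ) : Finset ℕ := (logWindow (u + δ / 2) (δ / 2)).filter Nat.Prime

theorem mem_primeWindow {u δ : ℝ} {p : ℕ} :
    p ∈ primeWindow u δ ↔ p.Prime ∧ u < Real.log p ∧ Real.log p ≤ u + δ := by
  rw [primeWindow, Finset.mem_filter, mem_logWindow]
  constructor
  · rintro ⟨⟨_, h1, h2⟩, h3⟩
    exact ⟨h3, by linarith, by linarith⟩
  · rintro ⟨h3, h1, h2⟩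
    exact ⟨⟨h3.pos, by linarith, by linarith⟩, h3⟩

theorem primesLE_floor_exp_eq_union (u : ℝ) {δ : ℝ} (hδ : 0 ≤ δ) :
    Disjoint (Nat.primesLE ⌊Real.exp u⌋₊) (primeWindow u δ) ∧
    Nat.primesLE ⌊Real.exp (u + δ)⌋₊ = Nat.primesLE ⌊Real.exp u⌋₊ ∪ primeWindow u δ := by
  have key : ∀ (v : ℝ) (p : ℕ), p.Prime → (p ≤ ⌊Real.exp v⌋₊ ↔ Real.log p ≤ v) := by
    intro v p hp
    rw [Nat.le_floor_iff (Real.exp_pos v).le, Real.log_le_iff_le_exp (by exact_mod_cast hp.pos)]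
  constructor
  · rw [Finset.disjoint_left]
    intro p hp hp'
    rw [mem_primeWindow] at hp'
    rw [Nat.mem_primesLE, key u p hp'.1] at hp
    linarith [hp.1, hp'.2.1]
  · ext p
    rw [Finset.mem_union, Nat.mem_primesLE, Nat.mem_primesLE, mem_primeWindow]
    by_cases hp : p.Prime
    · rw [key _ p hp, key _ p hp]
      constructor
      · rintro ⟨h, -⟩
        rcases le_or_gt (Real.log p) u with h' | h'
        · exact Or.inl ⟨h', hp⟩
        · exact Or.inr ⟨hp, h', h⟩
      · rintro (⟨h, -⟩ | ⟨-, -, h⟩)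
        · exact ⟨by linarith, hp⟩
        · exact ⟨h, hp⟩
    · simp [hp]

/-- Multiplicative intervals carry a positive proportion of a nonnegative function with a positive
mean over the primes. -/
theorem eventually_exp_le_sum_primeWindow {g : ℕ → ℝ} {κ : ℝ} (hκ : 0 < κ)
    (h : Tendsto (fun x : ℕ => (∑ p ∈ Nat.primesLE x, g p) / (Nat.primeCounting x : ℝ))
      atTop (𝓝 κ)) {δ : ℝ} (hδ : 0 < δ) (hδ₁ : δ ≤ 1) {ε : ℝ} (hε : 0 < ε) :
    ∀ᶠ u : ℝ in atTop, Real.exp ((1 - ε) * u) ≤ ∑ p ∈ primeWindow u δ, g p := by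
  obtain ⟨c, hc, hwin⟩ := exists_le_card_primes_window (half_pos hδ) (by linarith : δ / 2 ≤ 1)
  have hshift : Tendsto (fun u : ℝ => u + δ / 2) atTop atTop :=
    tendsto_atTop_add_const_right _ _ tendsto_id
  have hwin' := hshift.eventually hwin
  have hexp : Tendsto (fun u : ℝ => Real.exp (u + δ)) atTop atTop :=
    Real.tendsto_exp_atTop.comp (tendsto_atTop_add_const_right _ _ tendsto_id)
  have hche := hexp.eventually (Chebyshev.eventually_primeCounting_le one_pos)
  set C : ℝ := (Real.log 4 + 1) * Real.exp 1 with hC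
  have hC0 : 0 < C := by
    have : 0 < Real.log 4 := Real.log_pos (by norm_num)
    positivity
  -- The window has at least c e^u/(2u) primes and π(e^{u+δ}) ≤ C e^u/u, so the errors of the mean
  -- value at both ends together use up at most half of the main term.
  set η : ℝ := κ * c / (8 * C) with hη
  have hη0 : 0 < η := by positivity
  have hmean : ∀ᶠ x : ℕ in atTop,
      |(∑ p ∈ Nat.primesLE x, g p) - κ * Nat.primeCounting x| ≤ η * Nat.primeCounting x := by
    filter_upwards [h.eventually (Metric.ball_mem_nhds κ hη0), eventually_ge_atTop 2] with x hx hx2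
    have hpos : (0 : ℝ) < Nat.primeCounting x := by
      have := Nat.monotone_primeCounting hx2
      have h2 : Nat.primeCounting 2 = 1 := by decide
      rw [h2] at this
      exact_mod_cast this
    rw [Real.dist_eq] at hx
    have h3 : (∑ p ∈ Nat.primesLE x, g p) - κ * Nat.primeCounting x =
        ((∑ p ∈ Nat.primesLE x, g p) / (Nat.primeCounting x : ℝ) - κ) * Nat.primeCounting x := by
      field_simp
    rw [h3, abs_mul, abs_of_pos hpos]
    exact mul_le_mul_of_nonneg_right hx.le hpos.le
  have hm1 := (tendsto_nat_floor_atTop.comp Real.tendsto_exp_atTop).eventually hmean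
  have hm2 := (tendsto_nat_floor_atTop.comp hexp).eventually hmean
  filter_upwards [hwin', hche, hm1, hm2, eventually_ge_atTop 1,
    eventually_ge_atTop (8 / (κ * c * ε ^ 2))] with u h1 h2 h3 h4 hu1 hu2
  simp only [Function.comp_apply] at h3 h4
  obtain ⟨hdis, hun⟩ := primesLE_floor_exp_eq_union u hδ.le
  have hsum : ∑ p ∈ Nat.primesLE ⌊Real.exp (u + δ)⌋₊, g p =
      ∑ p ∈ Nat.primesLE ⌊Real.exp u⌋₊, g p + ∑ p ∈ primeWindow u δ, g p := by
    rw [hun, Finset.sum_union hdis]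
  have hcard : (Nat.primeCounting ⌊Real.exp (u + δ)⌋₊ : ℝ) =
      Nat.primeCounting ⌊Real.exp u⌋₊ + (primeWindow u δ).card := by
    rw [← Nat.primesLE_card_eq_primeCounting, hun, Finset.card_union_of_disjoint hdis,
      Nat.primesLE_card_eq_primeCounting]
    push_cast; rfl
  have hcw : c * (Real.exp u / (2 * u)) ≤ (primeWindow u δ).card := by
    refine le_trans ?_ h1
    refine mul_le_mul_of_nonneg_left ?_ hc.le
    exact div_le_div₀ (Real.exp_pos _).le (Real.exp_le_exp.2 (by linarith)) (by linarith)
      (by linarith)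
  have hpc : (Nat.primeCounting ⌊Real.exp (u + δ)⌋₊ : ℝ) ≤ C * (Real.exp u / u) := by
    refine h2.trans ?_
    rw [Real.log_exp, hC, mul_assoc (Real.log 4 + 1), ← mul_div_assoc (Real.exp 1),
      ← Real.exp_add, mul_div_assoc]
    have : 0 < Real.log 4 := Real.log_pos (by norm_num)
    refine mul_le_mul_of_nonneg_left ?_ (by positivity)
    exact div_le_div₀ (Real.exp_pos _).le (Real.exp_le_exp.2 (by linarith)) (by linarith)
      (by linarith)
  have hmono : (Nat.primeCounting ⌊Real.exp u⌋₊ : ℝ) ≤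
      Nat.primeCounting ⌊Real.exp (u + δ)⌋₊ := by rw [hcard]; simp
  have h5 := (abs_le.1 h3).2
  have h6 := (abs_le.1 h4).1
  have hη1 : 2 * η * Nat.primeCounting ⌊Real.exp (u + δ)⌋₊ ≤ κ * c / 4 * (Real.exp u / u) := by
    refine (mul_le_mul_of_nonneg_left hpc (by positivity)).trans (le_of_eq ?_)
    rw [hη]; field_simp; ring
  have hη2 : η * Nat.primeCounting ⌊Real.exp u⌋₊ ≤
      η * Nat.primeCounting ⌊Real.exp (u + δ)⌋₊ := mul_le_mul_of_nonneg_left hmono hη0.le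
  have hcw' : κ * c / 2 * (Real.exp u / u) ≤ κ * (primeWindow u δ).card := by
    refine le_trans (le_of_eq ?_) (mul_le_mul_of_nonneg_left hcw hκ.le)
    field_simp
  rw [hsum] at h6
  rw [hcard, mul_add κ] at h6
  rw [hcard] at hη1 hη2
  have hkey : κ * c / 4 * (Real.exp u / u) ≤ ∑ p ∈ primeWindow u δ, g p := by linarith
  refine le_trans ?_ hkey
  -- The factor κc/(4u) is absorbed by e^{εu} ≥ (εu)²/2, which is why u ≥ 8/(κcε²) was required.
  have hq := Real.quadratic_le_exp_of_nonneg (by positivity : 0 ≤ ε * u)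
  have hsplit : Real.exp u = Real.exp ((1 - ε) * u) * Real.exp (ε * u) := by
    rw [← Real.exp_add]; congr 1; ring
  rw [hsplit, mul_div_assoc (Real.exp ((1 - ε) * u)), mul_left_comm]
  refine le_mul_of_one_le_right (Real.exp_pos _).le ?_
  rw [div_le_iff₀ (by positivity)] at hu2
  rw [← mul_div_assoc, le_div_iff₀ (by linarith)]
  have h8 : (ε * u) ^ 2 / 2 ≤ Real.exp (ε * u) := by
    have : 0 ≤ ε * u := by positivity
    linarith
  have h9 := mul_le_mul_of_nonneg_left h8 (by positivity : 0 ≤ κ * c / 4)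
  nlinarith

/-- Since |a(p)|² ≤ L|a(p)|, the mean of squares controls first powers from below. The constant L is
paid for with half of ε. -/
theorem logDense_primes {a : ℕ → ℂ} {κ L : ℝ} (hκ : 0 < κ) (hL : ∀ p : ℕ, p.Prime → ‖a p‖ ≤ L)
    (h : Tendsto (fun x : ℕ => (∑ p ∈ Nat.primesLE x, ‖a p‖ ^ 2) / (Nat.primeCounting x : ℝ))
      atTop (𝓝 κ)) :
    LogDense 1 fun m => if (m + 1).Prime then a (m + 1) else 0 := by
  intro δ hδ hδ₁ ε hε
  have hL0 : 0 ≤ L := (norm_nonneg _).trans (hL 2 Nat.prime_two)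
  have hlarge : ∀ᶠ u : ℝ in atTop, L ≤ Real.exp (ε / 2 * u) :=
    (Real.tendsto_exp_atTop.comp (tendsto_id.const_mul_atTop (half_pos hε))).eventually_ge_atTop L
  filter_upwards [eventually_exp_le_sum_primeWindow hκ h hδ hδ₁ (half_pos hε), hlarge] with u hu hu'
  have hinj : Set.InjOn (fun p : ℕ => p - 1) (primeWindow u δ) := by
    intro p hp q hq hpq
    have h1 := (mem_primeWindow.1 hp).1.pos
    have h2 := (mem_primeWindow.1 hq).1.pos
    simp only at hpq
    omega
  refine ⟨(primeWindow u δ).image fun p => p - 1, ?_, ?_⟩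
  · intro m hm
    obtain ⟨p, hp, rfl⟩ := Finset.mem_image.1 hm
    obtain ⟨hp1, hp2, hp3⟩ := mem_primeWindow.1 hp
    rw [Nat.cast_sub hp1.one_le]
    simpa using ⟨hp2, hp3⟩
  · rw [Finset.sum_image hinj]
    have h1 : ∑ p ∈ primeWindow u δ, ‖a p‖ ^ 2 ≤ L * ∑ p ∈ primeWindow u δ,
        ‖if (p - 1 + 1).Prime then a (p - 1 + 1) else 0‖ := by
      rw [Finset.mul_sum]
      refine Finset.sum_le_sum fun p hp => ?_
      have hp1 := (mem_primeWindow.1 hp).1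
      rw [Nat.sub_add_cancel hp1.one_le, if_pos hp1, sq]
      exact mul_le_mul_of_nonneg_right (hL p hp1) (norm_nonneg _)
    have h2 := hu.trans (h1.trans (mul_le_mul_of_nonneg_right hu'
      (Finset.sum_nonneg fun _ _ => norm_nonneg _)))
    have h3 : Real.exp ((1 - ε / 2) * u) = Real.exp (ε / 2 * u) * Real.exp ((1 - ε) * u) := by
      rw [← Real.exp_add]; congr 1; ring
    rw [h3] at h2
    exact le_of_mul_le_mul_left h2 (Real.exp_pos _)

/-- The progression m₀ + jk alone suffices: it has at least e^u δ/k - 1 members in the window, all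
of weight |b(m₀)|. -/
theorem logDense_periodic {b : ℕ → ℂ} {k : ℕ} (hk : 0 < k) (hb : Function.Periodic b k) {m₀ : ℕ}
    (hm₀ : b m₀ ≠ 0) (α : ℝ) : LogDense α b := by
  intro δ hδ hδ₁ ε hε
  have hB : 0 < ‖b m₀‖ := norm_pos_iff.2 hm₀
  have hk' : (0 : ℝ) < k := by exact_mod_cast hk
  set c : ℝ := ‖b m₀‖ * δ / k with hc
  have hc0 : 0 < c := by positivity
  have h1 : ∀ᶠ u : ℝ in atTop, 2 / c ≤ Real.exp (ε * u) :=
    (Real.tendsto_exp_atTop.comp (tendsto_id.const_mul_atTop hε)).eventually_ge_atTop _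
  filter_upwards [h1, Real.tendsto_exp_atTop.eventually_ge_atTop (2 * ‖b m₀‖ / c),
    Real.tendsto_exp_atTop.eventually_ge_atTop (m₀ + α)] with u hu1 hu2 hu3
  set A : ℝ := (Real.exp u - (m₀ + α)) / k with hA
  set B : ℝ := (Real.exp (u + δ) - (m₀ + α)) / k with hB'
  have hA0 : 0 ≤ A := div_nonneg (by linarith) hk'.le
  have hexp : Real.exp u * (1 + δ) ≤ Real.exp (u + δ) := by
    rw [Real.exp_add]
    exact mul_le_mul_of_nonneg_left (by linarith [Real.add_one_le_exp δ]) (Real.exp_pos _).le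
  have hBA : A + Real.exp u * δ / k ≤ B := by
    rw [hA, hB', ← add_div]
    exact div_le_div_of_nonneg_right (by linarith) hk'.le
  have hB0 : 0 ≤ B := by
    have : 0 ≤ Real.exp u * δ / k := by positivity
    linarith
  have hbj : ∀ j : ℕ, b (m₀ + j * k) = b m₀ := fun j => by
    simpa using hb.nsmul j m₀
  refine ⟨(Finset.Ioc ⌊A⌋₊ ⌊B⌋₊).image fun j => m₀ + j * k, ?_, ?_⟩
  · intro m hm
    obtain ⟨j, hj, rfl⟩ := Finset.mem_image.1 hm
    rw [Finset.mem_Ioc, Nat.floor_lt hA0, Nat.le_floor_iff hB0, hA, hB', div_lt_iff₀ hk',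
      le_div_iff₀ hk'] at hj
    have hpos : 0 < (m₀ : ℝ) + j * k + α := by linarith [Real.exp_pos u, hj.1]
    push_cast
    rw [Set.mem_Ioc, Real.lt_log_iff_exp_lt hpos, Real.log_le_iff_le_exp hpos]
    constructor <;> linarith [hj.1, hj.2]
  · rw [Finset.sum_image (fun i _ j _ hij => by
      have : i * k = j * k := by simpa using hij
      exact Nat.eq_of_mul_eq_mul_right hk this)]
    simp only [hbj, Finset.sum_const, Nat.card_Ioc, nsmul_eq_mul]
    have hcard : Real.exp u * δ / k - 1 ≤ ((⌊B⌋₊ - ⌊A⌋₊ : ℕ) : ℝ) := by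
      have h2 : (⌊B⌋₊ : ℝ) ≤ ((⌊B⌋₊ - ⌊A⌋₊ : ℕ) : ℝ) + ⌊A⌋₊ := by
        exact_mod_cast le_tsub_add
      have h3 := Nat.lt_floor_add_one B
      have h4 := Nat.floor_le hA0
      linarith
    refine le_trans ?_ (mul_le_mul_of_nonneg_right hcard hB.le)
    have h5 : (Real.exp u * δ / k - 1) * ‖b m₀‖ = Real.exp u * c - ‖b m₀‖ := by
      rw [hc]; ring
    rw [h5]
    rw [div_le_iff₀ hc0] at hu1 hu2
    have h6 : Real.exp u = Real.exp ((1 - ε) * u) * Real.exp (ε * u) := by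
      rw [← Real.exp_add]; congr 1; ring
    have h7 := mul_le_mul_of_nonneg_left hu1 (Real.exp_pos ((1 - ε) * u)).le
    rw [← mul_assoc, ← h6] at h7
    linarith

/-- The mean-square abscissa is at least one half. -/
theorem half_le_of_summable {a : ℕ → ℂ} {κ : ℝ} (hκ : 0 < κ)
    (h : Tendsto (fun x : ℕ => (∑ p ∈ Nat.primesLE x, ‖a p‖ ^ 2) / (Nat.primeCounting x : ℝ))
      atTop (𝓝 κ)) {σ : ℝ}
    (hs : Summable fun m : ℕ => ‖a (m + 1)‖ ^ 2 / ((m + 1 : ℕ) : ℝ) ^ (2 * σ)) : 1 / 2 ≤ σ := by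
  by_contra! hσ
  have hs' : Summable fun m : ℕ => ‖a m‖ ^ 2 / (m : ℝ) ^ (2 * σ) := (summable_nat_add_iff 1).1 hs
  -- Truncating at 0 makes p^{-2τ} decreasing, so it can be bounded below over a window by its value
  -- at the right end. One far window then already exceeds the sum of the series.
  set τ : ℝ := max σ 0 with hτ
  have hτ0 : 0 ≤ τ := le_max_right _ _
  have hτ1 : τ < 1 / 2 := max_lt hσ (by norm_num)
  set ε : ℝ := (1 - 2 * τ) / 2 with hε
  have hε0 : 0 < ε := by rw [hε]; linarith
  have hlarge : ∀ᶠ u : ℝ in atTop,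
      (∑' m : ℕ, ‖a m‖ ^ 2 / (m : ℝ) ^ (2 * σ) + 1) * Real.exp (2 * τ) ≤ Real.exp (ε * u) :=
    (Real.tendsto_exp_atTop.comp (tendsto_id.const_mul_atTop hε0)).eventually_ge_atTop _
  obtain ⟨u, hu1, hu2⟩ := ((eventually_exp_le_sum_primeWindow hκ h one_pos le_rfl hε0).and
    hlarge).exists
  have h1 : ∑ p ∈ primeWindow u 1, ‖a p‖ ^ 2 * Real.exp (-(2 * τ * (u + 1))) ≤
      ∑' m : ℕ, ‖a m‖ ^ 2 / (m : ℝ) ^ (2 * σ) := by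
    refine le_trans (Finset.sum_le_sum fun p hp => ?_)
      (hs'.sum_le_tsum (primeWindow u 1) fun m _ => by positivity)
    obtain ⟨hp1, hp2, hp3⟩ := mem_primeWindow.1 hp
    have hp0 : (0 : ℝ) < p := by exact_mod_cast hp1.pos
    have hl : 0 ≤ Real.log p := Real.log_nonneg (by exact_mod_cast hp1.one_le)
    rw [div_eq_mul_inv, ← Real.rpow_neg hp0.le, Real.rpow_def_of_pos hp0]
    refine mul_le_mul_of_nonneg_left (Real.exp_le_exp.2 ?_) (by positivity)
    have h2 : σ * Real.log p ≤ τ * Real.log p := mul_le_mul_of_nonneg_right (le_max_left _ _) hl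
    have h3 : τ * Real.log p ≤ τ * (u + 1) := mul_le_mul_of_nonneg_left hp3 hτ0
    linarith
  rw [← Finset.sum_mul] at h1
  have h4 := (mul_le_mul_of_nonneg_right hu1 (Real.exp_pos (-(2 * τ * (u + 1)))).le).trans h1
  have h5 : Real.exp ((1 - ε) * u) * Real.exp (-(2 * τ * (u + 1))) * Real.exp (2 * τ) =
      Real.exp (ε * u) := by
    rw [← Real.exp_add, ← Real.exp_add]; congr 1; rw [hε]; ring
  have h6 := mul_le_mul_of_nonneg_right h4 (Real.exp_pos (2 * τ)).le
  rw [h5] at h6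
  have := Real.exp_pos (2 * τ)
  linarith

/-! ### Completely multiplicative functions with prescribed values at the primes -/

/-- The completely multiplicative function with the values `x p` at the primes. -/
def cmult (x : Nat.Primes → ℂ) : ℕ →*₀ ℂ where
  toFun m := if m = 0 then 0 else
    m.factorization.prod fun p e => (if h : p.Prime then x ⟨p, h⟩ else 0) ^ e
  map_zero' := by simp
  map_one' := by simp
  map_mul' m n := by
    rcases eq_or_ne m 0 with rfl | hm
    · simp
    rcases eq_or_ne n 0 with rfl | hn
    · simp
    rw [if_neg (mul_ne_zero hm hn), if_neg hm, if_neg hn, Nat.factorization_mul hm hn,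
      Finsupp.prod_add_index' (fun _ => pow_zero _) fun _ _ _ => pow_add _ _ _]

theorem cmult_prime (x : Nat.Primes → ℂ) (p : Nat.Primes) : cmult x p = x p := by
  change (if (p : ℕ) = 0 then 0 else _) = _
  rw [if_neg p.2.ne_zero, p.2.factorization, Finsupp.prod_single_index (by simp)]
  simp only [pow_one, p.2, dite_true]
  rfl

theorem cmult_mul (x y : Nat.Primes → ℂ) (m : ℕ) :
    cmult (fun p => x p * y p) m = cmult x m * cmult y m := by
  induction m using induction_on_primes with
  | zero => simp
  | one => simp
  | prime_mul p a hp ih =>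
    have h : ∀ z, cmult z p = z ⟨p, hp⟩ := fun z => cmult_prime z ⟨p, hp⟩
    rw [map_mul, map_mul, map_mul, ih, h, h, h]
    ring

/-- A provisional bound: before the parameters are known to lie in the unit disc, it gives absolute
convergence for Re s > 2. -/
theorem norm_cmult_le {x : Nat.Primes → ℂ} (hx : ∀ p : Nat.Primes, ‖x p‖ ≤ (p : ℕ)) (m : ℕ) :
    ‖cmult x m‖ ≤ m := by
  induction m using induction_on_primes with
  | zero => simp
  | one => simp
  | prime_mul p a hp ih =>
    have h : cmult x p = x ⟨p, hp⟩ := cmult_prime x ⟨p, hp⟩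
    rw [map_mul, norm_mul, Nat.cast_mul, h]
    exact mul_le_mul (hx ⟨p, hp⟩) ih (norm_nonneg _) (by positivity)

theorem norm_cmult_le_one {x : Nat.Primes → ℂ} (hx : ∀ p : Nat.Primes, ‖x p‖ ≤ 1) (m : ℕ) :
    ‖cmult x m‖ ≤ 1 := by
  induction m using induction_on_primes with
  | zero => simp
  | one => simp
  | prime_mul p a hp ih =>
    have h : cmult x p = x ⟨p, hp⟩ := cmult_prime x ⟨p, hp⟩
    rw [map_mul, norm_mul, h]
    exact mul_le_one₀ (hx ⟨p, hp⟩) (norm_nonneg _) ih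

theorem multExt_eq_cmult (ω : Ω₁) {m : ℕ} (hm : m ≠ 0) :
    (multExt ω m : ℂ) = cmult (fun p => (ω p : ℂ)) m := by
  change _ = (if m = 0 then 0 else _)
  rw [if_neg hm, Finsupp.prod, Nat.support_factorization, ← Finset.prod_attach, multExt]
  refine (map_prod Circle.coeHom _ _).trans (Finset.prod_congr rfl fun p _ => ?_)
  rw [map_pow, dif_pos (Nat.prime_of_mem_primeFactors p.2)]
  rfl

/-- `cmult x` as an arithmetic function. -/
def cmultArith (x : Nat.Primes → ℂ) : ArithmeticFunction ℂ := ⟨cmult x, map_zero _⟩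

theorem cmultArith_apply (x : Nat.Primes → ℂ) (m : ℕ) : cmultArith x m = cmult x m := rfl

/-- The Dirichlet product of the completely multiplicative functions with values `x j p`. -/
def eulerCoeff {l : ℕ} (x : Fin l → Nat.Primes → ℂ) (S : Finset (Fin l)) :
    ArithmeticFunction ℂ :=
  ∏ j ∈ S, cmultArith (x j)

theorem eulerCoeff_insert {l : ℕ} (x : Fin l → Nat.Primes → ℂ) {S : Finset (Fin l)} {j : Fin l}
    (hj : j ∉ S) : eulerCoeff x (insert j S) =
      cmultArith (x j) * eulerCoeff x S :=
  Finset.prod_insert hj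

/-- Pointwise multiplication by a completely multiplicative function is compatible with Dirichlet
convolution. This is how ω enters each local factor. -/
theorem eulerCoeff_twist {l : ℕ} (x : Fin l → Nat.Primes → ℂ) (y : Nat.Primes → ℂ)
    (S : Finset (Fin l)) (m : ℕ) :
    eulerCoeff (fun j p => x j p * y p) S m = eulerCoeff x S m * cmult y m := by
  classical
  induction S using Finset.induction_on generalizing m with
  | empty =>
    simp only [eulerCoeff, Finset.prod_empty]
    by_cases h : m = 1 <;> simp [h]
  | insert j S hj ih =>
    rw [eulerCoeff_insert _ hj, eulerCoeff_insert _ hj, ArithmeticFunction.mul_apply,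
      ArithmeticFunction.mul_apply, Finset.sum_mul]
    refine Finset.sum_congr rfl fun q hq => ?_
    rw [ih, ← (Nat.mem_divisorsAntidiagonal.1 hq).1, map_mul, cmultArith_apply, cmultArith_apply,
      cmult_mul]
    ring

theorem hasProd_cmult {x : Nat.Primes → ℂ} {s : ℂ} (hs : s ≠ 0) (h : LSeriesSummable (cmult x) s) :
    HasProd (fun p : Nat.Primes => (1 - x p / (p : ℂ) ^ s)⁻¹) (LSeries (cmult x) s) := by
  set g : ℕ →*₀ ℂ := cmult x * riemannZetaSummandHom hs with hg
  have hterm : ∀ n, g n = LSeries.term (cmult x) s n := by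
    intro n
    rcases eq_or_ne n 0 with rfl | hn
    · simp
    · rw [LSeries.term_of_ne_zero hn, hg]
      change cmult x n * (n : ℂ) ^ (-s) = _
      rw [Complex.cpow_neg, div_eq_mul_inv]
  have h1 := EulerProduct.eulerProduct_completely_multiplicative_hasProd (f := g) (by
    simp only [hterm]; exact h.norm)
  simp only [hterm] at h1
  have h2 : (fun p : Nat.Primes => (1 - x p / (p : ℂ) ^ s)⁻¹) =
      fun p : Nat.Primes => (1 - LSeries.term (cmult x) s p)⁻¹ := by
    funext p
    rw [LSeries.term_of_ne_zero p.2.ne_zero, cmult_prime]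
  rw [h2]
  exact h1

theorem eulerCoeff_hasProd {l : ℕ} {x : Fin l → Nat.Primes → ℂ} {s : ℂ} (hs : s ≠ 0)
    (h : ∀ j, LSeriesSummable (cmult (x j)) s) (S : Finset (Fin l)) :
    LSeriesSummable (eulerCoeff x S) s ∧
    HasProd (fun p : Nat.Primes => ∏ j ∈ S, (1 - x j p / (p : ℂ) ^ s)⁻¹)
      (LSeries (eulerCoeff x S) s) := by
  classical
  induction S using Finset.induction_on with
  | empty =>
    simp only [eulerCoeff, Finset.prod_empty, ArithmeticFunction.one_eq_delta]
    rw [LSeries_delta]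
    refine ⟨summable_of_ne_finset_zero (s := {1}) fun n hn => ?_, hasProd_one⟩
    rw [LSeries.term_delta, if_neg (by simpa using hn)]
  | insert j S hj ih =>
    rw [eulerCoeff_insert _ hj]
    have hj' : LSeriesSummable (cmultArith (x j)) s := h j
    refine ⟨ArithmeticFunction.LSeriesSummable_mul hj' ih.1, ?_⟩
    rw [ArithmeticFunction.LSeries_mul' hj' ih.1]
    simp only [Finset.prod_insert hj]
    exact (hasProd_cmult hs (h j)).mul ih.2

/-! ### The local factors -/

/-- The generating series of the values at the powers of `p`. -/
def localSeries (p : ℕ) (f : ArithmeticFunction ℂ) : PowerSeries ℂ :=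
  PowerSeries.mk fun k => f (p ^ k)

theorem localSeries_mul {p : ℕ} (hp : p.Prime) (f g : ArithmeticFunction ℂ) :
    localSeries p (f * g) = localSeries p f * localSeries p g := by
  ext k
  rw [PowerSeries.coeff_mul, localSeries, PowerSeries.coeff_mk, ArithmeticFunction.mul_apply,
    Nat.sum_divisorsAntidiagonal (fun i j => f i * g j), Nat.sum_divisors_prime_pow hp,
    Finset.Nat.sum_antidiagonal_eq_sum_range_succ
      (fun i j => PowerSeries.coeff i (localSeries p f) * PowerSeries.coeff j (localSeries p g))]
  refine Finset.sum_congr rfl fun i hi => ?_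
  rw [localSeries, localSeries, PowerSeries.coeff_mk, PowerSeries.coeff_mk,
    Nat.pow_div (Finset.mem_range_succ_iff.1 hi) hp.pos]

/-- Convolution becomes multiplication of the generating series at p, and each completely
multiplicative factor contributes a geometric series. -/
theorem localSeries_eulerCoeff {l : ℕ} (x : Fin l → Nat.Primes → ℂ) (p : Nat.Primes)
    (S : Finset (Fin l)) :
    localSeries p (eulerCoeff x S) *
      ((∏ j ∈ S, (1 - Polynomial.C (x j p) * Polynomial.X) : Polynomial ℂ) : PowerSeries ℂ) = 1 := by
  classical
  induction S using Finset.induction_on with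
  | empty =>
    ext k
    rcases eq_or_ne k 0 with rfl | hk
    · simp [eulerCoeff, localSeries]
    · simp [eulerCoeff, localSeries, PowerSeries.coeff_one, hk, ArithmeticFunction.one_apply,
        p.2.one_lt.ne']
  | insert j S hj ih =>
    rw [eulerCoeff_insert _ hj, localSeries_mul p.2, Finset.prod_insert hj, Polynomial.coe_mul,
      mul_mul_mul_comm, ih, mul_one]
    ext k
    have hc : ∀ k, PowerSeries.coeff k (localSeries p (cmultArith (x j))) = x j p ^ k := fun k => by
      rw [localSeries, PowerSeries.coeff_mk, cmultArith_apply, map_pow, cmult_prime]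
    rcases k with _ | k
    · rw [PowerSeries.coeff_mul, Finset.Nat.antidiagonal_zero, Finset.sum_singleton, hc]
      simp
    · simp only [Polynomial.coe_sub, Polynomial.coe_one, Polynomial.coe_mul, Polynomial.coe_C,
        Polynomial.coe_X, mul_sub, mul_one, map_sub]
      rw [mul_left_comm, PowerSeries.coeff_C_mul, PowerSeries.coeff_succ_mul_X, hc, hc, pow_succ']
      simp [PowerSeries.coeff_one]

theorem eulerCoeff_apply_one {l : ℕ} (x : Fin l → Nat.Primes → ℂ) (S : Finset (Fin l)) :
    eulerCoeff x S 1 = 1 := by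
  classical
  induction S using Finset.induction_on with
  | empty => simp [eulerCoeff]
  | insert j S hj ih =>
    rw [eulerCoeff_insert _ hj, ArithmeticFunction.mul_apply_one, ih, mul_one]
    exact map_one (cmult (x j))

theorem eulerCoeff_apply_prime {l : ℕ} (x : Fin l → Nat.Primes → ℂ) (p : Nat.Primes)
    (S : Finset (Fin l)) : eulerCoeff x S p = ∑ j ∈ S, x j p := by
  classical
  induction S using Finset.induction_on with
  | empty => simp [eulerCoeff, p.2.one_lt.ne']
  | insert j S hj ih =>
    rw [eulerCoeff_insert _ hj, Finset.sum_insert hj, ArithmeticFunction.mul_apply,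
      Nat.sum_divisorsAntidiagonal
        (fun i k => cmultArith (x j) i * eulerCoeff x S k),
      p.2.sum_divisors, Nat.div_self p.2.pos, Nat.div_one, eulerCoeff_apply_one, ih]
    rw [cmultArith_apply, cmultArith_apply, cmult_prime, map_one]
    ring

theorem tsum_coeff_mul {f g : PowerSeries ℂ} {z : ℂ}
    (hf : Summable fun n => ‖PowerSeries.coeff n f * z ^ n‖)
    (hg : Summable fun n => ‖PowerSeries.coeff n g * z ^ n‖) :
    ∑' n, PowerSeries.coeff n (f * g) * z ^ n =
      (∑' n, PowerSeries.coeff n f * z ^ n) * ∑' n, PowerSeries.coeff n g * z ^ n := by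
  rw [tsum_mul_tsum_eq_tsum_sum_antidiagonal_of_summable_norm hf hg]
  refine tsum_congr fun n => ?_
  rw [PowerSeries.coeff_mul, Finset.sum_mul]
  refine Finset.sum_congr rfl fun q hq => ?_
  rw [← Finset.HasAntidiagonal.mem_antidiagonal.1 hq, pow_add]
  ring

/-- A polynomial has no zero where its inverse power series converges absolutely. -/
theorem not_eval_eq_zero_of_localSeries {f : ℕ → ℂ} {Q : Polynomial ℂ} {z : ℂ}
    (h : PowerSeries.mk f * (Q : PowerSeries ℂ) = 1) (hf : Summable fun n => ‖f n * z ^ n‖)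
    (hz : Q.eval z = 0) : False := by
  have hQ : ∀ n ∉ Finset.range (Q.natDegree + 1),
      PowerSeries.coeff n (Q : PowerSeries ℂ) * z ^ n = 0 := by
    intro n hn
    rw [Polynomial.coeff_coe, Polynomial.coeff_eq_zero_of_natDegree_lt (by
      rw [Finset.mem_range] at hn; omega), zero_mul]
  have h1 := tsum_coeff_mul (f := PowerSeries.mk f) (g := (Q : PowerSeries ℂ)) (z := z)
    (by simpa using hf)
    (summable_of_ne_finset_zero (s := Finset.range (Q.natDegree + 1)) fun n hn => by
      rw [hQ n hn, norm_zero])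
  rw [h, tsum_eq_sum (s := Finset.range (Q.natDegree + 1)) hQ] at h1
  simp only [Polynomial.coeff_coe] at h1
  rw [← Polynomial.eval_eq_sum_range, hz, mul_zero, tsum_eq_single 0] at h1
  · simp at h1
  · intro n hn
    simp [PowerSeries.coeff_one, hn]

/-- If |z| > p, then s = log z / log p has real part above 1 and p^s = z. -/
theorem norm_le_of_forall_ne_zero {p : ℕ} (hp : p.Prime) {z : ℂ}
    (h : ∀ s : ℂ, 1 < s.re → 1 - z / (p : ℂ) ^ s ≠ 0) : ‖z‖ ≤ p := by
  by_contra! hz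
  have hp1 : (1 : ℝ) < p := by exact_mod_cast hp.one_lt
  have hlp : 0 < Real.log p := Real.log_pos hp1
  have hz0 : z ≠ 0 := norm_pos_iff.1 (by linarith)
  have hp0 : (p : ℂ) ≠ 0 := by exact_mod_cast hp.ne_zero
  have hlog : Complex.log (p : ℂ) = (Real.log p : ℝ) := by
    rw [Complex.ofReal_log (by linarith)]; simp
  refine h (Complex.log z / (Real.log p : ℝ)) ?_ ?_
  · rw [Complex.div_ofReal_re, Complex.log_re, one_lt_div hlp]
    exact Real.log_lt_log (by linarith) hz
  · have h0 : ((Real.log p : ℝ) : ℂ) ≠ 0 := by exact_mod_cast hlp.ne'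
    rw [Complex.cpow_def_of_ne_zero hp0, hlog, mul_div_cancel₀ _ h0, Complex.exp_log hz0,
      div_self hz0, sub_self]

/-- The bound a(m) = O(m^ε) is used with ε such that p^ε |z| = |z|^{1/2}, giving a geometric
majorant. -/
theorem summable_prime_pow_mul {a : ℕ → ℂ}
    (ha : ∀ ε : ℝ, 0 < ε → a =O[atTop] fun m : ℕ => (m : ℝ) ^ ε) {p : ℕ} (hp : p.Prime) {z : ℂ}
    (hz0 : z ≠ 0) (hz : ‖z‖ < 1) : Summable fun n => ‖a (p ^ n) * z ^ n‖ := by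
  have hp1 : (1 : ℝ) < p := by exact_mod_cast hp.one_lt
  have hlp : 0 < Real.log p := Real.log_pos hp1
  have hzn : 0 < ‖z‖ := norm_pos_iff.2 hz0
  have hlz : Real.log ‖z‖ < 0 := Real.log_neg hzn hz
  set ε : ℝ := -Real.log ‖z‖ / (2 * Real.log p) with hε
  have hε0 : 0 < ε := div_pos (by linarith) (by linarith)
  set r : ℝ := (p : ℝ) ^ ε * ‖z‖ with hr
  have hr1 : r < 1 := by
    rw [hr, Real.rpow_def_of_pos (by linarith), ← Real.exp_log hzn, ← Real.exp_add,
      Real.exp_lt_one_iff]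
    have : Real.log p * ε = -Real.log ‖z‖ / 2 := by rw [hε]; field_simp
    rw [this]; linarith
  have hr0 : 0 ≤ r := by positivity
  have hpow : Tendsto (fun n : ℕ => p ^ n) atTop atTop := tendsto_pow_atTop_atTop_of_one_lt hp.one_lt
  have h1 := ((ha ε hε0).comp_tendsto hpow).norm_left
  refine summable_of_isBigO_nat (summable_geometric_of_lt_one hr0 hr1) ?_
  have h2 := h1.mul (Asymptotics.isBigO_refl (fun n : ℕ => ‖z‖ ^ n) atTop)
  refine h2.congr (fun n => ?_) fun n => ?_
  · simp
  · simp only [Function.comp_apply]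
    rw [hr, mul_pow, Nat.cast_pow, ← Real.rpow_natCast, ← Real.rpow_mul (by positivity),
      mul_comm (n : ℝ), Real.rpow_mul (by positivity), Real.rpow_natCast]

/-- The Euler product determines the Dirichlet coefficients, and its parameters lie in the unit
disc. -/
theorem IsSteuding.exists_eulerCoeff {φ : ℂ → ℂ} {a : ℕ → ℂ} (h : IsSteuding φ a) :
    ∃ (l : ℕ) (A : Fin l → Nat.Primes → ℂ), (∀ j p, ‖A j p‖ ≤ 1) ∧
      ∀ m ≠ 0, a m = eulerCoeff A Finset.univ m := by
  obtain ⟨l, A, hA⟩ := h.euler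
  have hAp : ∀ j (p : Nat.Primes), ‖A j p‖ ≤ (p : ℕ) := fun j p =>
    norm_le_of_forall_ne_zero p.2 fun s hs => (hA s hs).1 j p
  -- Agreement of the two Dirichlet series for large real arguments determines the coefficients, so
  -- this smaller half-plane is enough.
  have hsum : ∀ s : ℂ, 2 < s.re → ∀ j, LSeriesSummable (cmult (A j)) s := fun s hs j =>
    LSeriesSummable_of_le_const_mul_rpow hs ⟨1, fun n _ => by
      norm_num
      exact norm_cmult_le (hAp j) n⟩
  have heq : ∀ m ≠ 0, a m = eulerCoeff A Finset.univ m := by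
    intro m hm
    have h3 : (2 : ℝ) < ((3 : ℝ) : ℂ).re := by norm_num
    refine LSeries.eq_of_LSeries_eventually_eq
      ((LSeriesSummable.abscissaOfAbsConv_le (s := ((3 : ℝ) : ℂ))
        (h.dirichlet _ (by linarith)).LSeriesSummable).trans_lt (EReal.coe_lt_top _))
      ((LSeriesSummable.abscissaOfAbsConv_le
        (eulerCoeff_hasProd (by norm_num) (hsum _ h3) _).1).trans_lt (EReal.coe_lt_top _)) ?_ hm
    filter_upwards [eventually_gt_atTop (2 : ℝ)] with x hx
    have hx' : 2 < (x : ℂ).re := by simpa using hx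
    have hx1 : 1 < (x : ℂ).re := by linarith
    rw [(h.dirichlet x hx1).LSeries_eq]
    refine (hA x hx1).2.unique (eulerCoeff_hasProd ?_ (hsum x hx') _).2
    exact_mod_cast (by linarith : (0 : ℝ) < x).ne'
  refine ⟨l, A, fun j p => ?_, heq⟩
  -- A parameter of modulus above 1 would put a zero of the local polynomial inside the unit disc,
  -- where its inverse power series converges by the growth of a.
  by_contra! hj
  have hA0 : A j p ≠ 0 := norm_pos_iff.1 (by linarith)
  have hz : ‖(A j p)⁻¹‖ < 1 := by rw [norm_inv]; exact inv_lt_one_of_one_lt₀ hj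
  have hs := summable_prime_pow_mul h.coeff_isBigO p.2 (inv_ne_zero hA0) hz
  have hloc := localSeries_eulerCoeff A p Finset.univ
  refine not_eval_eq_zero_of_localSeries (z := (A j p)⁻¹) hloc ?_ ?_
  · refine hs.congr fun n => ?_
    rw [heq _ (pow_ne_zero _ p.2.ne_zero)]
  · rw [Polynomial.eval_prod]
    refine Finset.prod_eq_zero (Finset.mem_univ j) ?_
    simp [hA0]

theorem hasProd_twist {a : ℕ → ℂ} {l : ℕ} {A : Fin l → Nat.Primes → ℂ} (hA : ∀ j p, ‖A j p‖ ≤ 1)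
    (ha : ∀ m ≠ 0, a m = eulerCoeff A Finset.univ m) (ω : Ω₁) {s : ℂ} (hs : 1 < s.re) :
    LSeriesSummable (fun k => a k * multExt ω k) s ∧
    HasProd (fun p : Nat.Primes => ∏ j, (1 - A j p * ω p / (p : ℂ) ^ s)⁻¹)
      (LSeries (fun k => a k * multExt ω k) s) := by
  have hs0 : s ≠ 0 := by rintro rfl; norm_num at hs
  have hcoef : ∀ {k : ℕ}, k ≠ 0 → a k * multExt ω k =
      eulerCoeff (fun j p => A j p * ω p) Finset.univ k := by
    intro k hk
    rw [eulerCoeff_twist, ha k hk, multExt_eq_cmult ω hk]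
  have hsum : ∀ j, LSeriesSummable (cmult fun p => A j p * ω p) s := fun j =>
    LSeriesSummable_of_le_const_mul_rpow hs ⟨1, fun n _ => by
      norm_num
      exact norm_cmult_le_one (fun p => by
        rw [norm_mul, Circle.norm_coe, mul_one]; exact hA j p) n⟩
  have h1 := eulerCoeff_hasProd hs0 hsum Finset.univ
  rw [LSeries_congr hcoef, LSeriesSummable_congr s hcoef]
  exact h1

/-! ### Almost sure convergence of the random Dirichlet series -/

/-- Countably many abscissae decreasing to σ₁ exhaust the half-plane, so that later the exceptional
null sets can be united. -/
theorem exists_tendstoLocallyUniformlyOn_of_forall_gt {α : ℝ} (hα : 0 < α) (c : ℕ → ℂ) (σ₁ : ℝ)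
    (h : ∀ k : ℕ, ∃ L, Tendsto (fun n => ∑ m ∈ Finset.range n,
      c m / ((m : ℂ) + α) ^ ((σ₁ + 1 / ((k : ℝ) + 1) : ℝ) : ℂ)) atTop (𝓝 L)) :
    ∃ f : ℂ → ℂ, DifferentiableOn ℂ f {s | σ₁ < s.re} ∧
      TendstoLocallyUniformlyOn (fun n s => ∑ m ∈ Finset.range n, c m / ((m : ℂ) + α) ^ s) f atTop
        {s | σ₁ < s.re} := by
  choose F hF hFt using fun k => exists_tendstoLocallyUniformlyOn_dirichlet hα c _ (h k)
  have hU : {s : ℂ | σ₁ < s.re} = ⋃ k : ℕ, {s : ℂ | σ₁ + 1 / ((k : ℝ) + 1) < s.re} := by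
    ext s
    simp only [Set.mem_ofPred_eq, Set.mem_iUnion]
    constructor
    · intro hs
      obtain ⟨k, hk⟩ := exists_nat_one_div_lt (sub_pos.2 hs)
      exact ⟨k, by linarith⟩
    · rintro ⟨k, hk⟩
      have : 0 < 1 / ((k : ℝ) + 1) := by positivity
      linarith
  have ho : ∀ k : ℕ, IsOpen {s : ℂ | σ₁ + 1 / ((k : ℝ) + 1) < s.re} := fun k =>
    isOpen_lt continuous_const Complex.continuous_re
  set f : ℂ → ℂ := fun s => limUnder atTop fun n => ∑ m ∈ Finset.range n, c m / ((m : ℂ) + α) ^ s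
    with hf
  have hlim : TendstoLocallyUniformlyOn
      (fun n s => ∑ m ∈ Finset.range n, c m / ((m : ℂ) + α) ^ s) f atTop {s | σ₁ < s.re} := by
    rw [hU]
    refine tendstoLocallyUniformlyOn_iUnion ho fun k => ?_
    refine (hFt k).congr_right fun s hs => ?_
    exact ((hFt k).tendsto_at hs).limUnder_eq.symm
  refine ⟨f, hlim.differentiableOn (Eventually.of_forall fun n => ?_)
    (isOpen_lt continuous_const Complex.continuous_re), hlim⟩
  refine DifferentiableOn.fun_sum fun m _ => ?_
  refine DifferentiableOn.div (differentiableOn_const _) ?_ ?_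
  · intro s _
    exact (DifferentiableAt.const_cpow differentiableAt_id
      (Or.inl (natCast_add_ne_zero hα m))).differentiableWithinAt
  · intro s _
    rw [Complex.cpow_def_of_ne_zero (natCast_add_ne_zero hα m)]
    exact Complex.exp_ne_zero _

theorem ae_exists_tendstoLocallyUniformlyOn {Ω : Type*} [MeasurableSpace Ω] {μ : Measure Ω}
    [IsProbabilityMeasure μ] {χ : ℕ → Ω → Circle} (hχ : ∀ m, Measurable (χ m))
    (horth : ∀ m n, m ≠ n → ∫ ω, (χ m ω : ℂ) * starRingEnd ℂ (χ n ω) ∂μ = 0)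
    {α : ℝ} (hα : 0 < α) {c : ℕ → ℂ}
    (hc : ∀ ε : ℝ, 0 < ε → ∃ C : ℝ, ∀ m : ℕ, ‖c m‖ ≤ C * ((m : ℝ) + 1) ^ ε) :
    ∀ᵐ ω ∂μ, ∃ f : ℂ → ℂ, DifferentiableOn ℂ f {s | 1 / 2 < s.re} ∧
      TendstoLocallyUniformlyOn (fun n s => ∑ m ∈ Finset.range n, c m * χ m ω / ((m : ℂ) + α) ^ s)
        f atTop {s | 1 / 2 < s.re} := by
  have key : ∀ k : ℕ, ∀ᵐ ω ∂μ, ∃ L, Tendsto (fun n => ∑ m ∈ Finset.range n,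
      c m * χ m ω / ((m : ℂ) + α) ^ ((1 / 2 + 1 / ((k : ℝ) + 1) : ℝ) : ℂ)) atTop (𝓝 L) := by
    intro k
    set η : ℝ := 1 / ((k : ℝ) + 1) with hη
    have hη0 : 0 < η := by positivity
    -- At abscissa 1/2 + η the squared terms are of order n^{-(1+2η)} n^{η}, leaving the exponent
    -- -(1+η) needed for almost sure convergence.
    obtain ⟨C, hC⟩ := hc (η / 2) (half_pos hη0)
    have hC0 : 0 ≤ C := by
      have := (norm_nonneg _).trans (hC 0)
      simpa using this
    set β : ℝ := min α 1 with hβ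
    have hβ0 : 0 < β := lt_min hα one_pos
    refine ae_tendsto_sum_of_orthogonal (C := C ^ 2 * β ^ (-(1 + 2 * η))) (δ := η) ?_ hη0
      (by positivity) ?_ ?_
    · intro n
      have hcoe : Continuous fun z : Circle => (z : ℂ) := by fun_prop
      have : Measurable fun ω => (χ n ω : ℂ) := hcoe.measurable.comp (hχ n)
      fun_prop
    · intro n ω
      rw [norm_div, norm_mul, Circle.norm_coe, mul_one, norm_natCast_add_cpow hα, Complex.ofReal_re,
        div_pow]
      have hn : (0 : ℝ) < n + 1 := by positivity
      have hna : (0 : ℝ) < n + α := by positivity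
      have h1 : β * ((n : ℝ) + 1) ≤ n + α := by
        have h2 : β ≤ 1 := min_le_right _ _
        have h3 : β ≤ α := min_le_left _ _
        have h4 : β * n ≤ n := mul_le_of_le_one_left (by positivity) h2
        linarith
      rw [div_eq_mul_inv, ← Real.rpow_natCast (((n : ℝ) + α) ^ _), ← Real.rpow_mul hna.le,
        ← Real.rpow_neg hna.le]
      have h5 : ((n : ℝ) + α) ^ (-((1 / 2 + η) * ((2 : ℕ) : ℝ))) ≤
          (β * ((n : ℝ) + 1)) ^ (-(1 + 2 * η)) := by
        have : -((1 / 2 + η) * ((2 : ℕ) : ℝ)) = -(1 + 2 * η) := by push_cast; ring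
        rw [this]
        exact Real.rpow_le_rpow_of_nonpos (by positivity) h1 (by linarith)
      have h6 : ‖c n‖ ^ 2 ≤ C ^ 2 * ((n : ℝ) + 1) ^ η := by
        refine (pow_le_pow_left₀ (norm_nonneg _) (hC n) 2).trans (le_of_eq ?_)
        rw [mul_pow, ← Real.rpow_natCast (((n : ℝ) + 1) ^ _), ← Real.rpow_mul hn.le]
        congr 2
        push_cast; ring
      refine (mul_le_mul h6 h5 (by positivity) (by positivity)).trans (le_of_eq ?_)
      rw [Real.mul_rpow hβ0.le hn.le]
      have h7 : ((n : ℝ) + 1) ^ η * ((n : ℝ) + 1) ^ (-(1 + 2 * η)) =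
          ((n : ℝ) + 1) ^ (-(1 + η)) := by
        rw [← Real.rpow_add hn]; congr 1; ring
      rw [← h7]; ring
    · intro m n hmn
      set u : ℂ := c m / ((m : ℂ) + α) ^ ((1 / 2 + η : ℝ) : ℂ) with hu
      set v : ℂ := c n / ((n : ℂ) + α) ^ ((1 / 2 + η : ℝ) : ℂ) with hv
      have h1 : ∀ ω, c m * χ m ω / ((m : ℂ) + α) ^ ((1 / 2 + η : ℝ) : ℂ) *
          starRingEnd ℂ (c n * χ n ω / ((n : ℂ) + α) ^ ((1 / 2 + η : ℝ) : ℂ)) =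
          (u * starRingEnd ℂ v) * ((χ m ω : ℂ) * starRingEnd ℂ (χ n ω)) := by
        intro ω
        rw [hu, hv]
        simp only [map_div₀, map_mul]
        ring
      simp only [h1]
      rw [integral_const_mul, horth m n hmn, mul_zero]
  filter_upwards [ae_all_iff.2 key] with ω hω
  exact exists_tendstoLocallyUniformlyOn_of_forall_gt hα (fun m => c m * χ m ω) (1 / 2) hω

/-! ### Orthogonality of characters -/

instance {G : Type*} [Group G] [TopologicalSpace G] [IsTopologicalGroup G] [CompactSpace G]
    [MeasurableSpace G] [BorelSpace G] : IsProbabilityMeasure (Measure.haarMeasure (⊤ : PositiveCompacts G)) :=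
  ⟨by simpa using Measure.haarMeasure_self (K₀ := (⊤ : PositiveCompacts G))⟩

/-- Translation by τ preserves the integral and also multiplies it by z ≠ 1. -/
theorem integral_eq_zero_of_mul_left {G : Type*} [Group G] [MeasurableSpace G] [MeasurableMul G]
    {μ : Measure G} [μ.IsMulLeftInvariant] {f : G → ℂ} (τ : G)
    {z : ℂ} (hz : z ≠ 1) (h : ∀ ω, f (τ * ω) = z * f ω) : ∫ ω, f ω ∂μ = 0 := by
  have h1 := integral_mul_left_eq_self (μ := μ) f τ
  simp only [h] at h1
  rw [integral_const_mul] at h1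
  have h2 : (z - 1) * ∫ ω, f ω ∂μ = 0 := by rw [sub_mul, h1]; ring
  exact (mul_eq_zero.1 h2).resolve_left (sub_ne_zero.2 hz)

theorem multExt_mul (τ ω : Ω₁) (m : ℕ) : multExt (τ * ω) m = multExt τ m * multExt ω m := by
  rw [multExt, multExt, multExt, ← Finset.prod_mul_distrib]
  exact Finset.prod_congr rfl fun p _ => mul_pow _ _ _

theorem continuous_multExt (m : ℕ) : Continuous fun ω : Ω₁ => multExt ω m := by
  unfold multExt
  fun_prop

theorem multExt_exp_log (t : ℝ) {m : ℕ} (hm : m ≠ 0) :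
    (multExt (fun p => Circle.exp (t * Real.log (p : ℕ))) m : ℂ) =
      Circle.exp (t * Real.log m) := by
  rw [multExt_eq_cmult _ hm]
  induction m using induction_on_primes with
  | zero => exact absurd rfl hm
  | one => simp
  | prime_mul p a hp ih =>
    have ha : a ≠ 0 := right_ne_zero_of_mul hm
    have h : cmult (fun p : Nat.Primes => (Circle.exp (t * Real.log (p : ℕ)) : ℂ)) p =
        Circle.exp (t * Real.log p) := cmult_prime _ ⟨p, hp⟩
    rw [map_mul, ih ha, h, ← Circle.coe_mul, ← Circle.exp_add, Nat.cast_mul,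
      Real.log_mul (by exact_mod_cast hp.ne_zero) (by exact_mod_cast ha)]
    congr 2
    ring

/-- Translating by the point p ↦ p^{it} multiplies the integrand by (m/n)^{it}, and t is chosen to
make this -1. -/
theorem integral_multExt_mul_conj {m n : ℕ} (hm : m ≠ 0) (hn : n ≠ 0) (hmn : m ≠ n) :
    ∫ ω, (multExt ω m : ℂ) * starRingEnd ℂ (multExt ω n)
      ∂(Measure.haarMeasure (⊤ : PositiveCompacts Ω₁)) = 0 := by
  have hlog : Real.log m - Real.log n ≠ 0 := by
    rw [sub_ne_zero]
    intro h
    have hm' : (m : ℝ) ∈ Set.Ioi 0 := Set.mem_Ioi.2 (Nat.cast_pos.2 (Nat.pos_of_ne_zero hm))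
    have hn' : (n : ℝ) ∈ Set.Ioi 0 := Set.mem_Ioi.2 (Nat.cast_pos.2 (Nat.pos_of_ne_zero hn))
    exact hmn (by exact_mod_cast Real.log_injOn_pos hm' hn' h)
  set t : ℝ := π / (Real.log m - Real.log n) with ht
  set τ : Ω₁ := fun p => Circle.exp (t * Real.log (p : ℕ)) with hτ
  refine integral_eq_zero_of_mul_left τ (z := -1) (by norm_num) fun ω => ?_
  rw [multExt_mul, multExt_mul, Circle.coe_mul, Circle.coe_mul, map_mul, multExt_exp_log t hm,
    multExt_exp_log t hn]
  have h1 : (Circle.exp (t * Real.log m) : ℂ) * starRingEnd ℂ (Circle.exp (t * Real.log n) : ℂ) =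
      -1 := by
    rw [← Circle.coe_inv_eq_conj, ← Circle.coe_mul, ← Circle.exp_neg, ← Circle.exp_add]
    have : t * Real.log m + -(t * Real.log n) = π := by
      rw [ht]; field_simp; ring
    rw [this]; simp
  linear_combination ((multExt ω m : ℂ) * starRingEnd ℂ (multExt ω n)) * h1

theorem integral_coord_mul_conj {m n : ℕ} (hmn : m ≠ n) :
    ∫ ω : Ω₂, (ω m : ℂ) * starRingEnd ℂ (ω n)
      ∂(Measure.haarMeasure (⊤ : PositiveCompacts Ω₂)) = 0 := by
  refine integral_eq_zero_of_mul_left (Function.update 1 m (Circle.exp π)) (z := -1) (by norm_num)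
    fun ω => ?_
  simp [Function.update_of_ne hmn.symm]

/-! ### The logarithm of the random Euler product -/

/-- The logarithm of the local factor at the prime `m + 1` of the random Euler product. -/
def eulerLog {l : ℕ} (A : Fin l → Nat.Primes → ℂ) (m : ℕ) (ω : Ω₁) (s : ℂ) : ℂ :=
  if h : (m + 1).Prime then
    ∑ j, -Complex.log (1 - A j ⟨m + 1, h⟩ * ω ⟨m + 1, h⟩ / ((m + 1 : ℕ) : ℂ) ^ s) else 0

/-- The coefficients of the Dirichlet series over the primes, shifted by one. -/
def primeCoeff (a : ℕ → ℂ) (m : ℕ) : ℂ := if (m + 1).Prime then a (m + 1) else 0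

theorem norm_div_natCast_cpow_le {z : ℂ} (hz : ‖z‖ ≤ 1) (m : ℕ) (s : ℂ) :
    ‖z / ((m + 1 : ℕ) : ℂ) ^ s‖ ≤ ((m : ℝ) + 1) ^ (-s.re) := by
  rw [norm_div, Complex.norm_natCast_cpow_of_pos m.succ_pos, Real.rpow_neg (by positivity),
    div_eq_mul_inv]
  push_cast
  exact mul_le_of_le_one_left (by positivity) hz

/-- Already 2^{-1/2} < 3/4, which keeps 1 - A_j(p)ω(p)p^{-s} away from the cut of the logarithm for
every prime. -/
theorem rpow_neg_le_of_half_le {m : ℕ} (hm : 1 ≤ m) {σ : ℝ} (hσ : 1 / 2 ≤ σ) :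
    ((m : ℝ) + 1) ^ (-σ) ≤ 3 / 4 := by
  have h1 : (2 : ℝ) ≤ (m : ℝ) + 1 := by
    have : (1 : ℝ) ≤ m := by exact_mod_cast hm
    linarith
  calc ((m : ℝ) + 1) ^ (-σ) ≤ ((m : ℝ) + 1) ^ (-(1 / 2) : ℝ) :=
        Real.rpow_le_rpow_of_exponent_le (by linarith) (by linarith)
    _ ≤ (2 : ℝ) ^ (-(1 / 2) : ℝ) := Real.rpow_le_rpow_of_nonpos (by norm_num) h1 (by norm_num)
    _ ≤ 3 / 4 := by
        rw [Real.rpow_neg (by norm_num), ← Real.sqrt_eq_rpow]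
        rw [inv_le_comm₀ (by positivity) (by norm_num)]
        apply Real.le_sqrt_of_sq_le
        norm_num

theorem norm_log_one_sub_add_le {z : ℂ} (hz : ‖z‖ ≤ 3 / 4) :
    ‖-Complex.log (1 - z) - z‖ ≤ 2 * ‖z‖ ^ 2 := by
  have h1 := Complex.norm_log_one_add_sub_self_le (z := -z) (by rw [norm_neg]; linarith)
  rw [norm_neg] at h1
  have h2 : ‖-Complex.log (1 - z) - z‖ = ‖Complex.log (1 + -z) - -z‖ := by
    rw [← norm_neg]; congr 1; rw [← sub_eq_add_neg]; ring
  rw [h2]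
  refine h1.trans ?_
  have h3 : (1 - ‖z‖)⁻¹ ≤ 4 := by
    rw [inv_le_comm₀ (by linarith) (by norm_num)]; linarith
  have h4 := mul_le_mul_of_nonneg_left h3 (sq_nonneg ‖z‖)
  linarith

section

variable {l : ℕ} {A : Fin l → Nat.Primes → ℂ}

theorem norm_local_le (hA : ∀ j p, ‖A j p‖ ≤ 1) (j : Fin l) {m : ℕ} (h : (m + 1).Prime) (ω : Ω₁)
    (s : ℂ) : ‖A j ⟨m + 1, h⟩ * ω ⟨m + 1, h⟩ / ((m + 1 : ℕ) : ℂ) ^ s‖ ≤ ((m : ℝ) + 1) ^ (-s.re) :=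
  norm_div_natCast_cpow_le (by
    rw [norm_mul, Circle.norm_coe, mul_one]; exact hA j ⟨m + 1, h⟩) m s

theorem norm_local_le_of_half_le (hA : ∀ j p, ‖A j p‖ ≤ 1) (j : Fin l) {m : ℕ}
    (h : (m + 1).Prime) (ω : Ω₁) {s : ℂ} (hs : 1 / 2 ≤ s.re) :
    ‖A j ⟨m + 1, h⟩ * ω ⟨m + 1, h⟩ / ((m + 1 : ℕ) : ℂ) ^ s‖ ≤ 3 / 4 :=
  (norm_local_le hA j h ω s).trans (rpow_neg_le_of_half_le (by have := h.two_le; omega) hs)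

theorem mem_slitPlane_local (hA : ∀ j p, ‖A j p‖ ≤ 1) (j : Fin l) {m : ℕ}
    (h : (m + 1).Prime) (ω : Ω₁) {s : ℂ} (hs : 1 / 2 ≤ s.re) :
    1 - A j ⟨m + 1, h⟩ * ω ⟨m + 1, h⟩ / ((m + 1 : ℕ) : ℂ) ^ s ∈ Complex.slitPlane := by
  have h1 := norm_local_le_of_half_le hA j h ω hs
  rw [sub_eq_add_neg]
  exact Complex.mem_slitPlane_of_norm_lt_one (by rw [norm_neg]; linarith)

theorem differentiableOn_eulerLog (hA : ∀ j p, ‖A j p‖ ≤ 1) (m : ℕ) (ω : Ω₁) :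
    DifferentiableOn ℂ (eulerLog A m ω) {s | 1 / 2 < s.re} := by
  intro s hs
  unfold eulerLog
  split_ifs with h
  · have h0 : ((m + 1 : ℕ) : ℂ) ≠ 0 := by exact_mod_cast m.succ_ne_zero
    refine DifferentiableAt.differentiableWithinAt (DifferentiableAt.fun_sum fun j _ => ?_)
    refine DifferentiableAt.fun_neg (DifferentiableAt.clog (f := fun s => 1 - A j ⟨m + 1, h⟩ *
      ω ⟨m + 1, h⟩ / ((m + 1 : ℕ) : ℂ) ^ s) ?_ (mem_slitPlane_local hA j h ω (le_of_lt hs)))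
    refine (differentiableAt_const _).sub ((differentiableAt_const _).div
      (differentiableAt_id.const_cpow (Or.inl h0)) ?_)
    rw [Complex.cpow_def_of_ne_zero h0]
    exact Complex.exp_ne_zero _
  · exact differentiableWithinAt_const _

theorem continuousOn_eulerLog (hA : ∀ j p, ‖A j p‖ ≤ 1) (m : ℕ) :
    ContinuousOn (fun q : Ω₁ × ℂ => eulerLog A m q.1 q.2) (Set.univ ×ˢ {s | 1 / 2 < s.re}) := by
  unfold eulerLog
  split_ifs with h
  · have h0 : ((m + 1 : ℕ) : ℂ) ≠ 0 := by exact_mod_cast m.succ_ne_zero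
    refine continuousOn_finsetSum _ fun j _ => ContinuousOn.neg (ContinuousOn.clog ?_ ?_)
    · simp only [Complex.cpow_def_of_ne_zero h0]
      refine continuousOn_const.sub (ContinuousOn.div ?_ (by fun_prop)
        fun _ _ => Complex.exp_ne_zero _)
      have : Continuous fun q : Ω₁ × ℂ => ((q.1 ⟨m + 1, h⟩ : Circle) : ℂ) := by
        have h1 : Continuous fun z : Circle => (z : ℂ) := by fun_prop
        exact h1.comp ((continuous_apply _).comp continuous_fst)
      exact (continuous_const.mul this).continuousOn
    · rintro ⟨ω, s⟩ ⟨-, hs⟩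
      exact mem_slitPlane_local hA j h ω (le_of_lt hs)
  · exact continuousOn_const

theorem exp_eulerLog (hA : ∀ j p, ‖A j p‖ ≤ 1) (m : ℕ) (ω : Ω₁) {s : ℂ} (hs : 1 / 2 ≤ s.re) :
    Complex.exp (eulerLog A m ω s) =
      if h : (m + 1).Prime then
        ∏ j, (1 - A j ⟨m + 1, h⟩ * ω ⟨m + 1, h⟩ / ((m + 1 : ℕ) : ℂ) ^ s)⁻¹ else 1 := by
  unfold eulerLog
  split_ifs with h
  · rw [Complex.exp_sum]
    refine Finset.prod_congr rfl fun j _ => ?_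
    rw [Complex.exp_neg, Complex.exp_log
      (Complex.slitPlane_ne_zero (mem_slitPlane_local hA j h ω hs))]
  · exact Complex.exp_zero

/-- Since a(p) is the sum of the A_j(p), it is the linear coefficient of the local logarithm. The
remainder is quadratic, hence summable for Re s > 1/2, uniformly in ω. -/
theorem norm_eulerLog_sub_le (hA : ∀ j p, ‖A j p‖ ≤ 1) {a : ℕ → ℂ}
    (ha : ∀ m ≠ 0, a m = eulerCoeff A Finset.univ m) (m : ℕ) (ω : Ω₁) {s : ℂ}
    (hs : 1 / 2 ≤ s.re) :
    ‖eulerLog A m ω s - primeCoeff a m * multExt ω (m + 1) / ((m + 1 : ℕ) : ℂ) ^ s‖ ≤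
      2 * l * ((m : ℝ) + 1) ^ (-(2 * s.re)) := by
  unfold eulerLog primeCoeff
  split_ifs with h
  · have h1 : a (m + 1) = ∑ j, A j ⟨m + 1, h⟩ :=
      (ha _ m.succ_ne_zero).trans (eulerCoeff_apply_prime A ⟨m + 1, h⟩ Finset.univ)
    have h2 : (multExt ω (m + 1) : ℂ) = ω ⟨m + 1, h⟩ :=
      (multExt_eq_cmult ω m.succ_ne_zero).trans (cmult_prime _ ⟨m + 1, h⟩)
    rw [h1, h2, Finset.sum_mul, Finset.sum_div, ← Finset.sum_sub_distrib]
    refine (norm_sum_le _ _).trans ?_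
    have h3 : ∀ j ∈ Finset.univ, ‖-Complex.log (1 - A j ⟨m + 1, h⟩ * ω ⟨m + 1, h⟩ /
        ((m + 1 : ℕ) : ℂ) ^ s) - A j ⟨m + 1, h⟩ * ω ⟨m + 1, h⟩ / ((m + 1 : ℕ) : ℂ) ^ s‖ ≤
        2 * ((m : ℝ) + 1) ^ (-(2 * s.re)) := by
      intro j _
      refine (norm_log_one_sub_add_le (norm_local_le_of_half_le hA j h ω hs)).trans ?_
      refine mul_le_mul_of_nonneg_left ?_ zero_le_two
      refine (pow_le_pow_left₀ (norm_nonneg _) (norm_local_le hA j h ω s) 2).trans (le_of_eq ?_)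
      rw [← Real.rpow_natCast, ← Real.rpow_mul (by positivity)]
      congr 1
      push_cast; ring
    refine (Finset.sum_le_sum h3).trans (le_of_eq ?_)
    simp; ring
  · simp only [zero_mul, zero_div, sub_zero, norm_zero]
    positivity

theorem summable_rpow_neg {σ : ℝ} (hσ : 1 / 2 < σ) (C : ℝ) :
    Summable fun m : ℕ => C * ((m : ℝ) + 1) ^ (-(2 * σ)) := by
  refine Summable.mul_left _ ?_
  have := (Real.summable_one_div_nat_add_rpow 1 (2 * σ)).2 (by linarith)
  refine this.congr fun m => ?_
  rw [abs_of_pos (by positivity), Real.rpow_neg (by positivity), one_div]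

theorem tendstoLocallyUniformlyOn_remainder (hA : ∀ j p, ‖A j p‖ ≤ 1) {a : ℕ → ℂ}
    (ha : ∀ m ≠ 0, a m = eulerCoeff A Finset.univ m) (ω : Ω₁) :
    TendstoLocallyUniformlyOn (fun n s => ∑ m ∈ Finset.range n,
        (eulerLog A m ω s - primeCoeff a m * multExt ω (m + 1) / ((m + 1 : ℕ) : ℂ) ^ s))
      (fun s => ∑' m, (eulerLog A m ω s -
        primeCoeff a m * multExt ω (m + 1) / ((m + 1 : ℕ) : ℂ) ^ s)) atTop {s | 1 / 2 < s.re} := by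
  rw [tendstoLocallyUniformlyOn_iff_forall_isCompact
    (isOpen_lt continuous_const Complex.continuous_re)]
  intro K hK hKc
  rcases K.eq_empty_or_nonempty with rfl | hne
  · exact tendstoUniformlyOn_empty
  obtain ⟨z, hz, hzm⟩ := hKc.exists_isMinOn hne Complex.continuous_re.continuousOn
  have hz1 : 1 / 2 < z.re := hK hz
  refine tendstoUniformlyOn_tsum_nat (summable_rpow_neg hz1 (2 * l)) fun m s hs => ?_
  have hs1 : z.re ≤ s.re := hzm hs
  refine (norm_eulerLog_sub_le hA ha m ω (by linarith)).trans ?_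
  refine mul_le_mul_of_nonneg_left ?_ (by positivity)
  exact Real.rpow_le_rpow_of_exponent_le (by linarith [(Nat.cast_nonneg m : (0 : ℝ) ≤ m)])
    (by linarith)

theorem tendsto_prod_local (hA : ∀ j p, ‖A j p‖ ≤ 1) {a : ℕ → ℂ}
    (ha : ∀ m ≠ 0, a m = eulerCoeff A Finset.univ m) (ω : Ω₁) {s : ℂ} (hs : 1 < s.re) :
    Tendsto (fun n => Complex.exp (∑ m ∈ Finset.range n, eulerLog A m ω s)) atTop
      (𝓝 (LSeries (fun k => a k * multExt ω k) s)) := by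
  have h1 := (hasProd_twist hA ha ω hs).2
  set g : ℕ → ℂ := fun n => if h : n.Prime then
    ∏ j, (1 - A j ⟨n, h⟩ * ω ⟨n, h⟩ / (n : ℂ) ^ s)⁻¹ else 1 with hg
  have hinj : Function.Injective fun p : Nat.Primes => (p : ℕ) := Nat.Primes.coe_nat_injective
  have h2 : HasProd g (LSeries (fun k => a k * multExt ω k) s) := by
    refine (hinj.hasProd_iff fun n hn => ?_).1 ?_
    · have hn' : ¬n.Prime := fun h => hn ⟨⟨n, h⟩, rfl⟩
      simp [hg, hn']
    · refine h1.congr_fun fun p => ?_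
      simp only [hg, Function.comp_apply]
      exact dif_pos p.2
  have h4 := (tendsto_add_atTop_iff_nat 1).2 h2.tendsto_prod_nat
  refine h4.congr fun n => ?_
  rw [Finset.prod_range_succ', Complex.exp_sum]
  have h0 : g 0 = 1 := by simp [hg, Nat.not_prime_zero]
  rw [h0, mul_one]
  refine Finset.prod_congr rfl fun m _ => ?_
  rw [exp_eulerLog hA m ω (by linarith)]

end

theorem phiPartial_eq_sum_range (a : ℕ → ℂ) (ω : Ω₁) (n : ℕ) (s : ℂ) :
    phiPartial a ω n s =
      ∑ m ∈ Finset.range n, a (m + 1) * multExt ω (m + 1) / ((m + 1 : ℕ) : ℂ) ^ s := by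
  rw [phiPartial, Finset.range_eq_Ico,
    Finset.sum_Ico_add' (fun k => a k * (multExt ω k : ℂ) / (k : ℂ) ^ s) 0 n 1]
  rfl

theorem exists_norm_le_of_isBigO {a : ℕ → ℂ} {ε : ℝ}
    (h : a =O[atTop] fun m : ℕ => (m : ℝ) ^ ε) :
    ∃ C : ℝ, 0 ≤ C ∧ ∀ m : ℕ, ‖a (m + 1)‖ ≤ C * ((m : ℝ) + 1) ^ ε := by
  obtain ⟨C, hC, hb⟩ := Asymptotics.bound_of_isBigO_nat_atTop h
  refine ⟨C, hC.le, fun m => ?_⟩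
  have h0 : (0 : ℝ) < ((m + 1 : ℕ) : ℝ) ^ ε := by positivity
  have := hb h0.ne'
  rw [Real.norm_of_nonneg h0.le] at this
  push_cast at this
  exact this

/-- Almost surely the random Dirichlet series converges on `1 / 2 < Re s` to the exponential of the
sum of the logarithms of the local factors. -/
theorem ae_tendsto_phiPartial {a : ℕ → ℂ}
    (hO : ∀ ε : ℝ, 0 < ε → a =O[atTop] fun m : ℕ => (m : ℝ) ^ ε)
    {l : ℕ} {A : Fin l → Nat.Primes → ℂ} (hA : ∀ j p, ‖A j p‖ ≤ 1)
    (ha : ∀ m ≠ 0, a m = eulerCoeff A Finset.univ m) :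
    ∀ᵐ ω ∂(Measure.haarMeasure (⊤ : PositiveCompacts Ω₁)), ∃ H : ℂ → ℂ,
      DifferentiableOn ℂ H {s | 1 / 2 < s.re} ∧
      TendstoLocallyUniformlyOn (fun n s => ∑ m ∈ Finset.range n, eulerLog A m ω s) H atTop
        {s | 1 / 2 < s.re} ∧
      TendstoLocallyUniformlyOn (phiPartial a ω) (fun s => Complex.exp (H s)) atTop
        {s | 1 / 2 < s.re} := by
  have hχ : ∀ m, Measurable fun ω : Ω₁ => multExt ω (m + 1) := fun m =>
    (continuous_multExt (m + 1)).measurable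
  have horth : ∀ m n, m ≠ n → ∫ ω, (multExt ω (m + 1) : ℂ) * starRingEnd ℂ (multExt ω (n + 1))
      ∂(Measure.haarMeasure (⊤ : PositiveCompacts Ω₁)) = 0 := fun m n hmn =>
    integral_multExt_mul_conj m.succ_ne_zero n.succ_ne_zero (by omega)
  have hc1 : ∀ ε : ℝ, 0 < ε → ∃ C : ℝ, ∀ m : ℕ, ‖a (m + 1)‖ ≤ C * ((m : ℝ) + 1) ^ ε :=
    fun ε hε => by
      obtain ⟨C, -, hC⟩ := exists_norm_le_of_isBigO (hO ε hε)
      exact ⟨C, hC⟩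
  have hc2 : ∀ ε : ℝ, 0 < ε → ∃ C : ℝ, ∀ m : ℕ, ‖primeCoeff a m‖ ≤ C * ((m : ℝ) + 1) ^ ε :=
    fun ε hε => by
      obtain ⟨C, hC0, hC⟩ := exists_norm_le_of_isBigO (hO ε hε)
      refine ⟨C, fun m => ?_⟩
      unfold primeCoeff
      split_ifs
      · exact hC m
      · rw [norm_zero]; positivity
  have hbase : ∀ m : ℕ, (m : ℂ) + ((1 : ℝ) : ℂ) = ((m + 1 : ℕ) : ℂ) := fun m => by push_cast; rfl
  have ho : IsOpen {s : ℂ | 1 / 2 < s.re} := isOpen_lt continuous_const Complex.continuous_re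
  -- Orthogonality is used twice: for the full Dirichlet series and for the series restricted to
  -- primes. The latter plus an absolutely convergent remainder is the sum of logarithms.
  filter_upwards [ae_exists_tendstoLocallyUniformlyOn hχ horth one_pos hc1,
    ae_exists_tendstoLocallyUniformlyOn hχ horth one_pos hc2] with ω h1 h2
  obtain ⟨F, hF, hFt⟩ := h1
  obtain ⟨f₀, -, hft⟩ := h2
  simp only [hbase] at hFt hft
  have hsum := hft.add (tendstoLocallyUniformlyOn_remainder hA ha ω)
  have hHt : TendstoLocallyUniformlyOn (fun n s => ∑ m ∈ Finset.range n, eulerLog A m ω s)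
      (f₀ + fun s => ∑' m, (eulerLog A m ω s -
        primeCoeff a m * multExt ω (m + 1) / ((m + 1 : ℕ) : ℂ) ^ s)) atTop {s | 1 / 2 < s.re} := by
    refine hsum.congr fun n s _ => ?_
    simp only [Pi.add_apply, ← Finset.sum_add_distrib, add_sub_cancel]
  set H : ℂ → ℂ := f₀ + fun s => ∑' m, (eulerLog A m ω s -
    primeCoeff a m * multExt ω (m + 1) / ((m + 1 : ℕ) : ℂ) ^ s) with hH
  have hHd : DifferentiableOn ℂ H {s | 1 / 2 < s.re} :=
    hHt.differentiableOn (Eventually.of_forall fun n =>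
      DifferentiableOn.fun_sum fun m _ => differentiableOn_eulerLog hA m ω) ho
  refine ⟨H, hHd, hHt, ?_⟩
  -- The Euler product is available only for Re s > 1; the identity theorem carries it to the
  -- half-plane where both sides are holomorphic.
  have heq : Set.EqOn F (fun s => Complex.exp (H s)) {s | 1 / 2 < s.re} := by
    refine eqOn_of_convex_of_eqOn ho (convex_halfSpace_re_gt _)
      (isOpen_lt continuous_const Complex.continuous_re : IsOpen {s : ℂ | 1 < s.re})
      ⟨2, by norm_num, by norm_num⟩ hF hHd.cexp fun s hs => ?_
    have hs1 : 1 < s.re := hs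
    have hs2 : s ∈ {s : ℂ | 1 / 2 < s.re} := show 1 / 2 < s.re by linarith
    have t1 := tendsto_prod_local hA ha ω hs1
    have t2 := (Complex.continuous_exp.tendsto (H s)).comp (hHt.tendsto_at hs2)
    have t3 := (hasProd_twist hA ha ω hs1).1.hasSum.tendsto_sum_nat
    have t4 := (tendsto_add_atTop_iff_nat 1).2 t3
    have t5 := hFt.tendsto_at hs2
    have e1 : LSeries (fun k => a k * multExt ω k) s = Complex.exp (H s) :=
      tendsto_nhds_unique t1 t2
    refine (tendsto_nhds_unique t5 ?_).trans e1
    refine t4.congr fun n => ?_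
    rw [Finset.sum_range_succ', LSeries.term_zero, add_zero]
    exact Finset.sum_congr rfl fun m _ => LSeries.term_of_ne_zero m.succ_ne_zero _ _
  refine (hFt.congr_right heq).congr fun n s _ => ?_
  exact (phiPartial_eq_sum_range a ω n s).symm

/-! ### The space of analytic functions -/

theorem hasBasis_nhds_hol {D : Opens ℂ} (f : Hol D) :
    (𝓝 f).HasBasis (fun q : Set D × ℝ => IsCompact q.1 ∧ 0 < q.2)
      fun q => {g : Hol D | ∀ z ∈ q.1, ‖g.1 z - f.1 z‖ < q.2} := by
  have h1 := nhds_basis_uniformity'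
    (Metric.uniformity_basis_dist (α := ℂ)).compactConvergenceUniformity (x := (f : C(D, ℂ)))
  have h2 := h1.comap (Subtype.val : Hol D → C(D, ℂ))
  rw [← nhds_subtype_eq_comap] at h2
  refine h2.congr (fun q => Iff.rfl) fun q _ => ?_
  ext g
  simp only [UniformSpace.ball, Set.mem_preimage, Set.mem_ofPred_eq]
  refine forall₂_congr fun z _ => ?_
  rw [dist_comm, dist_eq_norm]

/-- The restriction to `D` of a function that is differentiable on `D`. -/
def toHol (D : Opens ℂ) (g : ℂ → ℂ) (hg : DifferentiableOn ℂ g D) : Hol D :=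
  ⟨⟨fun z => g z, continuousOn_iff_continuous_domRestrict.1 hg.continuousOn⟩, g, hg, fun _ => rfl⟩

theorem toHol_apply {D : Opens ℂ} {g : ℂ → ℂ} (hg : DifferentiableOn ℂ g D) (z : D) :
    (toHol D g hg).1 z = g z := rfl

theorem tendstoLocallyUniformly_of_on {D : Opens ℂ} {F : ℕ → ℂ → ℂ} {g : ℂ → ℂ}
    (h : TendstoLocallyUniformlyOn F g atTop D) :
    TendstoLocallyUniformly (fun n (z : D) => F n z) (fun z : D => g z) atTop :=
  tendstoLocallyUniformlyOn_iff_tendstoLocallyUniformly_comp_coe.1 h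

theorem tendsto_holLim {D : Opens ℂ} {F : ℕ → ℂ → ℂ} {g : ℂ → ℂ} (hg : DifferentiableOn ℂ g D)
    (h : TendstoLocallyUniformlyOn F g atTop D) :
    TendstoLocallyUniformly (fun n (z : D) => F n z) (holLim D F).1 atTop := by
  have hex : ∃ f : Hol D, TendstoLocallyUniformly (fun n (z : D) => F n z) f.1 atTop :=
    ⟨toHol D g hg, tendstoLocallyUniformly_of_on h⟩
  rw [holLim, dif_pos hex]
  exact hex.choose_spec

theorem holLim_apply {D : Opens ℂ} {F : ℕ → ℂ → ℂ} {g : ℂ → ℂ} (hg : DifferentiableOn ℂ g D)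
    (h : TendstoLocallyUniformlyOn F g atTop D) (z : D) : (holLim D F).1 z = g z :=
  tendsto_nhds_unique ((tendstoLocallyUniformlyOn_univ.2 (tendsto_holLim hg h)).tendsto_at
    (Set.mem_univ z)) (h.tendsto_at z.2)

/-- The partial sums depend continuously on ω as elements of the metrizable space H(D), and an
almost everywhere limit of measurable maps is measurable up to a null set. -/
theorem aemeasurable_holLim {Ω : Type*} [MeasurableSpace Ω] [TopologicalSpace Ω]
    [OpensMeasurableSpace Ω] {μ : Measure Ω} {D : Opens ℂ} {F : Ω → ℕ → ℂ → ℂ}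
    (hF : ∀ ω n, DifferentiableOn ℂ (F ω n) D)
    (hc : ∀ n, ContinuousOn (fun q : Ω × ℂ => F q.1 n q.2) (Set.univ ×ˢ (D : Set ℂ)))
    (h : ∀ᵐ ω ∂μ, TendstoLocallyUniformly (fun n (z : D) => F ω n z) (holLim D (F ω)).1 atTop) :
    AEMeasurable (fun ω => holLim D (F ω)) μ := by
  have : LocallyCompactSpace D := D.isOpen.locallyCompactSpace
  have : (uniformity (Hol D)).IsCountablyGenerated := by
    rw [uniformity_subtype]; infer_instance
  have : PseudoMetrizableSpace (Hol D) := UniformSpace.pseudoMetrizableSpace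
  refine aemeasurable_of_tendsto_metrizable_ae (f := fun n ω => toHol D (F ω n) (hF ω n)) atTop
    (fun n => Continuous.aemeasurable ?_) ?_
  · refine Continuous.subtype_mk (ContinuousMap.continuous_of_continuous_uncurry _ ?_) _
    have h1 : Continuous fun q : Ω × D => ((q.1, (q.2 : ℂ)) : Ω × ℂ) := by fun_prop
    exact (hc n).comp_continuous h1 fun q => ⟨Set.mem_univ _, q.2.2⟩
  · filter_upwards [h] with ω hω
    rw [tendsto_subtype_rng]
    exact ContinuousMap.tendsto_of_tendstoLocallyUniformly hω

/-! ### Functions without zeros -/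

theorem convex_rect (σ₁ R : ℝ) : Convex ℝ (rect σ₁ R : Set ℂ) := by
  have h1 : (rect σ₁ R : Set ℂ) = ({s | σ₁ < s.re} ∩ {s | s.re < 1}) ∩
      ({s | -R < s.im} ∩ {s | s.im < R}) := by
    ext s
    change (σ₁ < s.re ∧ s.re < 1 ∧ |s.im| < R) ↔ _
    rw [abs_lt]
    exact ⟨fun h => ⟨⟨h.1, h.2.1⟩, h.2.2⟩, fun h => ⟨h.1.1, h.1.2, h.2⟩⟩
  rw [h1]
  exact ((convex_halfSpace_re_gt _).inter (convex_halfSpace_re_lt _)).inter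
    ((convex_halfSpace_im_gt _).inter (convex_halfSpace_im_lt _))

/-- Hurwitz: the set of functions that have no zero or vanish identically is closed. -/
theorem isClosed_nonvanishingOrZero {D : Opens ℂ} (hD : IsPreconnected (D : Set ℂ)) :
    IsClosed (nonvanishingOrZero D) := by
  rw [← isOpen_compl_iff, isOpen_iff_mem_nhds]
  intro f hf
  obtain ⟨F, hF, hFf⟩ := f.2
  have hf' : ¬((∀ z : D, f.1 z ≠ 0) ∨ f = 0) := hf
  push Not at hf'
  obtain ⟨⟨z₀, hz₀⟩, hf0⟩ := hf'
  have hFa : AnalyticOnNhd ℂ F D := hF.analyticOnNhd D.isOpen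
  have hne : ∀ᶠ z in 𝓝[≠] (z₀ : ℂ), F z ≠ 0 := by
    rcases (hFa z₀ z₀.2).eventually_eq_zero_or_eventually_ne_zero with h | h
    · refine absurd ?_ hf0
      have h1 := hFa.eqOn_zero_of_preconnected_of_eventuallyEq_zero hD z₀.2 h
      refine Subtype.ext (ContinuousMap.ext fun z => ?_)
      rw [hFf z, h1 z.2]
      rfl
    · exact h
  obtain ⟨r, hr0, hr⟩ : ∃ r > 0, Metric.closedBall (z₀ : ℂ) r ⊆
      (D : Set ℂ) ∩ {z | z ≠ z₀ → F z ≠ 0} := by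
    refine Metric.nhds_basis_closedBall.mem_iff.1 (Filter.inter_mem (D.isOpen.mem_nhds z₀.2) ?_)
    exact eventually_nhdsWithin_iff.1 hne
  have hsub : Metric.sphere (z₀ : ℂ) r ⊆ Metric.closedBall (z₀ : ℂ) r :=
    Metric.sphere_subset_closedBall
  obtain ⟨w, hw, hwmin⟩ := (isCompact_sphere (z₀ : ℂ) r).exists_isMinOn
    (NormedSpace.sphere_nonempty.2 hr0.le)
    ((hF.continuousOn.mono fun z hz => (hr (hsub hz)).1).norm)
  have hwne : w ≠ z₀ := by
    rintro rfl
    simp [hr0.ne] at hw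
  have hm0 : 0 < ‖F w‖ := norm_pos_iff.2 ((hr (hsub hw)).2 hwne)
  set K : Set D := Subtype.val ⁻¹' Metric.closedBall (z₀ : ℂ) r with hK
  have hKc : IsCompact K := by
    have himg : (Subtype.val '' K : Set ℂ) = Metric.closedBall (z₀ : ℂ) r := by
      ext z
      exact ⟨by rintro ⟨y, hy, rfl⟩; exact hy, fun hz => ⟨⟨z, (hr hz).1⟩, hz, rfl⟩⟩
    rw [Subtype.isCompact_iff, himg]
    exact isCompact_closedBall _ _
  refine (hasBasis_nhds_hol f).mem_iff.2 ⟨(K, ‖F w‖ / 2), ⟨hKc, half_pos hm0⟩, fun g hg => ?_⟩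
  obtain ⟨G, hG, hGg⟩ := g.2
  have hgF : ∀ z ∈ Metric.closedBall (z₀ : ℂ) r, ‖G z - F z‖ < ‖F w‖ / 2 := by
    intro z hz
    have := hg ⟨z, (hr hz).1⟩ hz
    rwa [hGg, hFf] at this
  have hsph : ∀ z ∈ Metric.sphere (z₀ : ℂ) r, ‖F w‖ / 2 ≤ ‖G z‖ := by
    intro z hz
    have h1 : ‖F w‖ ≤ ‖F z‖ := hwmin hz
    have h2 := hgF z (hsub hz)
    have h3 : ‖F z‖ ≤ ‖G z‖ + ‖G z - F z‖ := by
      have := norm_sub_le (G z) (G z - F z)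
      rwa [sub_sub_cancel] at this
    linarith
  have hcen : ‖G z₀‖ < ‖F w‖ / 2 := by
    have := hgF z₀ (Metric.mem_closedBall_self hr0.le)
    rwa [← hFf, hz₀, sub_zero] at this
  rintro (hgn | hg0)
  · have hGne : ∀ z ∈ Metric.closedBall (z₀ : ℂ) r, G z ≠ 0 := fun z hz => by
      have := hgn ⟨z, (hr hz).1⟩
      rwa [hGg] at this
    -- In place of Rouché, the maximum principle for 1/G: a zero-free G cannot be smaller at the
    -- centre than its minimum on the circle.
    have hd : DiffContOnCl ℂ (fun z => (G z)⁻¹) (Metric.ball (z₀ : ℂ) r) := by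
      refine DifferentiableOn.diffContOnCl_ball (U := Metric.closedBall (z₀ : ℂ) r) ?_ subset_rfl
      exact (hG.mono fun z hz => (hr hz).1).inv hGne
    have hmax := Complex.norm_le_of_forall_mem_frontier_norm_le Metric.isBounded_ball hd
      (C := (‖F w‖ / 2)⁻¹) (fun z hz => ?_) (subset_closure (Metric.mem_ball_self hr0))
    · rw [norm_inv, inv_le_inv₀ (norm_pos_iff.2 (hGne _ (Metric.mem_closedBall_self hr0.le)))
        (half_pos hm0)] at hmax
      linarith
    · rw [frontier_ball _ hr0.ne'] at hz
      rw [norm_inv, inv_le_inv₀ (norm_pos_iff.2 (hGne _ (hsub hz))) (half_pos hm0)]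
      exact hsph z hz
  · have h1 := hsph w hw
    have h2 : G w = 0 := by
      rw [← hGg ⟨w, (hr (hsub hw)).1⟩, hg0]
      rfl
    rw [h2, norm_zero] at h1
    linarith

/-- A zero-free analytic function on a convex open set has an analytic logarithm. -/
theorem exists_log_of_convex {U : Set ℂ} (hU : IsOpen U) (hUc : Convex ℝ U) (hne : U.Nonempty)
    {f : ℂ → ℂ} (hf : DifferentiableOn ℂ f U) (hf0 : ∀ z ∈ U, f z ≠ 0) :
    ∃ g : ℂ → ℂ, DifferentiableOn ℂ g U ∧ ∀ z ∈ U, Complex.exp (g z) = f z := by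
  have hsc : IsSimplyConnected U := by
    have : ContractibleSpace U := hUc.contractibleSpace hne
    exact SimplyConnectedSpace.ofContractible U
  obtain ⟨g, hg, hgf⟩ := Complex.exists_continuousOn_eqOn_exp_comp hsc hU hf.continuousOn
    (by rintro ⟨z, hz, h⟩; exact hf0 z hz h)
  refine ⟨g, fun z hz => ?_, hgf⟩
  have hz' := hU.mem_nhds hz
  have hgz : ContinuousAt g z := hg.continuousAt hz'
  have hfz : DifferentiableAt ℂ f z := hf.differentiableAt hz'
  -- Near z the continuous logarithm g must coincide with this holomorphic one, since the imaginary
  -- part of g(w) - g(z) stays within (-π, π).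
  have hd : DifferentiableAt ℂ (fun w => g z + Complex.log (f w / f z)) z := by
    refine (differentiableAt_const _).add ((hfz.div_const _).clog ?_)
    rw [div_self (hf0 z hz)]
    exact Complex.one_mem_slitPlane
  have him : ∀ᶠ w in 𝓝 z, |(g w - g z).im| < π := by
    have : ContinuousAt (fun w => |(g w - g z).im|) z := by
      have h2 : ContinuousAt (fun w => g w - g z) z := hgz.sub continuousAt_const
      exact (continuous_abs.comp Complex.continuous_im).continuousAt.comp h2
    refine this.eventually_lt continuousAt_const ?_
    simpa using Real.pi_pos
  refine (hd.congr_of_eventuallyEq ?_).differentiableWithinAt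
  filter_upwards [him, hz'] with w hw hwU
  have h1 : f w / f z = Complex.exp (g w - g z) := by
    rw [Complex.exp_sub]
    exact congrArg₂ _ (hgf hwU).symm (hgf hz).symm
  rw [abs_lt] at hw
  rw [h1, Complex.log_exp hw.1 hw.2.le]
  ring

/-! ### Positivity of the probability of approximation -/

/-- If a random series on a compact group has terms that can be modified independently of the tail,
converges almost surely uniformly on `K`, and its partial sums attain values close to `f`, then its
sum is close to `f` with positive probability. -/
theorem measure_approx_pos {G : Type*} [Group G] [TopologicalSpace G] [IsTopologicalGroup G]
    [CompactSpace G] [MeasurableSpace G] [BorelSpace G] {μ : Measure G} [μ.IsMulLeftInvariant]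
    [NeZero μ] {X : ℕ → G → ℂ → ℂ} {K : Set ℂ} (hK : IsCompact K)
    (hmod : ∀ (N : ℕ) (ω c : G), ∃ τ : G, (∀ m, N ≤ m → ∀ ω' s, X m (τ * ω') s = X m ω' s) ∧
      ∀ m < N, ∀ s, X m (τ * ω) s = X m c s)
    (hconv : ∀ᵐ ω ∂μ, ∃ L : ℂ → ℂ,
      TendstoUniformlyOn (fun n s => ∑ m ∈ Finset.range n, X m ω s) L atTop K)
    (hcont : ∀ m, ContinuousOn (fun q : G × ℂ => X m q.1 q.2) (Set.univ ×ˢ K))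
    {f : ℂ → ℂ} (hf : ContinuousOn f K)
    (happ : ∀ ε : ℝ, 0 < ε → ∃ N₁ : ℕ, ∀ N ≥ N₁, ∃ c : G, ∀ s ∈ K,
      ‖∑ m ∈ Finset.range N, X m c s - f s‖ ≤ ε) {ε : ℝ} (hε : 0 < ε) :
    0 < μ {ω | ∀ᶠ n in atTop, ∀ s ∈ K, ‖∑ m ∈ Finset.range n, X m ω s - f s‖ ≤ ε} := by
  have : CompactSpace K := isCompact_iff_compactSpace.1 hK
  set δ : ℝ := ε / 4 with hδ
  have hδ0 : 0 < δ := by positivity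
  obtain ⟨N₁, hN₁⟩ := happ δ hδ0
  set A : ℕ → Set G := fun N =>
    {ω | ∀ n ≥ N, ∀ s ∈ K, ‖∑ m ∈ Finset.Ico N n, X m ω s‖ ≤ 2 * δ} with hA
  -- Almost every ω has a uniformly Cauchy series on K, so the small-tail events with N ≥ N₁ cover
  -- almost everything.
  obtain ⟨N, hN, hAN⟩ : ∃ N ≥ N₁, μ (A N) ≠ 0 := by
    by_contra! hcon
    have h1 : μ (⋃ k : ℕ, A (N₁ + k)) = 0 :=
      measure_iUnion_null fun k => hcon _ (Nat.le_add_right _ _)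
    have h2 : ∀ᵐ ω ∂μ, ω ∈ ⋃ k : ℕ, A (N₁ + k) := by
      filter_upwards [hconv] with ω hω
      obtain ⟨L, hL⟩ := hω
      rw [Metric.tendstoUniformlyOn_iff] at hL
      obtain ⟨N, hN⟩ := eventually_atTop.1 (hL δ hδ0)
      rw [Set.mem_iUnion]
      refine ⟨N, fun n hn s hs => ?_⟩
      rw [Finset.sum_Ico_eq_sub _ hn, ← dist_eq_norm]
      have e1 := hN n (by omega) s hs
      have e2 := hN (N₁ + N) (by omega) s hs
      have := dist_triangle_left (∑ m ∈ Finset.range n, X m ω s)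
        (∑ m ∈ Finset.range (N₁ + N), X m ω s) (L s)
      linarith
    have h3 : μ Set.univ = 0 := by
      refine le_antisymm ?_ zero_le
      calc μ Set.univ ≤ μ ((⋃ k : ℕ, A (N₁ + k)) ∪ (⋃ k : ℕ, A (N₁ + k))ᶜ) :=
            measure_mono (by rw [Set.union_compl_self])
        _ ≤ μ (⋃ k : ℕ, A (N₁ + k)) + μ (⋃ k : ℕ, A (N₁ + k))ᶜ := measure_union_le _ _
        _ = 0 := by rw [h1, zero_add]; exact h2
    exact NeZero.ne μ (Measure.measure_univ_eq_zero.1 h3)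
  obtain ⟨c, hc⟩ := hN₁ N hN
  set B : Set G := {ω | ∀ s : K, ‖∑ m ∈ Finset.range N, X m ω s - f s‖ < 2 * δ} with hB
  have hBo : IsOpen B := by
    rw [isOpen_iff_eventually]
    intro ω hω
    have hcts : Continuous fun q : G × K => ‖∑ m ∈ Finset.range N, X m q.1 q.2 - f q.2‖ := by
      refine Continuous.norm (Continuous.sub (continuous_finsetSum _ fun m _ => ?_) ?_)
      · exact (hcont m).comp_continuous (by fun_prop : Continuous fun q : G × K => (q.1, (q.2 : ℂ)))
          fun q => ⟨Set.mem_univ _, q.2.2⟩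
      · exact hf.comp_continuous (by fun_prop) fun q => q.2.2
    have h1 := (isCompact_univ (X := K)).eventually_forall_of_forall_eventually (x₀ := ω)
      (P := fun ω s => ‖∑ m ∈ Finset.range N, X m ω s - f s‖ < 2 * δ) fun s _ =>
        hcts.continuousAt.eventually_lt continuousAt_const (hω s)
    filter_upwards [h1] with ω' hω' s using hω' s (Set.mem_univ s)
  have hpos : μ (A N ∩ B) ≠ 0 := by
    intro h0
    -- Translations replace independence: τ(ω) resets the first N terms at ω to those of c and
    -- leaves the tail event invariant. By compactness finitely many translates of B cover G, so if
    -- A N ∩ B were null, A N would be null too.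
    choose τ hτ1 hτ2 using fun ω => hmod N ω c
    have hτB : ∀ ω, (fun ω' => τ ω * ω') ⁻¹' B ∈ 𝓝 ω := by
      intro ω
      refine (hBo.preimage (continuous_const_mul _)).mem_nhds fun s => ?_
      rw [Finset.sum_congr rfl fun m hm => hτ2 ω m (Finset.mem_range.1 hm) s]
      exact (hc s s.2).trans_lt (by linarith)
    obtain ⟨t, -, ht⟩ := isCompact_univ.elim_nhds_subcover _ fun ω _ => hτB ω
    refine hAN (le_antisymm ?_ zero_le)
    calc μ (A N) ≤ μ (⋃ ω ∈ t, A N ∩ (fun ω' => τ ω * ω') ⁻¹' B) := by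
          refine measure_mono fun ω hω => ?_
          have := ht (Set.mem_univ ω)
          simp only [Set.mem_iUnion] at this ⊢
          obtain ⟨x, hx, hx'⟩ := this
          exact ⟨x, hx, hω, hx'⟩
      _ ≤ ∑ ω ∈ t, μ (A N ∩ (fun ω' => τ ω * ω') ⁻¹' B) := measure_biUnion_finset_le _ _
      _ ≤ ∑ ω ∈ t, μ ((fun ω' => τ ω * ω') ⁻¹' (A N ∩ B)) := by
          refine Finset.sum_le_sum fun ω _ => measure_mono ?_
          rintro ω' ⟨h1, h2⟩
          refine ⟨fun n hn s hs => ?_, h2⟩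
          rw [Finset.sum_congr rfl fun m hm => hτ1 ω m (Finset.mem_Ico.1 hm).1 ω' s]
          exact h1 n hn s hs
      _ = 0 := by
          refine Finset.sum_eq_zero fun ω _ => ?_
          rw [measure_preimage_mul, h0]
  refine lt_of_lt_of_le (pos_iff_ne_zero.2 hpos) (measure_mono ?_)
  rintro ω ⟨h1, h2⟩
  filter_upwards [eventually_ge_atTop N] with n hn s hs
  have e1 := h1 n hn s hs
  have e2 := h2 ⟨s, hs⟩
  rw [Finset.sum_Ico_eq_sub _ hn] at e1
  calc ‖∑ m ∈ Finset.range n, X m ω s - f s‖ = ‖(∑ m ∈ Finset.range n, X m ω s -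
        ∑ m ∈ Finset.range N, X m ω s) + (∑ m ∈ Finset.range N, X m ω s - f s)‖ := by
        congr 1; ring
    _ ≤ 2 * δ + 2 * δ := (norm_add_le _ _).trans (add_le_add e1 e2.le)
    _ = ε := by rw [hδ]; ring

theorem tendstoUniformlyOn_of_half {F : ℕ → ℂ → ℂ} {g : ℂ → ℂ}
    (h : TendstoLocallyUniformlyOn F g atTop {s | 1 / 2 < s.re}) {K : Set ℂ} (hK : IsCompact K)
    (hKs : K ⊆ {s | 1 / 2 < s.re}) : TendstoUniformlyOn F g atTop K :=
  (tendstoLocallyUniformlyOn_iff_forall_isCompact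
    (isOpen_lt continuous_const Complex.continuous_re)).1 h K hKs hK

theorem rect_subset_half {σ₁ R : ℝ} (hσ : 1 / 2 ≤ σ₁) :
    (rect σ₁ R : Set ℂ) ⊆ {s | 1 / 2 < s.re} := fun _ hs => lt_of_le_of_lt hσ hs.1

/-! ### The Dirichlet series over the shifted integers -/

theorem continuous_coe_circle : Continuous fun z : Circle => (z : ℂ) := by fun_prop

theorem cpow_natCast_add_ne_zero {α : ℝ} (hα : 0 < α) (m : ℕ) (s : ℂ) :
    ((m : ℂ) + α) ^ s ≠ 0 := by
  rw [Complex.cpow_def_of_ne_zero (natCast_add_ne_zero hα m)]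
  exact Complex.exp_ne_zero _

theorem differentiable_div_cpow {α : ℝ} (hα : 0 < α) (m : ℕ) (z : ℂ) :
    Differentiable ℂ fun s : ℂ => z / ((m : ℂ) + α) ^ s := fun _ =>
  (differentiableAt_const _).fun_div
    (differentiableAt_fun_id.const_cpow (Or.inl (natCast_add_ne_zero hα m)))
    (cpow_natCast_add_ne_zero hα m _)

theorem continuous_zetaTerm {α : ℝ} (hα : 0 < α) (m : ℕ) (z : ℂ) :
    Continuous fun q : Ω₂ × ℂ => z * (q.1 m : ℂ) / ((m : ℂ) + α) ^ q.2 := by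
  have h1 : Continuous fun q : Ω₂ × ℂ => (q.1 m : ℂ) :=
    continuous_coe_circle.comp ((continuous_apply m).comp continuous_fst)
  simp only [Complex.cpow_def_of_ne_zero (natCast_add_ne_zero hα m)]
  exact (continuous_const.mul h1).div (by fun_prop) fun _ => Complex.exp_ne_zero _

theorem exists_norm_le_of_periodic {b : ℕ → ℂ} {k : ℕ} (hk : 0 < k) (hb : Function.Periodic b k) :
    ∃ W : ℝ, 0 ≤ W ∧ ∀ m, ‖b m‖ ≤ W := by
  refine ⟨∑ i ∈ Finset.range k, ‖b i‖, Finset.sum_nonneg fun _ _ => norm_nonneg _, fun m => ?_⟩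
  rw [← hb.map_mod_nat m]
  exact Finset.single_le_sum (f := fun i => ‖b i‖) (fun _ _ => norm_nonneg _)
    (Finset.mem_range.2 (Nat.mod_lt m hk))

theorem ae_tendsto_zetaPartial {b : ℕ → ℂ} {k : ℕ} (hk : 0 < k) (hb : Function.Periodic b k)
    {α : ℝ} (hα : 0 < α) :
    ∀ᵐ ω ∂(Measure.haarMeasure (⊤ : PositiveCompacts Ω₂)), ∃ H : ℂ → ℂ,
      DifferentiableOn ℂ H {s | 1 / 2 < s.re} ∧
      TendstoLocallyUniformlyOn (zetaPartial b α ω) H atTop {s | 1 / 2 < s.re} := by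
  obtain ⟨W, hW0, hW⟩ := exists_norm_le_of_periodic hk hb
  refine ae_exists_tendstoLocallyUniformlyOn (χ := fun m (ω : Ω₂) => ω m)
    (fun m => (continuous_apply m).measurable) (fun m n hmn => integral_coord_mul_conj hmn) hα
    fun ε hε => ⟨W, fun m => (hW m).trans (le_mul_of_one_le_right hW0 ?_)⟩
  exact Real.one_le_rpow (by linarith [(Nat.cast_nonneg m : (0 : ℝ) ≤ m)]) hε.le

/-- The coordinates of `Ω₂` are the coefficients themselves, so `measure_approx_pos` applies
directly to the terms of the series. -/
theorem zeta_measure_pos {b : ℕ → ℂ} {k : ℕ} (hk : 0 < k) (hb : Function.Periodic b k)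
    (hb₀ : ∃ m, b m ≠ 0) {α : ℝ} (hα : 0 < α) {R : ℝ} (f : Hol (rect (1 / 2) R))
    {U : Set (Hol (rect (1 / 2) R))} (hU : U ∈ 𝓝 f) :
    0 < Measure.haarMeasure (⊤ : PositiveCompacts Ω₂)
      {ω | holLim (rect (1 / 2) R) (zetaPartial b α ω) ∈ U} := by
  obtain ⟨⟨K, ε⟩, ⟨hK, hε⟩, hKU⟩ := (hasBasis_nhds_hol f).mem_iff.1 hU
  simp only at hK hε hKU
  obtain ⟨F, hF, hFf⟩ := f.2
  obtain ⟨W, -, hW⟩ := exists_norm_le_of_periodic hk hb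
  obtain ⟨m₀, hm₀⟩ := hb₀
  set K' : Set ℂ := Subtype.val '' K with hK'
  have hKc : IsCompact K' := hK.image continuous_subtype_val
  have hKr : K' ⊆ rect (1 / 2) R := by rintro _ ⟨z, -, rfl⟩; exact z.2
  have hpos := measure_approx_pos (μ := Measure.haarMeasure (⊤ : PositiveCompacts Ω₂))
    (X := fun m ω s => b m * (ω m : ℂ) / ((m : ℂ) + α) ^ s) hKc ?_ ?_
    (fun m => (continuous_zetaTerm hα m (b m)).continuousOn) (hF.continuousOn.mono hKr) ?_
    (half_pos hε)
  · refine lt_of_lt_of_le hpos ?_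
    refine measure_mono_ae ?_
    filter_upwards [ae_tendsto_zetaPartial hk hb hα] with ω hω hev
    obtain ⟨H, hH, hHt⟩ := hω
    have hev' : ∀ᶠ n in atTop, ∀ s ∈ K', ‖zetaPartial b α ω n s - F s‖ ≤ ε / 2 := hev
    refine hKU fun z hz => ?_
    have hsub : (rect (1 / 2) R : Set ℂ) ⊆ {s | 1 / 2 < s.re} := rect_subset_half le_rfl
    rw [holLim_apply (hH.mono hsub) (hHt.mono hsub), hFf]
    refine lt_of_le_of_lt (le_of_tendsto ((hHt.tendsto_at (hsub z.2)).sub_const (F z)).norm ?_)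
      (half_lt_self hε)
    filter_upwards [hev'] with n hn using hn z ⟨z, hz, rfl⟩
  · intro N ω c
    refine ⟨fun m => if m < N then c m * (ω m)⁻¹ else 1, fun m hm ω' s => ?_, fun m hm s => ?_⟩
    · simp [not_lt.2 hm]
    · simp [hm]
  · filter_upwards [ae_tendsto_zetaPartial hk hb hα] with ω hω
    obtain ⟨H, -, hHt⟩ := hω
    exact ⟨H, tendstoUniformlyOn_of_half hHt hKc (hKr.trans (rect_subset_half le_rfl))⟩
  · intro η hη
    obtain ⟨y, hy⟩ := exists_circle_sum_approx hα (logDense_periodic hk hb hm₀ α) hW le_rfl hKc hKr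
      hη
    -- The first y coordinates are set to 1 and their terms moved to the target; this is allowed
    -- because y was fixed before the target.
    have hd : DifferentiableOn ℂ (fun s => F s - ∑ m ∈ Finset.range y, b m / ((m : ℂ) + α) ^ s)
        (rect (1 / 2) R) := by
      refine hF.sub (DifferentiableOn.fun_sum fun m _ => ?_)
      exact (differentiable_div_cpow hα m (b m)).differentiableOn
    obtain ⟨N₀, hN₀⟩ := hy y le_rfl _ hd
    refine ⟨max N₀ y, fun N hN => ?_⟩
    obtain ⟨c, hc⟩ := hN₀ N (le_of_max_le_left hN)
    refine ⟨fun m => if m < y then 1 else c m, fun s hs => ?_⟩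
    refine le_trans (le_of_eq ?_) (hc s hs)
    rw [← Finset.sum_range_add_sum_Ico _ (le_of_max_le_right hN)]
    have e1 : ∑ m ∈ Finset.range y, b m * ((if m < y then 1 else c m : Circle) : ℂ) /
        ((m : ℂ) + α) ^ s = ∑ m ∈ Finset.range y, b m / ((m : ℂ) + α) ^ s :=
      Finset.sum_congr rfl fun m hm => by simp [Finset.mem_range.1 hm]
    have e2 : ∑ m ∈ Finset.Ico y N, b m * ((if m < y then 1 else c m : Circle) : ℂ) /
        ((m : ℂ) + α) ^ s = ∑ m ∈ Finset.Ico y N, b m * c m / ((m : ℂ) + α) ^ s :=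
      Finset.sum_congr rfl fun m hm => by simp [not_lt.2 (Finset.mem_Ico.1 hm).1]
    rw [e1, e2]
    congr 1
    ring

/-! ### The Euler product component -/

section

variable {l : ℕ} {A : Fin l → Nat.Primes → ℂ} {a : ℕ → ℂ}

theorem eulerLog_congr (m : ℕ) {ω ω' : Ω₁}
    (h : ∀ hp : (m + 1).Prime, ω ⟨m + 1, hp⟩ = ω' ⟨m + 1, hp⟩) (s : ℂ) :
    eulerLog A m ω s = eulerLog A m ω' s := by
  unfold eulerLog
  split_ifs with hp
  · rw [h hp]
  · rfl

theorem norm_prime_coeff_le (hA : ∀ j p, ‖A j p‖ ≤ 1)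
    (ha : ∀ m ≠ 0, a m = eulerCoeff A Finset.univ m) (p : ℕ) (hp : p.Prime) : ‖a p‖ ≤ l := by
  have h1 : a p = ∑ j, A j ⟨p, hp⟩ :=
    (ha p hp.ne_zero).trans (eulerCoeff_apply_prime A ⟨p, hp⟩ Finset.univ)
  rw [h1]
  refine (norm_sum_le _ _).trans ((Finset.sum_le_sum fun j _ => hA j ⟨p, hp⟩).trans ?_)
  simp

theorem norm_primeCoeff_le (hA : ∀ j p, ‖A j p‖ ≤ 1)
    (ha : ∀ m ≠ 0, a m = eulerCoeff A Finset.univ m) (m : ℕ) : ‖primeCoeff a m‖ ≤ l := by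
  unfold primeCoeff
  split_ifs with h
  · exact norm_prime_coeff_le hA ha _ h
  · simp

/-- Beyond y the logarithms are replaced by their linear terms with total error at most ε/2,
whatever the coordinates; the linear terms are handled by density, with p = m + 1 as the index shift
and α = 1. -/
theorem exists_eulerLog_approx (hA : ∀ j p, ‖A j p‖ ≤ 1)
    (ha : ∀ m ≠ 0, a m = eulerCoeff A Finset.univ m) (hdense : LogDense 1 (primeCoeff a))
    {σ₀ R : ℝ} (hσ : 1 / 2 < σ₀) {K : Set ℂ} (hK : IsCompact K) (hKr : K ⊆ rect σ₀ R)
    {F : ℂ → ℂ} (hF : DifferentiableOn ℂ F (rect σ₀ R)) {ε : ℝ} (hε : 0 < ε) :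
    ∃ N₁ : ℕ, ∀ N ≥ N₁, ∃ c : Ω₁, ∀ s ∈ K,
      ‖∑ m ∈ Finset.range N, eulerLog A m c s - F s‖ ≤ ε := by
  obtain ⟨y₀, hy₀⟩ := exists_circle_sum_approx one_pos hdense (norm_primeCoeff_le hA ha) hσ.le hK
    hKr (half_pos hε)
  obtain ⟨y₁, hy₁⟩ := exists_sum_rpow_tail_le (α := 1) (W := √(2 * l)) hσ (half_pos hε)
  set y : ℕ := max y₀ y₁ with hy
  have hd : DifferentiableOn ℂ (fun s => F s - ∑ m ∈ Finset.range y, eulerLog A m 1 s)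
      (rect σ₀ R) := by
    refine hF.sub (DifferentiableOn.fun_sum fun m _ => ?_)
    exact (differentiableOn_eulerLog hA m 1).mono (rect_subset_half hσ.le)
  obtain ⟨N₀, hN₀⟩ := hy₀ y (le_max_left _ _) _ hd
  refine ⟨max N₀ y, fun N hN => ?_⟩
  obtain ⟨c, hc⟩ := hN₀ N (le_of_max_le_left hN)
  set c' : Ω₁ := fun p => if (p : ℕ) - 1 < y then 1 else c ((p : ℕ) - 1) with hc'
  refine ⟨c', fun s hs => ?_⟩
  have hs1 : σ₀ < s.re := (hKr hs).1
  rw [← Finset.sum_range_add_sum_Ico _ (le_of_max_le_right hN)]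
  have e1 : ∑ m ∈ Finset.range y, eulerLog A m c' s = ∑ m ∈ Finset.range y, eulerLog A m 1 s :=
    Finset.sum_congr rfl fun m hm => eulerLog_congr m (fun hp => by
      have : m + 1 - 1 < y := Finset.mem_range.1 hm
      exact if_pos this) s
  have e2 : ∀ m ∈ Finset.Ico y N, primeCoeff a m * (multExt c' (m + 1) : ℂ) /
      ((m + 1 : ℕ) : ℂ) ^ s = primeCoeff a m * c m / ((m : ℂ) + ((1 : ℝ) : ℂ)) ^ s := by
    intro m hm
    have hbase : (m : ℂ) + ((1 : ℝ) : ℂ) = ((m + 1 : ℕ) : ℂ) := by push_cast; rfl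
    rw [hbase]
    unfold primeCoeff
    split_ifs with hp
    · have h1 : (multExt c' (m + 1) : ℂ) = c' ⟨m + 1, hp⟩ :=
        (multExt_eq_cmult c' m.succ_ne_zero).trans (cmult_prime _ ⟨m + 1, hp⟩)
      have h2 : c' ⟨m + 1, hp⟩ = c m :=
        if_neg (show ¬m + 1 - 1 < y from not_lt.2 (Finset.mem_Ico.1 hm).1)
      rw [h1, h2]
    · simp
  have e3 : ‖∑ m ∈ Finset.Ico y N, (eulerLog A m c' s - primeCoeff a m * (multExt c' (m + 1) : ℂ) /
      ((m + 1 : ℕ) : ℂ) ^ s)‖ ≤ ε / 2 := by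
    refine (norm_sum_le _ _).trans ((Finset.sum_le_sum fun m _ => ?_).trans
      (hy₁ y (le_max_right _ _) N))
    refine (norm_eulerLog_sub_le hA ha m c' (by linarith)).trans ?_
    have hm : (0 : ℝ) ≤ m := Nat.cast_nonneg m
    rw [Real.sq_sqrt (by positivity), abs_of_pos (by positivity)]
    exact mul_le_mul_of_nonneg_left
      (Real.rpow_le_rpow_of_exponent_le (by linarith) (by linarith)) (by positivity)
  rw [Finset.sum_sub_distrib, Finset.sum_congr rfl e2] at e3
  rw [e1]
  have e4 := hc s hs
  have e5 := (norm_add_le _ _).trans (add_le_add e3 e4)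
  rw [add_halves] at e5
  refine le_trans (le_of_eq ?_) e5
  congr 1
  ring

/-- A logarithm of f exists on the convex rectangle. The sum of local logarithms is close to it on K
with positive probability, and exponentiation transfers this to f. -/
theorem phi_measure_pos
    (hO : ∀ ε : ℝ, 0 < ε → a =O[atTop] fun m : ℕ => (m : ℝ) ^ ε)
    (hA : ∀ j p, ‖A j p‖ ≤ 1)
    (ha : ∀ m ≠ 0, a m = eulerCoeff A Finset.univ m) (hdense : LogDense 1 (primeCoeff a))
    {σ₀ R : ℝ} (hσ : 1 / 2 < σ₀) (f : Hol (rect σ₀ R)) (hf : ∀ z, f.1 z ≠ 0)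
    {U : Set (Hol (rect σ₀ R))} (hU : U ∈ 𝓝 f) :
    0 < Measure.haarMeasure (⊤ : PositiveCompacts Ω₁)
      {ω | holLim (rect σ₀ R) (phiPartial a ω) ∈ U} := by
  obtain ⟨⟨K, ε⟩, ⟨hK, hε⟩, hKU⟩ := (hasBasis_nhds_hol f).mem_iff.1 hU
  simp only at hK hε hKU
  rcases (rect σ₀ R : Set ℂ).eq_empty_or_nonempty with hemp | hne
  · have hall : ∀ g : Hol (rect σ₀ R), g ∈ U := fun g => hKU fun z _ =>
      absurd z.2 (by rw [← SetLike.mem_coe, hemp]; exact Set.notMem_empty _)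
    simp [hall]
  obtain ⟨F₀, hF₀, hFf⟩ := f.2
  obtain ⟨F, hF, hFe⟩ := exists_log_of_convex (rect σ₀ R).isOpen (convex_rect σ₀ R) hne hF₀
    fun z hz => by have := hf ⟨z, hz⟩; rwa [hFf] at this
  set K' : Set ℂ := Subtype.val '' K with hK'
  have hKc : IsCompact K' := hK.image continuous_subtype_val
  have hKr : K' ⊆ rect σ₀ R := by rintro _ ⟨z, -, rfl⟩; exact z.2
  have hsub : (rect σ₀ R : Set ℂ) ⊆ {s | 1 / 2 < s.re} := rect_subset_half hσ.le
  obtain ⟨B, hB⟩ := hKc.exists_bound_of_continuousOn (hF₀.continuousOn.mono hKr)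
  -- Chosen for |e^w - 1| ≤ 2|w|, valid for |w| ≤ 1: with |f| ≤ |B| + 1 on K the error after
  -- exponentiation is at most ε/2.
  set δ : ℝ := min 1 (ε / (4 * (|B| + 1))) with hδ
  have hδ0 : 0 < δ := lt_min one_pos (by positivity)
  have hpos := measure_approx_pos (μ := Measure.haarMeasure (⊤ : PositiveCompacts Ω₁))
    (X := eulerLog A) hKc ?_ ?_
    (fun m => (continuousOn_eulerLog hA m).mono (Set.prod_mono_right (hKr.trans hsub)))
    (hF.continuousOn.mono hKr)
    (fun η hη => exists_eulerLog_approx hA ha hdense hσ hKc hKr hF hη) hδ0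
  · refine lt_of_lt_of_le hpos (measure_mono_ae ?_)
    filter_upwards [ae_tendsto_phiPartial hO hA ha] with ω hω hev
    obtain ⟨H, hH, hHt, hφ⟩ := hω
    refine hKU fun z hz => ?_
    have hzK : (z : ℂ) ∈ K' := ⟨z, hz, rfl⟩
    rw [holLim_apply (hH.cexp.mono hsub) (hφ.mono hsub), hFf]
    have h1 : ‖H z - F z‖ ≤ δ := by
      refine le_of_tendsto ((hHt.tendsto_at (hsub z.2)).sub_const (F z)).norm ?_
      filter_upwards [(show ∀ᶠ n in atTop, ∀ s ∈ K',
        ‖∑ m ∈ Finset.range n, eulerLog A m ω s - F s‖ ≤ δ from hev)] with n hn using hn z hzK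
    have h2 := Complex.norm_exp_sub_one_le (h1.trans (min_le_left _ _))
    have h3 : Complex.exp (H z) - F₀ z = F₀ z * (Complex.exp (H z - F z) - 1) := by
      rw [Complex.exp_sub, hFe z z.2]
      have : F₀ z ≠ 0 := by have := hf z; rwa [hFf] at this
      field_simp
    rw [h3, norm_mul]
    have h4 : ‖F₀ z‖ ≤ |B| + 1 := (hB z hzK).trans ((le_abs_self B).trans (by linarith))
    have h5 : δ ≤ ε / (4 * (|B| + 1)) := min_le_right _ _
    calc ‖F₀ z‖ * ‖Complex.exp (H z - F z) - 1‖ ≤ (|B| + 1) * (2 * (ε / (4 * (|B| + 1)))) :=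
          mul_le_mul h4 (by linarith) (norm_nonneg _) (by positivity)
      _ = ε / 2 := by field_simp; ring
      _ < ε := half_lt_self hε
  · intro N ω c
    refine ⟨fun p => if (p : ℕ) - 1 < N then c p * (ω p)⁻¹ else 1, fun m hm ω' s => ?_,
      fun m hm s => ?_⟩
    · refine eulerLog_congr m (fun hp => ?_) s
      have h1 : ¬m + 1 - 1 < N := not_lt.2 hm
      have h2 : (fun p : Nat.Primes => if (p : ℕ) - 1 < N then c p * (ω p)⁻¹ else 1) ⟨m + 1, hp⟩ =
        1 := if_neg h1
      exact (congrArg (· * ω' ⟨m + 1, hp⟩) h2).trans (one_mul _)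
    · refine eulerLog_congr m (fun hp => ?_) s
      have h1 : m + 1 - 1 < N := hm
      have h2 : (fun p : Nat.Primes => if (p : ℕ) - 1 < N then c p * (ω p)⁻¹ else 1) ⟨m + 1, hp⟩ =
        c ⟨m + 1, hp⟩ * (ω ⟨m + 1, hp⟩)⁻¹ := if_pos h1
      exact (congrArg (· * ω ⟨m + 1, hp⟩) h2).trans (inv_mul_cancel_right _ _)
  · filter_upwards [ae_tendsto_phiPartial hO hA ha] with ω hω
    obtain ⟨H, -, hHt, -⟩ := hω
    exact ⟨H, tendstoUniformlyOn_of_half hHt hKc (hKr.trans hsub)⟩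

end

/-! ### Regularity of the partial sums and the position of σ* -/

theorem continuous_phiTerm (k : ℕ) (z : ℂ) :
    Continuous fun q : Ω₁ × ℂ => z * (multExt q.1 (k + 1) : ℂ) / ((k + 1 : ℕ) : ℂ) ^ q.2 := by
  have h0 : ((k + 1 : ℕ) : ℂ) ≠ 0 := by exact_mod_cast k.succ_ne_zero
  have h1 : Continuous fun q : Ω₁ × ℂ => (multExt q.1 (k + 1) : ℂ) :=
    continuous_coe_circle.comp ((continuous_multExt (k + 1)).comp continuous_fst)
  simp only [Complex.cpow_def_of_ne_zero h0]
  exact (continuous_const.mul h1).div (by fun_prop) fun _ => Complex.exp_ne_zero _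

theorem differentiable_phiPartial (a : ℕ → ℂ) (ω : Ω₁) (n : ℕ) :
    Differentiable ℂ (phiPartial a ω n) := by
  have h : phiPartial a ω n = fun s => ∑ m ∈ Finset.range n,
      a (m + 1) * multExt ω (m + 1) / ((m : ℂ) + ((1 : ℝ) : ℂ)) ^ s := by
    funext s
    rw [phiPartial_eq_sum_range]
    push_cast
    rfl
  rw [h]
  exact Differentiable.fun_sum fun m _ => differentiable_div_cpow one_pos m _

theorem differentiable_zetaPartial (b : ℕ → ℂ) {α : ℝ} (hα : 0 < α) (ω : Ω₂) (n : ℕ) :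
    Differentiable ℂ (zetaPartial b α ω n) :=
  Differentiable.fun_sum fun m _ => differentiable_div_cpow hα m _

/-- Some admissible σ₁ < σ₀ has a convergent mean-square series, which forces σ₁ ≥ 1/2. As σ₁ < 1,
the excluded line causes no trouble. -/
theorem half_lt_of_sigmaStar_lt {φ : ℂ → ℂ} {a : ℕ → ℂ} (hφ : IsSteuding φ a) {σ₀ : ℝ}
    (h : sigmaStar φ a < (σ₀ : EReal)) (h₁ : σ₀ < 1) : 1 / 2 < σ₀ := by
  obtain ⟨_, ⟨σ₁, ⟨-, hσ₁⟩, rfl⟩, hlt⟩ := sInf_lt_iff.1 h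
  have hlt' : σ₁ < σ₀ := EReal.coe_lt_coe_iff.1 hlt
  obtain ⟨κ, hκ, hlim⟩ := hφ.prime_mean
  exact (half_le_of_summable hκ hlim (hσ₁ σ₁ le_rfl (by linarith)).1).trans_lt hlt'

end MixedUniversality

end

open MixedUniversality in
/-- The two random series converge almost surely, uniformly on compacta, to the components of the
random element `Z`, which is measurable up to a null set, and the support of its distribution is
`S_φ × H(D_T)`. -/
theorem theorem4 (φ : ℂ → ℂ) (a : ℕ → ℂ) (hφ : IsSteuding φ a)
    (α h : ℝ) (hα₀ : 0 < α) (hα₁ : α ≤ 1) (hh : 0 < h)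
    (hL : LinearIndepOn ℚ id (logSet α h))
    (b : ℕ → ℂ) (k : ℕ) (hk : 0 < k) (hb : Function.Periodic b k) (hb₀ : ∃ m, b m ≠ 0)
    (σ₀ M T : ℝ) (hσ₀ : sigmaStar φ a < (σ₀ : EReal)) (hσ₁ : σ₀ < 1) (hM : 0 < M) (hT : 0 < T) :
    (∀ᵐ ω ∂mH,
      TendstoLocallyUniformly (fun n (z : rect σ₀ M) => phiPartial a ω.1 n z)
        (Z a b α (rect σ₀ M) (rect (1 / 2) T) ω).1.1 atTop ∧
      TendstoLocallyUniformly (fun n (z : rect (1 / 2) T) => zetaPartial b α ω.2 n z)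
        (Z a b α (rect σ₀ M) (rect (1 / 2) T) ω).2.1 atTop) ∧
    AEMeasurable (Z a b α (rect σ₀ M) (rect (1 / 2) T)) mH ∧
    (PZ a b α (rect σ₀ M) (rect (1 / 2) T)).support =
      nonvanishingOrZero (rect σ₀ M) ×ˢ (Set.univ : Set (Hol (rect (1 / 2) T))) := by
  obtain ⟨l, A, hA, ha⟩ := hφ.exists_eulerCoeff
  obtain ⟨κ, hκ, hlim⟩ := hφ.prime_mean
  have hσ : 1 / 2 < σ₀ := half_lt_of_sigmaStar_lt hφ hσ₀ hσ₁
  have hdense : LogDense 1 (primeCoeff a) := logDense_primes hκ (norm_prime_coeff_le hA ha) hlim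
  have hsub₁ : (rect σ₀ M : Set ℂ) ⊆ {s | 1 / 2 < s.re} := rect_subset_half hσ.le
  have hsub₂ : (rect (1 / 2) T : Set ℂ) ⊆ {s | 1 / 2 < s.re} := rect_subset_half le_rfl
  have hφae := ae_tendsto_phiPartial hφ.coeff_isBigO hA ha
  have hζae := ae_tendsto_zetaPartial hk hb hα₀
  have hconv₁ : ∀ᵐ ω ∂(Measure.haarMeasure (⊤ : PositiveCompacts Ω₁)),
      TendstoLocallyUniformly (fun n (z : rect σ₀ M) => phiPartial a ω n z)
        (holLim (rect σ₀ M) (phiPartial a ω)).1 atTop ∧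
      ∀ z, (holLim (rect σ₀ M) (phiPartial a ω)).1 z ≠ 0 := by
    filter_upwards [hφae] with ω hω
    obtain ⟨H, hH, -, hHt⟩ := hω
    refine ⟨tendsto_holLim (hH.cexp.mono hsub₁) (hHt.mono hsub₁), fun z => ?_⟩
    rw [holLim_apply (hH.cexp.mono hsub₁) (hHt.mono hsub₁)]
    exact Complex.exp_ne_zero _
  have hconv₂ : ∀ᵐ ω ∂(Measure.haarMeasure (⊤ : PositiveCompacts Ω₂)),
      TendstoLocallyUniformly (fun n (z : rect (1 / 2) T) => zetaPartial b α ω n z)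
        (holLim (rect (1 / 2) T) (zetaPartial b α ω)).1 atTop := by
    filter_upwards [hζae] with ω hω
    obtain ⟨H, hH, hHt⟩ := hω
    exact tendsto_holLim (hH.mono hsub₂) (hHt.mono hsub₂)
  have hfst : Measure.QuasiMeasurePreserving (Prod.fst : Ω₁ × Ω₂ → Ω₁) mH
    (Measure.haarMeasure (⊤ : PositiveCompacts Ω₁)) := Measure.quasiMeasurePreserving_fst
  have hsnd : Measure.QuasiMeasurePreserving (Prod.snd : Ω₁ × Ω₂ → Ω₂) mH
    (Measure.haarMeasure (⊤ : PositiveCompacts Ω₂)) := Measure.quasiMeasurePreserving_snd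
  have hmeas₁ : AEMeasurable (fun ω => holLim (rect σ₀ M) (phiPartial a ω))
      (Measure.haarMeasure (⊤ : PositiveCompacts Ω₁)) := by
    refine aemeasurable_holLim (fun ω n => (differentiable_phiPartial a ω n).differentiableOn)
      (fun n => Continuous.continuousOn ?_) (hconv₁.mono fun ω h => h.1)
    simp only [phiPartial_eq_sum_range]
    exact continuous_finsetSum _ fun m _ => continuous_phiTerm m _
  have hmeas₂ : AEMeasurable (fun ω => holLim (rect (1 / 2) T) (zetaPartial b α ω))
      (Measure.haarMeasure (⊤ : PositiveCompacts Ω₂)) := by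
    refine aemeasurable_holLim
      (fun ω n => (differentiable_zetaPartial b hα₀ ω n).differentiableOn)
      (fun n => Continuous.continuousOn ?_) hconv₂
    exact continuous_finsetSum _ fun m _ => continuous_zetaTerm hα₀ m _
  have hmeas : AEMeasurable (Z a b α (rect σ₀ M) (rect (1 / 2) T)) mH :=
    (hmeas₁.comp_quasiMeasurePreserving hfst).prodMk (hmeas₂.comp_quasiMeasurePreserving hsnd)
  refine ⟨?_, hmeas, Set.Subset.antisymm ?_ ?_⟩
  · filter_upwards [hfst.ae hconv₁, hsnd.ae hconv₂] with ω h₁ h₂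
    exact ⟨h₁.1, h₂⟩
  -- A closed set of full measure contains the support.
  · have hclosed : IsClosed (nonvanishingOrZero (rect σ₀ M) ×ˢ
        (Set.univ : Set (Hol (rect (1 / 2) T)))) :=
      (isClosed_nonvanishingOrZero (convex_rect σ₀ M).isPreconnected).prod isClosed_univ
    have := borelSpace_prod (rect σ₀ M) (rect (1 / 2) T)
    refine Measure.support_subset_of_isClosed hclosed ?_
    rw [PZ, mem_ae_map_iff hmeas hclosed.measurableSet]
    filter_upwards [hfst.ae hconv₁] with ω h₁
    exact ⟨Or.inl h₁.2, Set.mem_univ _⟩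
  · have hpos : ∀ (f : Hol (rect σ₀ M)) (g : Hol (rect (1 / 2) T)), (∀ z, f.1 z ≠ 0) →
        (f, g) ∈ (PZ a b α (rect σ₀ M) (rect (1 / 2) T)).support := by
      intro f g hf
      rw [Measure.mem_support_iff_forall]
      intro U hU
      obtain ⟨U₁, hU₁, U₂, hU₂, hUU⟩ := mem_nhds_prod_iff.1 hU
      refine lt_of_lt_of_le ?_ ((measure_mono hUU).trans' (Measure.le_map_apply hmeas _))
      change 0 < mH ({ω | holLim (rect σ₀ M) (phiPartial a ω) ∈ U₁} ×ˢ
        {ω | holLim (rect (1 / 2) T) (zetaPartial b α ω) ∈ U₂})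
      rw [mH, Measure.prod_prod]
      exact ENNReal.mul_pos
        (phi_measure_pos hφ.coeff_isBigO hA ha hdense hσ f hf hU₁).ne'
        (zeta_measure_pos hk hb hb₀ hα₀ g hU₂).ne'
    rintro ⟨f, g⟩ ⟨hf | rfl, -⟩
    · exact hpos f g hf
    -- The zero function has no logarithm, so it is reached as the limit of the zero-free constants
    -- 1/(n+1) in the closed support.
    · have hclosed : IsClosed (PZ a b α (rect σ₀ M) (rect (1 / 2) T)).support :=
        Measure.isClosed_support
      have hconst : ∀ n : ℕ, DifferentiableOn ℂ (fun _ : ℂ => 1 / ((n : ℂ) + 1)) (rect σ₀ M) :=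
        fun n => differentiableOn_const _
      have hto : Tendsto (fun n : ℕ => toHol (rect σ₀ M) _ (hconst n)) atTop (𝓝 0) := by
        refine (hasBasis_nhds_hol _).tendsto_right_iff.2 fun q hq => ?_
        have := tendsto_one_div_add_atTop_nhds_zero_nat (𝕜 := ℂ)
        filter_upwards [(Metric.tendsto_nhds.1 this) q.2 hq.2] with n hn z _
        rw [dist_eq_norm] at hn
        exact hn
      refine hclosed.mem_of_tendsto (hto.prodMk_nhds tendsto_const_nhds)
        (Eventually.of_forall fun n => hpos _ g fun z => ?_)
      rw [toHol_apply]
      exact one_div_ne_zero (by exact_mod_cast n.succ_ne_zero)
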